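/- **Setting.** Let $K\ge 2$, $\epsilon_0>0$, $\delta\in(0,1)$. Let $\nu=(\nu_i)_{i\in[K]}$ be any instance of $1$-sub-Gaussian distributions, i.e. $\mathbb E_{\nu_i}[e^{\lambda(X-\mathbb E X)}]\le e^{\lambda^2/2}$ for all $\lambda\in\mathbb R$, with means $\mu=(\mu_i)_i$ (several arms may be best). Put $\mu_\star=\max_i\mu_i$, $\Delta_i=\mu_\star-\mu_i$, $\mathcal I_\epsilon(\mu)=\{i:\mu_i\ge\mu_\star-\epsilon\}$, $i^\star(\mu)=\mathcal I_0(\mu)$. At each round $n\ge1$ the learner pulls an arm $I_n$ chosen from the history and receives a reward $X_n$ with conditional law $\nu_{I_n}$ given the history. Let $N_{n,i}$ and $\mu_{n,i}$ be the number of pulls and the empirical mean of arm $i$ before round $n$. **Algorithm** (EB-TC$_{\epsilon_0}$, fixed $\beta=1/2$). The first $K$ rounds pull every arm once. At a round $n>K$ the leader (also the recommendation $\hat\imath_n$) is $B_n\in\arg\max_i\mu_{n,i}$, the challenger is $C_n\in\arg\min_{i\ne B_n}\frac{\mu_{n,B_n}-\mu_{n,i}+\epsilon_0}{\sqrt{1/N_{n,B_n}+1/N_{n,i}}}$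 (ties broken arbitrarily); with $T_n(i,j)=|\{K<t<n:(B_t,C_t)=(i,j)\}|$ and $N^i_{n,j}=|\{K<t<n:(B_t,C_t)=(i,j),I_t=j\}|$, the arm pulled is $I_n=C_n$ if $N^{B_n}_{n,C_n}\le\frac12\,T_{n+1}(B_n,C_n)$ and $I_n=B_n$ otherwise. For $\epsilon\ge0$ the stopping time is $$\tau_{\epsilon,\delta}=\inf\Big\{n>K:\ \min_{i\ne\hat\imath_n}\tfrac{\mu_{n,\hat\imath_n}-\mu_{n,i}+\epsilon}{\sqrt{1/N_{n,\hat\imath_n}+1/N_{n,i}}}\ge\sqrt{2c(n-1,\delta)}\Big\},\quad c(n,\delta)=2\mathcal C_G\big(\tfrac12\log\tfrac{K-1}\delta\big)+4\log\big(4+\log\tfrac n2\big),$$ where $\mathcal C_G(x)=\min_{\lambda\in(1/2,1]}\frac{g_G(\lambda)+x}\lambda$ and $g_G(\lambda)=2\lambda-2\lambda\log(4\lambda)+\log\zeta(2\lambda)-\frac12\log(1-\lambda)$. **Complexities.** For an arm $i$, let $T_i\in(0,\infty]$ and $w^{(i)}$ be given by $T_i^{-1}=\max_{w}\min_{j\ne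 i}\frac12\frac{(\mu_i-\mu_j+\epsilon_0)^2}{2+1/w_j}$, the maximum being over $w$ in the simplex with $w_i=\frac12$, and $w^{(i)}$ a maximizer (these are $T_{\epsilon_0,1/2}(\mu,i)$ and $w_{\epsilon_0,1/2}(\mu,i)$). For $\epsilon\in[0,\epsilon_0]$ let $\Delta_\mu(\epsilon)=\min_{k\notin\mathcal I_\epsilon(\mu)}\Delta_k$ (with $\min\emptyset=+\infty$), $C(\epsilon)=\max\{2\Delta_\mu(\epsilon)^{-1}-\epsilon_0^{-1},\epsilon_0^{-1}\}$, $$H(\epsilon)=\frac{2|i^\star(\mu)|}{\Delta_\mu(\epsilon)^2}+|\mathcal I_\epsilon(\mu)\setminus i^\star(\mu)|\,C(\epsilon)^2+\sum_{i\notin\mathcal I_\epsilon(\mu)}\max\{C(\epsilon),\sqrt2\,\Delta_i^{-1}\}^2,\qquad v(\epsilon)=\frac{\min_{i\in\mathcal I_\epsilon(\mu)}T_i}{\sum_{i\in\mathcal I_\epsilon(\mu)}T_i}.$$ Let $h_1(z,y)=z\,\overline W_{-1}(\log z+y/z)$ for $z>0$ and $h_1(0,y)=y$ (its limit), where $\overline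 W_{-1}(x)=-W_{-1}(-e^{-x})$ for $x\ge1$ and $W_{-1}$ is the negative branch of the Lambert function. If $\sum_{i\in\mathcal I_\epsilon(\mu)}T_i=\infty$ (possible only for $\epsilon=\epsilon_0$), the terms $T$ below, hence the bounds at this $\epsilon$, are $+\infty$. **Theorem.** (1) The algorithm with stopping time $\tau_{\epsilon_0,\delta}$ is $(\epsilon_0,\delta)$-PAC: $\mathbb P_\nu(\tau_{\epsilon_0,\delta}<\infty,\ \hat\imath_{\tau_{\epsilon_0,\delta}}\notin\mathcal I_{\epsilon_0}(\mu))\le\delta$. More generally, for every $\epsilon_1\ge\epsilon_0$ the algorithm with stopping time $\tau_{\epsilon_1,\delta}$ is $(\epsilon_1,\delta)$-PAC, and $\mathbb E_\nu[\tau_{\epsilon_1,\delta}]\le\mathbb E_\nu[\tau_{\epsilon_0,\delta}]$. (2) For every $\gamma\in(0,1/2]$, $$\mathbb E_\nu[\tau_{\epsilon_0,\delta}]\le\inf_{\tilde\epsilon\in[0,\epsilon_0]}\max\{T(\delta,\tilde\epsilon)+1,\ S(\tilde\epsilon)\}+2K^2,$$ $$T(\delta,\tilde\epsilon)=\sup\Big\{n>K:\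 n-1\le2(1+\gamma)^2\sum_{i\in\mathcal I_{\tilde\epsilon}(\mu)}T_i\,\big(\sqrt{c(n-1,\delta)}+\sqrt{4\log n}\big)^2\Big\},$$ $$S(\tilde\epsilon)=h_1\Big(\frac{16(1+\gamma^{-1})}{a(\tilde\epsilon)}H(\tilde\epsilon),\ \frac{(1+\gamma^{-1})K^2}{a(\tilde\epsilon)}+1\Big),\qquad a(\tilde\epsilon)=v(\tilde\epsilon)\min_{i\in\mathcal I_{\tilde\epsilon}(\mu),\,j\ne i}w^{(i)}_j.$$ (3) (Refined bound.) For every $\gamma\in(0,1/2]$ and $s>1$, $$\mathbb E_\nu[\tau_{\epsilon_0,\delta}]\le\inf_{(\epsilon,x)\in[0,\epsilon_0]\times[0,\frac1{K-1}]}\max\{T(\delta,\epsilon,x)+1,\ S(\epsilon,x)\}+\zeta(s)\frac{K(K+1)}2,$$ where, with $d(x,i)=|\{j\ne i:w^{(i)}_j<x/2\}|$ and $d(\epsilon,x)=\max_{i\in\mathcal I_\epsilon(\mu)}d(x,i)$, $$T(\delta,\epsilon,x)=\sup\Big\{n>K:\ n-1\le\frac{2(1+\gamma)^2\sum_{i\in\mathcal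 I_\epsilon(\mu)}T_i}{(1-x)^{d(\epsilon,x)}}\big(\sqrt{c(n-1,\delta)}+\sqrt{(2+s)\log n}\big)^2\Big\},$$ $$S(\epsilon,x)=h_1\Big(\frac{4(2+s)(1+\gamma^{-1})}{a(\epsilon,x)v(\epsilon)}H(\epsilon),\ \frac{(1+\gamma^{-1})(3K^2/4+1)}{a(\epsilon,x)v(\epsilon)}+1\Big),$$ $$a(\epsilon,x)=\min_{i\in\mathcal I_\epsilon(\mu)}(1-x)^{d(x,i)}\max\{\min_{j\ne i}w^{(i)}_j,\ x/2\}.$$ -/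

import Mathlib

open MeasureTheory ProbabilityTheory
open scoped ENNReal

noncomputable section

namespace EBTC

/-! ### Instances -/

/-- A distribution `ρ` on `ℝ` is 1-sub-Gaussian: `E[exp (t (X - E X))] ≤ exp (t ^ 2 / 2)` for all
real `t` (all these exponential moments being finite). -/
def IsOneSubGaussian (ρ : Measure ℝ) : Prop :=
  HasSubgaussianMGF (fun x : ℝ => x - ∫ y, y ∂ρ) 1 ρ

/-- The vector of means `μ` of the instance `ν`. -/
def means {K : ℕ} (ν : Fin K → Measure ℝ) : Fin K → ℝ := fun i => ∫ x, x ∂(ν i)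

/-- The largest mean `μ_⋆`. -/
def maxMean {K : ℕ} (μ : Fin K → ℝ) : ℝ := ⨆ i, μ i

/-- The gap `Δ_i = μ_⋆ - μ_i`. -/
def gap {K : ℕ} (μ : Fin K → ℝ) (i : Fin K) : ℝ := maxMean μ - μ i

/-- The set of `ε`-good arms. -/
def goodArms {K : ℕ} (μ : Fin K → ℝ) (ε : ℝ) : Finset (Fin K) :=
  Finset.univ.filter fun i => maxMean μ - ε ≤ μ i

/-- The set of best arms. -/
def bestArms {K : ℕ} (μ : Fin K → ℝ) : Finset (Fin K) :=
  Finset.univ.filter fun i => μ i = maxMean μ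

/-! ### Interaction with the bandit

Rounds are numbered `1, 2, …`.  `ℱ n` is what the learner knows before round `n` (the past arms
and rewards, and possibly some extra randomness), `I n` is the arm pulled at round `n` and `X n`
the reward then received. -/

/-- `(I, X)` is a (non-anticipating) interaction with the instance `ν`: `I n` is known before the
round `n`, `X n` is known after it, and the conditional distribution of `X n` given `ℱ n` is
`ν (I n)`. -/
structure IsBanditRun {K : ℕ} {Ω : Type*} {mΩ : MeasurableSpace Ω} (P : Measure Ω)
    (ν : Fin K → Measure ℝ) (ℱ : Filtration ℕ mΩ) (I : ℕ → Ω → Fin K) (X : ℕ → Ω → ℝ) : Prop where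
  arm_measurable : ∀ n, 1 ≤ n → Measurable[ℱ n] (I n)
  reward_measurable : ∀ n, 1 ≤ n → Measurable[ℱ (n + 1)] (X n)
  reward_law : ∀ n, 1 ≤ n → ∀ i : Fin K, ∀ A : Set Ω, MeasurableSet[ℱ n] A →
    ∀ s : Set ℝ, MeasurableSet s →
      P (A ∩ I n ⁻¹' {i} ∩ X n ⁻¹' s) = P (A ∩ I n ⁻¹' {i}) * ν i s

/-! ### The sampling rule, along one trajectory

`I`, `X`, `B`, `C` are the sequences of pulled arms, rewards, leaders and challengers. -/

/-- `N_{n,i}`: number of pulls of arm `i` before time `n`. -/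
def pulls {K : ℕ} (I : ℕ → Fin K) (n : ℕ) (i : Fin K) : ℕ :=
  ((Finset.Ico 1 n).filter fun t => I t = i).card

/-- `μ_{n,i}`: empirical mean of arm `i` before time `n`. -/
def empMean {K : ℕ} (I : ℕ → Fin K) (X : ℕ → ℝ) (n : ℕ) (i : Fin K) : ℝ :=
  (∑ t ∈ (Finset.Ico 1 n).filter (fun t => I t = i), X t) / (pulls I n i : ℝ)

/-- The empirical transportation cost with slack `ε` of arm `j` with respect to arm `i`:
`(μ_{n,i} - μ_{n,j} + ε) / √(1 / N_{n,i} + 1 / N_{n,j})`. -/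
def transportCost {K : ℕ} (ε : ℝ) (I : ℕ → Fin K) (X : ℕ → ℝ) (n : ℕ) (i j : Fin K) : ℝ :=
  (empMean I X n i - empMean I X n j + ε) /
    Real.sqrt (1 / (pulls I n i : ℝ) + 1 / (pulls I n j : ℝ))

/-- `T_n(i,j)`: number of rounds before `n` with leader `i` and challenger `j`.  Leaders and
challengers exist only at the rounds `t > K`. -/
def pairCount {K : ℕ} (B C : ℕ → Fin K) (n : ℕ) (i j : Fin K) : ℕ :=
  ((Finset.Ioo K n).filter fun t => B t = i ∧ C t = j).card

/-- `N^i_{n,j}`: number of those rounds before `n` with leader `i` and challenger `j` at which the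
challenger `j` was pulled. -/
def challengerPulls {K : ℕ} (I B C : ℕ → Fin K) (n : ℕ) (i j : Fin K) : ℕ :=
  ((Finset.Ioo K n).filter fun t => (B t = i ∧ C t = j) ∧ I t = j).card

/-- The trajectory follows the sampling rule EB-TC with slack `ε₀` and fixed proportion `β`,
ties in the choices of leader and challenger being broken arbitrarily. The recommendation at
time `n > K` is the leader `B n`. -/
structure FollowsEBTC {K : ℕ} (ε₀ β : ℝ) (I B C : ℕ → Fin K) (X : ℕ → ℝ) : Prop where
  /-- The first `K` rounds sample each of the `K` arms once. -/
  init : ∀ i, ∃ t ∈ Finset.Icc 1 K, I t = i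
  leader : ∀ n, K < n → ∀ i, empMean I X n i ≤ empMean I X n (B n)
  challenger_ne : ∀ n, K < n → C n ≠ B n
  challenger : ∀ n, K < n → ∀ i, i ≠ B n →
    transportCost ε₀ I X n (B n) (C n) ≤ transportCost ε₀ I X n (B n) i
  tracking : ∀ n, K < n →
    I n = if (challengerPulls I B C n (B n) (C n) : ℝ)
        ≤ (1 - β) * (pairCount B C (n + 1) (B n) (C n) : ℝ) then C n else B n

/-! ### The stopping rule -/

/-- `g_G(l) = 2 l - 2 l log (4 l) + log ζ(2 l) - log (1 - l) / 2`. -/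
def gG (l : ℝ) : ℝ :=
  2 * l - 2 * l * Real.log (4 * l) + Real.log (riemannZeta ((2 * l : ℝ) : ℂ)).re
    - Real.log (1 - l) / 2

/-- `C_G(x) = min_{1/2 < l ≤ 1} (g_G(l) + x) / l`. As `g_G(1) = +∞`, the point `l = 1` is left
out (in Lean `Real.log 0 = 0`). -/
def CG (x : ℝ) : ℝ := ⨅ l : Set.Ioo (1 / 2 : ℝ) 1, (gG l + x) / (l : ℝ)

/-- The threshold `c(t, δ) = 2 C_G(log ((K - 1) / δ) / 2) + 4 log (4 + log (t / 2))`. -/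
def threshold (K : ℕ) (t δ : ℝ) : ℝ :=
  2 * CG (Real.log (((K : ℝ) - 1) / δ) / 2) + 4 * Real.log (4 + Real.log (t / 2))

/-- The GLR stopping time `τ_{ε,δ}` with error `ε` and confidence `δ` (`⊤` if the algorithm does
not stop). -/
def stoppingTime {K : ℕ} (ε δ : ℝ) (I B : ℕ → Fin K) (X : ℕ → ℝ) : ℕ∞ :=
  ⨅ n ∈ {n : ℕ | K < n ∧ ∀ i, i ≠ B n →
    Real.sqrt (2 * threshold K ((n : ℝ) - 1) δ) ≤ transportCost ε I X n (B n) i}, (n : ℕ∞)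

/-! ### Characteristic times and optimal allocations -/

/-- The allocations `w` of the simplex with `w i = β`. -/
def allocations {K : ℕ} (β : ℝ) (i : Fin K) : Set (Fin K → ℝ) :=
  {w | w ∈ stdSimplex ℝ (Fin K) ∧ w i = β}

/-- `min_{j ≠ i} (1 / 2) (μ_i - μ_j + ε) ^ 2 / (1 / β + 1 / w_j)`, where `1 / (1 / β + 1 / w_j)` is
written `β w_j / (β + w_j)`, which has the right value `0` also at `w_j = 0`. -/
def allocationValue {K : ℕ} (ε β : ℝ) (μ : Fin K → ℝ) (i : Fin K) (w : Fin K → ℝ) : ℝ :=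
  ⨅ j : {j : Fin K // j ≠ i}, 1 / 2 * (μ i - μ j + ε) ^ 2 * (β * w j / (β + w j))

/-- The characteristic time `T_{ε,β}(μ,i)`, the inverse of the largest allocation value. It is
`⊤` exactly when this largest value is `0`. -/
def charTime {K : ℕ} (ε β : ℝ) (μ : Fin K → ℝ) (i : Fin K) : ℝ≥0∞ :=
  (ENNReal.ofReal (sSup (allocationValue ε β μ i '' allocations β i)))⁻¹

/-- `w` is a `β`-optimal allocation for the arm `i`. -/
def IsOptimalAllocation {K : ℕ} (ε β : ℝ) (μ : Fin K → ℝ) (i : Fin K) (w : Fin K → ℝ) : Prop :=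
  w ∈ allocations β i ∧ ∀ w' ∈ allocations β i, allocationValue ε β μ i w' ≤ allocationValue ε β μ i w

/-- The optimal allocation `w_{ε,β}(μ,i)`. A maximizer always exists (see below); it is unique
whenever `μ_i - μ_j + ε > 0` for all `j ≠ i`. -/
def optAlloc {K : ℕ} (ε β : ℝ) (μ : Fin K → ℝ) (i : Fin K) : Fin K → ℝ :=
  Classical.epsilon (IsOptimalAllocation ε β μ i)

theorem optAlloc_spec {K : ℕ} (hK : 2 ≤ K) (ε : ℝ) {β : ℝ} (h0 : 0 < β) (h1 : β < 1)
    (μ : Fin K → ℝ) (i : Fin K) : IsOptimalAllocation ε β μ i (optAlloc ε β μ i) := by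
  have hnt : Nontrivial (Fin K) := Fin.nontrivial_iff_two_le.mpr hK
  obtain ⟨j₀, hj₀⟩ := exists_ne i
  have hne : Nonempty {j : Fin K // j ≠ i} := ⟨⟨j₀, hj₀⟩⟩
  have hcomp : IsCompact (allocations (K := K) β i) :=
    (isCompact_stdSimplex ℝ (Fin K)).inter_right
      (isClosed_eq (continuous_apply i) continuous_const)
  have hnonempty : (allocations (K := K) β i).Nonempty := by
    refine ⟨Pi.single i β + Pi.single j₀ (1 - β), ⟨fun k => ?_, ?_⟩, ?_⟩
    · have h2 : 0 ≤ (Pi.single i β : Fin K → ℝ) k := by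
        rw [Pi.single_apply]; split_ifs <;> linarith
      have h3 : 0 ≤ (Pi.single j₀ (1 - β) : Fin K → ℝ) k := by
        rw [Pi.single_apply]; split_ifs <;> linarith
      exact add_nonneg h2 h3
    · simp [Finset.sum_add_distrib]
    · simp [hj₀.symm]
  have hcont : ContinuousOn (allocationValue ε β μ i) (allocations β i) := by
    have h : ContinuousOn (fun w : Fin K → ℝ => Finset.univ.inf' Finset.univ_nonempty
        fun j : {j : Fin K // j ≠ i} =>
          1 / 2 * (μ i - μ j + ε) ^ 2 * (β * w j / (β + w j))) (allocations β i) := by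
      refine ContinuousOn.finset_inf'_apply _ fun j _ => ?_
      refine continuousOn_const.mul (ContinuousOn.div (by fun_prop) (by fun_prop) ?_)
      intro w hw
      have := hw.1.1 (j : Fin K)
      linarith
    refine h.congr fun w _ => ?_
    exact (Finset.inf'_univ_eq_ciInf _).symm
  obtain ⟨w, hw, hmax⟩ := hcomp.exists_isMaxOn hnonempty hcont
  exact Classical.epsilon_spec (p := IsOptimalAllocation ε β μ i) ⟨w, hw, fun w' hw' => hmax hw'⟩

/-! ### The terms of the bounds -/

/-- `Δ_μ(ε) = min_{k not ε-good} Δ_k`. If all arms are `ε`-good, the minimum over the empty set is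
`+∞`; it is used only through its inverse, which is then `0`, as in Lean. -/
def minBadGap {K : ℕ} (μ : Fin K → ℝ) (ε : ℝ) : ℝ :=
  ⨅ k : {k : Fin K // k ∉ goodArms μ ε}, gap μ k

/-- `C_{μ,ε₀}(ε) = max {2 / Δ_μ(ε) - 1 / ε₀, 1 / ε₀}`. -/
def Cconst {K : ℕ} (μ : Fin K → ℝ) (ε₀ ε : ℝ) : ℝ :=
  max (2 * (minBadGap μ ε)⁻¹ - ε₀⁻¹) ε₀⁻¹

/-- The complexity `H_{μ,ε₀}(ε)`. -/
def Hconst {K : ℕ} (μ : Fin K → ℝ) (ε₀ ε : ℝ) : ℝ :=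
  2 * ((bestArms μ).card : ℝ) * (minBadGap μ ε)⁻¹ ^ 2
    + ((goodArms μ ε \ bestArms μ).card : ℝ) * Cconst μ ε₀ ε ^ 2
    + ∑ i ∈ (goodArms μ ε)ᶜ, max (Cconst μ ε₀ ε) (Real.sqrt 2 * (gap μ i)⁻¹) ^ 2

/-- The negative branch `W_{-1}` of the Lambert function: for `-1/e ≤ u < 0`, the only `w ≤ -1`
with `w exp w = u`. -/
def lambertWNeg (u : ℝ) : ℝ := sSup {w : ℝ | w ≤ -1 ∧ w * Real.exp w = u}

/-- `x ↦ - W_{-1}(- exp (- x))`, for `x ≥ 1`. -/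
def Wbar (x : ℝ) : ℝ := -lambertWNeg (-Real.exp (-x))

/-- `h₁(z,y) = z Wbar(y / z + log z)` for `z > 0`, extended by its limit `h₁(0,y) = y`. -/
def h1 (z y : ℝ) : ℝ := if z = 0 then y else z * Wbar (y / z + Real.log z)

/-- `∑_{i ∈ I_ε(μ)} T_{ε₀,1/2}(μ,i)`. -/
def sumTime {K : ℕ} (μ : Fin K → ℝ) (ε₀ ε : ℝ) : ℝ≥0∞ :=
  ∑ i ∈ goodArms μ ε, charTime ε₀ (1 / 2) μ i

/-- `v_{μ,ε₀}(ε)`: the ratio of `min_{i ∈ I_ε(μ)} T_{ε₀,1/2}(μ,i)` to `sumTime μ ε₀ ε`. -/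
def timeRatio {K : ℕ} (μ : Fin K → ℝ) (ε₀ ε : ℝ) : ℝ :=
  ((⨅ i ∈ goodArms μ ε, charTime ε₀ (1 / 2) μ i) / sumTime μ ε₀ ε).toReal

/-- `min_{j ≠ i} w_{ε₀,1/2}(μ,i)_j`. -/
def minAlloc {K : ℕ} (μ : Fin K → ℝ) (ε₀ : ℝ) (i : Fin K) : ℝ :=
  ⨅ j : {j : Fin K // j ≠ i}, optAlloc ε₀ (1 / 2) μ i j

/-- `sup {n > K | n - 1 ≤ Q (√c(n - 1, δ) + √(b log n)) ^ 2}`. -/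
def largestTime (K : ℕ) (δ : ℝ) (Q : ℝ≥0∞) (b : ℝ) : ℝ≥0∞ :=
  ⨆ n ∈ {n : ℕ | K < n ∧ ENNReal.ofReal ((n : ℝ) - 1) ≤
    Q * ENNReal.ofReal
      ((Real.sqrt (threshold K ((n : ℝ) - 1) δ) + Real.sqrt (b * Real.log n)) ^ 2)}, (n : ℝ≥0∞)

/-- The `δ`-dependent term `T_{μ,ε₀}(δ,ε)`. -/
def Tterm {K : ℕ} (μ : Fin K → ℝ) (ε₀ γ δ ε : ℝ) : ℝ≥0∞ :=
  largestTime K δ (ENNReal.ofReal (2 * (1 + γ) ^ 2) * sumTime μ ε₀ ε) 4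

/-- `a_{μ,ε₀}(ε)`. -/
def aconst {K : ℕ} (μ : Fin K → ℝ) (ε₀ ε : ℝ) : ℝ :=
  timeRatio μ ε₀ ε * ⨅ i : {i : Fin K // i ∈ goodArms μ ε}, minAlloc μ ε₀ i

/-- The `δ`-independent term `S_{μ,ε₀}(ε)`. -/
def Sterm {K : ℕ} (μ : Fin K → ℝ) (ε₀ γ ε : ℝ) : ℝ :=
  h1 (16 * (1 + γ⁻¹) / aconst μ ε₀ ε * Hconst μ ε₀ ε)
    ((1 + γ⁻¹) * (K : ℝ) ^ 2 / aconst μ ε₀ ε + 1)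

/-! ### The terms of the refined bound -/

/-- `d_{μ,ε₀}(x,i)`: the number of arms `j ≠ i` with `w_{ε₀,1/2}(μ,i)_j < x / 2`. -/
def numClipped {K : ℕ} (μ : Fin K → ℝ) (ε₀ x : ℝ) (i : Fin K) : ℕ :=
  (Finset.univ.filter fun j => j ≠ i ∧ optAlloc ε₀ (1 / 2) μ i j < x / 2).card

/-- `d_{μ,ε₀}(ε,x)`: the maximum of `d_{μ,ε₀}(x,i)` over `ε`-good arms `i`. -/
def maxNumClipped {K : ℕ} (μ : Fin K → ℝ) (ε₀ ε x : ℝ) : ℕ :=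
  (goodArms μ ε).sup (numClipped μ ε₀ x)

/-- `T_{μ,ε₀}(δ,ε,x)`. -/
def TtermRefined {K : ℕ} (μ : Fin K → ℝ) (ε₀ γ s δ ε x : ℝ) : ℝ≥0∞ :=
  largestTime K δ
    (ENNReal.ofReal (2 * (1 + γ) ^ 2 / (1 - x) ^ maxNumClipped μ ε₀ ε x) * sumTime μ ε₀ ε) (2 + s)

/-- `a_{μ,ε₀}(ε,x)`. -/
def aconstRefined {K : ℕ} (μ : Fin K → ℝ) (ε₀ ε x : ℝ) : ℝ :=
  ⨅ i : {i : Fin K // i ∈ goodArms μ ε},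
    (1 - x) ^ numClipped μ ε₀ x i * max (minAlloc μ ε₀ i) (x / 2)

/-- `S_{μ,ε₀}(ε,x)`. -/
def StermRefined {K : ℕ} (μ : Fin K → ℝ) (ε₀ γ s ε x : ℝ) : ℝ :=
  h1 (4 * (2 + s) * (1 + γ⁻¹) / (aconstRefined μ ε₀ ε x * timeRatio μ ε₀ ε) * Hconst μ ε₀ ε)
    ((1 + γ⁻¹) * (3 * (K : ℝ) ^ 2 / 4 + 1) / (aconstRefined μ ε₀ ε x * timeRatio μ ε₀ ε) + 1)

end EBTC

end

/-!
The proof has a probabilistic and a combinatorial side.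

*Correctness.* For a vector `θ` of parameters, the process
`exp (∑_t θ_{I_t} (X_t - μ_{I_t}) - θ_{I_t} ^ 2 / 2)` is a nonnegative supermartingale
(`IsBanditRun.lintegral_expMart_succ_le`), and so is its mixture over the parameters of two arms.
With a suitable countable mixture of Gaussian priors (`slicePrior`) for each arm, the mixture
dominates `exp (l (N (μ̂ - μ) ^ 2 / 2 - 2 log (4 + log N)) - g_G l)`
(`le_mixture_slicePrior`), so that Ville's inequality controls the self-normalized deviations of two
arms uniformly in time; this is where the function `C_G` and the iterated logarithm of the threshold
come from (`IsBanditRun.measure_CG_lt_deviation_le`). If a bad arm is recommended, then by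
Cauchy-Schwarz this arm and a fixed best arm deviate jointly (`threshold_lt_deviation`), and a union
bound over the other `K - 1` arms concludes.

*Expected stopping time.* Let `n` be a time before stopping at which all the differences of empirical
means have been, up to time `n`, within `√(2 (2 + s) log n)` standard deviations of the true
differences (`Concentrated`); this fails with probability at most `K (K - 1) / 2 * n ^ (-s)`. Then:

* a leader which is not `ε`-good is empirically better than the best arms, and the challenger has a
  smaller transportation cost than a best arm, so that the leader or the challenger has few pulls
  (`FollowsEBTC.pulls_le_of_bad`); as tracking pulls each of the two at about half of the rounds,
  such rounds are logarithmically many, with a constant governed by `H` (`FollowsEBTC.card_bad_le`);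
* hence some `ε`-good arm `i` has been the leader for at least its share `m` of the remaining rounds,
  the shares being proportional to the characteristic times. Among the last `m / 2` of these rounds,
  some challenger `j` is chosen at least as often as the (clipped) optimal allocation prescribes; at
  the last such round both arms have many pulls, while the stopping rule does not hold
  (`FollowsEBTC.exists_gap_sq_le`), which bounds `m` by the characteristic time of `i` multiplied by
  the threshold (`FollowsEBTC.sub_one_le`).

So `n` is at most the `δ`-dependent term unless it is at most the `δ`-independent one, which the
function `h₁` turns into an inequality between `n` and `log n` (`add_mul_log_lt_of_h1_lt`). Summing
the failure probabilities gives the factor `ζ s`. The first bound is the case `s = 2`, `x = 0`.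
-/

namespace EBTC

/-! ### Exponential supermartingales -/

/-- If every increment of a nonnegative adapted process is nonpositive on average, the process
exceeds a level `c` with probability at most its initial mean over `c` (Ville's inequality). -/
theorem ville {Ω : Type*} {mΩ : MeasurableSpace Ω} (P : Measure Ω) (ℱ : Filtration ℕ mΩ)
    (M : ℕ → Ω → ℝ≥0∞) (hM : ∀ n, 1 ≤ n → Measurable[ℱ n] (M n))
    (hstep : ∀ n, 1 ≤ n → ∀ A, MeasurableSet[ℱ n] A →
      ∫⁻ ω in A, M (n + 1) ω ∂P ≤ ∫⁻ ω in A, M n ω ∂P) (c : ℝ≥0∞) :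
    c * P {ω | ∃ n, 1 ≤ n ∧ c ≤ M n ω} ≤ ∫⁻ ω, M 1 ω ∂P := by
  -- the event that the level has not been reached up to time `n`
  set A : ℕ → Set Ω := fun n => {ω | ∀ k, 1 ≤ k → k ≤ n → M k ω < c} with hA
  have hAmeas : ∀ n, MeasurableSet[ℱ n] (A n) := by
    intro n
    have : A n = ⋂ k, ⋂ (_ : 1 ≤ k), ⋂ (_ : k ≤ n), {ω | M k ω < c} := by
      ext ω; simp [hA]
    rw [this]
    refine MeasurableSet.iInter fun k => MeasurableSet.iInter fun hk => MeasurableSet.iInter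
      fun hkn => ?_
    exact ℱ.mono hkn _ (hM k hk measurableSet_Iio)
  have hset : ∀ n, 1 ≤ n → MeasurableSet {ω | c ≤ M n ω} := fun n hn =>
    measurableSet_le measurable_const ((hM n hn).mono (ℱ.le n) le_rfl)
  have key : ∀ n, 1 ≤ n →
      c * P {ω | ∃ k, 1 ≤ k ∧ k ≤ n ∧ c ≤ M k ω} + ∫⁻ ω in A n, M n ω ∂P ≤ ∫⁻ ω, M 1 ω ∂P := by
    intro n hn
    induction n, hn using Nat.le_induction with
    | base =>
      have h1 : {ω | ∃ k, 1 ≤ k ∧ k ≤ 1 ∧ c ≤ M k ω} = {ω | c ≤ M 1 ω} := by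
        ext ω
        constructor
        · rintro ⟨k, h1, h2, h3⟩
          obtain rfl : k = 1 := by omega
          exact h3
        · intro h; exact ⟨1, le_rfl, le_rfl, h⟩
      have h2 : A 1 = {ω | c ≤ M 1 ω}ᶜ := by
        ext ω
        simp only [hA, Set.mem_ofPred_eq, Set.mem_compl_iff, not_le]
        constructor
        · intro h; exact h 1 le_rfl le_rfl
        · intro h k h1 h2
          obtain rfl : k = 1 := by omega
          exact h
      rw [h1, h2, ← lintegral_add_compl (μ := P) (M 1) (hset 1 le_rfl)]
      gcongr
      rw [← setLIntegral_const]
      exact setLIntegral_mono' (hset 1 le_rfl) fun ω hω => hω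
    | succ n hn ih =>
      have hs := hset (n + 1) (by omega)
      have hAn : MeasurableSet (A n) := ℱ.le n _ (hAmeas n)
      have h1 : {ω | ∃ k, 1 ≤ k ∧ k ≤ n + 1 ∧ c ≤ M k ω} ⊆
          {ω | ∃ k, 1 ≤ k ∧ k ≤ n ∧ c ≤ M k ω} ∪ (A n ∩ {ω | c ≤ M (n + 1) ω}) := by
        rintro ω ⟨k, hk1, hk2, hk3⟩
        by_cases h : ω ∈ A n
        · right
          refine ⟨h, ?_⟩
          rcases Nat.lt_or_ge n k with h' | h'
          · obtain rfl : k = n + 1 := by omega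
            exact hk3
          · exact absurd hk3 (not_le.2 (h k hk1 h'))
        · left
          simp only [hA, Set.mem_ofPred_eq, not_forall, not_lt] at h
          obtain ⟨k, a, b, d⟩ := h
          exact ⟨k, a, b, d⟩
      have h2 : A (n + 1) = A n ∩ {ω | c ≤ M (n + 1) ω}ᶜ := by
        ext ω
        simp only [hA, Set.mem_ofPred_eq, Set.mem_inter_iff, Set.mem_compl_iff, not_le]
        constructor
        · intro h; exact ⟨fun k a b => h k a (by omega), h _ (by omega) le_rfl⟩
        · rintro ⟨h, h'⟩ k a b
          rcases Nat.lt_or_ge n k with h'' | h''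
          · obtain rfl : k = n + 1 := by omega
            exact h'
          · exact h k a h''
      calc c * P {ω | ∃ k, 1 ≤ k ∧ k ≤ n + 1 ∧ c ≤ M k ω} + ∫⁻ ω in A (n + 1), M (n + 1) ω ∂P
          ≤ c * (P {ω | ∃ k, 1 ≤ k ∧ k ≤ n ∧ c ≤ M k ω} + P (A n ∩ {ω | c ≤ M (n + 1) ω}))
            + ∫⁻ ω in A (n + 1), M (n + 1) ω ∂P := by
              gcongr
              exact (measure_mono h1).trans (measure_union_le _ _)
        _ = c * P {ω | ∃ k, 1 ≤ k ∧ k ≤ n ∧ c ≤ M k ω} + (c * P (A n ∩ {ω | c ≤ M (n + 1) ω})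
            + ∫⁻ ω in A n ∩ {ω | c ≤ M (n + 1) ω}ᶜ, M (n + 1) ω ∂P) := by
              rw [h2, mul_add, add_assoc]
        _ ≤ c * P {ω | ∃ k, 1 ≤ k ∧ k ≤ n ∧ c ≤ M k ω} +
            (∫⁻ ω in A n ∩ {ω | c ≤ M (n + 1) ω}, M (n + 1) ω ∂P
            + ∫⁻ ω in A n ∩ {ω | c ≤ M (n + 1) ω}ᶜ, M (n + 1) ω ∂P) := by
              gcongr
              rw [← setLIntegral_const]
              exact setLIntegral_mono' (hAn.inter hs) fun ω hω => hω.2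
        _ = c * P {ω | ∃ k, 1 ≤ k ∧ k ≤ n ∧ c ≤ M k ω} + ∫⁻ ω in A n, M (n + 1) ω ∂P := by
              rw [← Set.sdiff_eq, lintegral_inter_add_sdiff _ _ hs]
        _ ≤ c * P {ω | ∃ k, 1 ≤ k ∧ k ≤ n ∧ c ≤ M k ω} + ∫⁻ ω in A n, M n ω ∂P := by
              gcongr c * _ + ?_
              exact hstep n hn _ (hAmeas n)
        _ ≤ _ := ih
  have hU : {ω | ∃ n, 1 ≤ n ∧ c ≤ M n ω} = ⋃ n : ℕ, {ω | ∃ k, 1 ≤ k ∧ k ≤ n + 1 ∧ c ≤ M k ω} := by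
    ext ω
    simp only [Set.mem_ofPred_eq, Set.mem_iUnion]
    constructor
    · rintro ⟨n, h1, h2⟩; exact ⟨n, n, h1, by omega, h2⟩
    · rintro ⟨n, k, h1, h2, h3⟩; exact ⟨k, h1, h3⟩
  have hmono : Monotone fun n : ℕ => {ω | ∃ k, 1 ≤ k ∧ k ≤ n + 1 ∧ c ≤ M k ω} := by
    rintro n m hnm ω ⟨k, h1, h2, h3⟩
    exact ⟨k, h1, by omega, h3⟩
  rw [hU, hmono.measure_iUnion, ENNReal.mul_iSup]
  exact iSup_le fun n => le_self_add.trans (key (n + 1) (by omega))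

/-- Given the past, the reward of the arm `i` is independent of it and has law `ν i`. -/
theorem IsBanditRun.lintegral_mul {K : ℕ} {Ω : Type*} {mΩ : MeasurableSpace Ω} {P : Measure Ω}
    [IsProbabilityMeasure P] {ν : Fin K → Measure ℝ} [∀ i, IsProbabilityMeasure (ν i)]
    {ℱ : Filtration ℕ mΩ} {I : ℕ → Ω → Fin K} {X : ℕ → Ω → ℝ} (h : IsBanditRun P ν ℱ I X)
    {n : ℕ} (hn : 1 ≤ n) (i : Fin K) {A : Set Ω} (hA : MeasurableSet[ℱ n] A)
    {f : Ω → ℝ≥0∞} (hf : Measurable[ℱ n] f) {g : ℝ → ℝ≥0∞} (hg : Measurable g) :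
    ∫⁻ ω in A ∩ I n ⁻¹' {i}, f ω * g (X n ω) ∂P
      = (∫⁻ ω in A ∩ I n ⁻¹' {i}, f ω ∂P) * ∫⁻ x, g x ∂(ν i) := by
  have hfm : Measurable f := hf.mono (ℱ.le n) le_rfl
  have hXm : Measurable (X n) := (h.reward_measurable n hn).mono (ℱ.le _) le_rfl
  have hprod : (P.restrict (A ∩ I n ⁻¹' {i})).map (fun ω => (f ω, X n ω))
      = ((P.restrict (A ∩ I n ⁻¹' {i})).map f).prod (ν i) := by
    symm
    refine Measure.prod_eq fun s t hs ht => ?_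
    have hsA : MeasurableSet[ℱ n] (A ∩ f ⁻¹' s) := hA.inter (hf hs)
    rw [Measure.map_apply (hfm.prodMk hXm) (hs.prod ht), Measure.map_apply hfm hs,
      Measure.restrict_apply (hfm.prodMk hXm (hs.prod ht)), Measure.restrict_apply (hfm hs)]
    have e1 : (fun ω => (f ω, X n ω)) ⁻¹' s ×ˢ t ∩ (A ∩ I n ⁻¹' {i})
        = (A ∩ f ⁻¹' s) ∩ I n ⁻¹' {i} ∩ X n ⁻¹' t := by
      ext ω; simp; tauto
    have e2 : f ⁻¹' s ∩ (A ∩ I n ⁻¹' {i}) = (A ∩ f ⁻¹' s) ∩ I n ⁻¹' {i} := by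
      ext ω; simp; tauto
    rw [e1, e2]
    exact h.reward_law n hn i _ hsA t ht
  calc ∫⁻ ω in A ∩ I n ⁻¹' {i}, f ω * g (X n ω) ∂P
      = ∫⁻ p, p.1 * g p.2 ∂((P.restrict (A ∩ I n ⁻¹' {i})).map (fun ω => (f ω, X n ω))) := by
        rw [lintegral_map (by fun_prop) (hfm.prodMk hXm)]
    _ = (∫⁻ a, a ∂((P.restrict (A ∩ I n ⁻¹' {i})).map f)) * ∫⁻ x, g x ∂(ν i) := by
        rw [hprod, lintegral_prod_mul (f := fun a => a) aemeasurable_id hg.aemeasurable]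
    _ = _ := by rw [lintegral_map (f := fun a => a) measurable_id hfm]

/-- The exponential process of the rewards, centred at `m`, with the parameter `θ i` for the
arm `i`. -/
noncomputable def expMart {K : ℕ} (m θ : Fin K → ℝ) (I : ℕ → Fin K) (X : ℕ → ℝ) (n : ℕ) : ℝ :=
  Real.exp (∑ t ∈ Finset.Ico 1 n, (θ (I t) * (X t - m (I t)) - θ (I t) ^ 2 / 2))

theorem expMart_one {K : ℕ} (m θ : Fin K → ℝ) (I : ℕ → Fin K) (X : ℕ → ℝ) :
    expMart m θ I X 1 = 1 := by
  simp [expMart]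

theorem expMart_succ {K : ℕ} (m θ : Fin K → ℝ) (I : ℕ → Fin K) (X : ℕ → ℝ) {n : ℕ}
    (hn : 1 ≤ n) : expMart m θ I X (n + 1) = expMart m θ I X n *
      Real.exp (θ (I n) * (X n - m (I n)) - θ (I n) ^ 2 / 2) := by
  rw [expMart, Finset.sum_Ico_succ_top hn, Real.exp_add, expMart]

theorem IsBanditRun.measurable_sum {K : ℕ} {Ω : Type*} {mΩ : MeasurableSpace Ω} {P : Measure Ω}
    {ν : Fin K → Measure ℝ} {ℱ : Filtration ℕ mΩ} {I : ℕ → Ω → Fin K} {X : ℕ → Ω → ℝ}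
    (h : IsBanditRun P ν ℱ I X) (n : ℕ) {g : Fin K → ℝ → ℝ} (hg : ∀ i, Measurable (g i)) :
    Measurable[ℱ n] fun ω => ∑ t ∈ Finset.Ico 1 n, g (I t ω) (X t ω) := by
  refine Finset.measurable_fun_sum _ fun t ht => ?_
  rw [Finset.mem_Ico] at ht
  have hI : Measurable[ℱ n] (I t) := (h.arm_measurable t ht.1).mono (ℱ.mono (by omega)) le_rfl
  have hX : Measurable[ℱ n] (X t) := (h.reward_measurable t ht.1).mono (ℱ.mono (by omega)) le_rfl
  have hg' : Measurable fun p : Fin K × ℝ => g p.1 p.2 :=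
    measurable_from_prod_countable_right hg
  exact hg'.comp (hI.prodMk hX)

theorem IsBanditRun.measurable_expMart {K : ℕ} {Ω : Type*} {mΩ : MeasurableSpace Ω}
    {P : Measure Ω} {ν : Fin K → Measure ℝ} {ℱ : Filtration ℕ mΩ} {I : ℕ → Ω → Fin K}
    {X : ℕ → Ω → ℝ} (h : IsBanditRun P ν ℱ I X) (m θ : Fin K → ℝ) (n : ℕ) :
    Measurable[ℱ n] fun ω => expMart m θ (fun t => I t ω) (fun t => X t ω) n := by
  refine Real.measurable_exp.comp ?_
  exact h.measurable_sum n (g := fun i x => θ i * (x - m i) - θ i ^ 2 / 2) fun i => by fun_prop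

/-- The exponential process is a supermartingale. -/
theorem IsBanditRun.lintegral_expMart_succ_le {K : ℕ} {Ω : Type*} {mΩ : MeasurableSpace Ω}
    {P : Measure Ω} [IsProbabilityMeasure P] {ν : Fin K → Measure ℝ}
    [∀ i, IsProbabilityMeasure (ν i)] (hν : ∀ i, IsOneSubGaussian (ν i))
    {ℱ : Filtration ℕ mΩ} {I : ℕ → Ω → Fin K} {X : ℕ → Ω → ℝ} (h : IsBanditRun P ν ℱ I X)
    (θ : Fin K → ℝ) {n : ℕ} (hn : 1 ≤ n) {A : Set Ω} (hA : MeasurableSet[ℱ n] A) :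
    ∫⁻ ω in A, ENNReal.ofReal
        (expMart (means ν) θ (fun t => I t ω) (fun t => X t ω) (n + 1)) ∂P
      ≤ ∫⁻ ω in A, ENNReal.ofReal
        (expMart (means ν) θ (fun t => I t ω) (fun t => X t ω) n) ∂P := by
  have hI : Measurable (I n) := (h.arm_measurable n hn).mono (ℱ.le n) le_rfl
  have hA' : MeasurableSet A := ℱ.le n _ hA
  -- splitting according to the arm pulled
  have hsplit : ∀ F : Ω → ℝ≥0∞, ∫⁻ ω in A, F ω ∂P = ∑ i, ∫⁻ ω in A ∩ I n ⁻¹' {i}, F ω ∂P := by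
    intro F
    have hU : A = ⋃ i, A ∩ I n ⁻¹' {i} := by ext ω; simp
    conv_lhs => rw [hU]
    rw [lintegral_iUnion (fun i => hA'.inter (hI (measurableSet_singleton i))), tsum_fintype]
    intro i j hij
    refine Set.disjoint_left.2 ?_
    rintro ω ⟨_, h1⟩ ⟨_, h2⟩
    exact hij (h1.symm.trans h2)
  rw [hsplit, hsplit]
  refine Finset.sum_le_sum fun i _ => ?_
  set g : ℝ → ℝ≥0∞ := fun x => ENNReal.ofReal
    (Real.exp (θ i * (x - means ν i) - θ i ^ 2 / 2)) with hgdef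
  have hg : Measurable g := by fun_prop
  have hint : ∫⁻ x, g x ∂(ν i) ≤ 1 := by
    have h1 : Integrable (fun x => Real.exp (θ i * (x - means ν i))) (ν i) :=
      (hν i).integrable_exp_mul (θ i)
    have h2 := (hν i).mgf_le (θ i)
    have e : ∀ x, Real.exp (θ i * (x - means ν i) - θ i ^ 2 / 2)
        = Real.exp (θ i * (x - means ν i)) * Real.exp (-(θ i ^ 2 / 2)) := by
      intro x; rw [← Real.exp_add]; congr 1
    rw [hgdef]
    simp only [e]
    rw [← ofReal_integral_eq_lintegral_ofReal (h1.mul_const _)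
      (Filter.Eventually.of_forall fun x => (mul_pos (Real.exp_pos _) (Real.exp_pos _)).le)]
    rw [integral_mul_const, ENNReal.ofReal_le_one]
    calc _ ≤ Real.exp (((1 : NNReal) : ℝ) * θ i ^ 2 / 2) * Real.exp (-(θ i ^ 2 / 2)) := by
          gcongr; exact h2
      _ = 1 := by rw [← Real.exp_add]; simp
  calc ∫⁻ ω in A ∩ I n ⁻¹' {i}, ENNReal.ofReal
        (expMart (means ν) θ (fun t => I t ω) (fun t => X t ω) (n + 1)) ∂P
      = ∫⁻ ω in A ∩ I n ⁻¹' {i}, ENNReal.ofReal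
        (expMart (means ν) θ (fun t => I t ω) (fun t => X t ω) n) * g (X n ω) ∂P := by
        refine setLIntegral_congr_fun (hA'.inter (hI (measurableSet_singleton i))) ?_
        rintro ω ⟨_, hω⟩
        have hω' : I n ω = i := hω
        simp only
        rw [expMart_succ _ _ _ _ hn, hω', ENNReal.ofReal_mul (by rw [expMart]; positivity)]
    _ = (∫⁻ ω in A ∩ I n ⁻¹' {i}, ENNReal.ofReal
        (expMart (means ν) θ (fun t => I t ω) (fun t => X t ω) n) ∂P) * ∫⁻ x, g x ∂(ν i) :=
        h.lintegral_mul hn i hA (h.measurable_expMart (means ν) θ n).ennreal_ofReal hg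
    _ ≤ _ := by
        exact (mul_le_mul_right hint _).trans_eq (mul_one _)

/-! ### Mixtures over the parameters of two arms -/

/-- The sum of the rewards of the arm `i` before time `n`, centred at `m i`. -/
noncomputable def centredSum {K : ℕ} (m : Fin K → ℝ) (I : ℕ → Fin K) (X : ℕ → ℝ) (n : ℕ)
    (i : Fin K) : ℝ :=
  ∑ t ∈ (Finset.Ico 1 n).filter (fun t => I t = i), (X t - m i)

theorem centredSum_eq {K : ℕ} (m : Fin K → ℝ) (I : ℕ → Fin K) (X : ℕ → ℝ) {n : ℕ}
    {i : Fin K} (h : 1 ≤ pulls I n i) :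
    centredSum m I X n i = pulls I n i * (empMean I X n i - m i) := by
  have h' : (pulls I n i : ℝ) ≠ 0 := by positivity
  rw [centredSum, Finset.sum_sub_distrib, Finset.sum_const, empMean, mul_sub, mul_div_cancel₀ _ h',
    nsmul_eq_mul, pulls]

/-- The parameter `u` for the arm `i`, `w` for the arm `j`, and `0` for the other arms. -/
def pairParam {K : ℕ} (i j : Fin K) (u w : ℝ) : Fin K → ℝ :=
  fun k => if k = i then u else if k = j then w else 0

theorem expMart_pairParam {K : ℕ} (m : Fin K → ℝ) (I : ℕ → Fin K) (X : ℕ → ℝ) (n : ℕ)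
    {i j : Fin K} (hij : i ≠ j) (u w : ℝ) :
    expMart m (pairParam i j u w) I X n =
      Real.exp (u * centredSum m I X n i - u ^ 2 / 2 * pulls I n i) *
      Real.exp (w * centredSum m I X n j - w ^ 2 / 2 * pulls I n j) := by
  have h : ∀ t, pairParam i j u w (I t) * (X t - m (I t)) - pairParam i j u w (I t) ^ 2 / 2
      = (if I t = i then u * (X t - m i) - u ^ 2 / 2 else 0)
        + (if I t = j then w * (X t - m j) - w ^ 2 / 2 else 0) := by
    intro t
    by_cases h1 : I t = i
    · have h2 : I t ≠ j := fun h => hij (h1.symm.trans h)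
      simp [pairParam, h1, hij]
    · by_cases h2 : I t = j
      · simp [pairParam, h2, hij.symm]
      · simp [pairParam, h1, h2]
  rw [expMart, ← Real.exp_add]
  congr 1
  simp only [h]
  rw [Finset.sum_add_distrib, ← Finset.sum_filter, ← Finset.sum_filter, Finset.sum_sub_distrib,
    Finset.sum_sub_distrib, ← Finset.mul_sum, ← Finset.mul_sum, Finset.sum_const, Finset.sum_const,
    nsmul_eq_mul, nsmul_eq_mul, centredSum, centredSum, pulls, pulls]
  ring

/-- The mixture of the exponential supermartingales of one arm with `N` pulls and centred sum `S`,
under the prior `π` on the parameter. -/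
noncomputable def mixture (π : Measure ℝ) (S N : ℝ) : ℝ≥0∞ :=
  ∫⁻ u, ENNReal.ofReal (Real.exp (u * S - u ^ 2 / 2 * N)) ∂π

theorem measurable_mixture (π : Measure ℝ) [SFinite π] :
    Measurable fun p : ℝ × ℝ => mixture π p.1 p.2 := by
  refine Measurable.lintegral_prod_right' (f := fun q : (ℝ × ℝ) × ℝ =>
    ENNReal.ofReal (Real.exp (q.2 * q.1.1 - q.2 ^ 2 / 2 * q.1.2))) ?_
  fun_prop

theorem measurable_mixture_mul_mixture {Ω : Type*} {_ : MeasurableSpace Ω} (π : Measure ℝ) [SFinite π]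
    {f g f' g' : Ω → ℝ} (hf : Measurable f) (hg : Measurable g) (hf' : Measurable f')
    (hg' : Measurable g') :
    Measurable fun ω => mixture π (f ω) (g ω) * mixture π (f' ω) (g' ω) :=
  ((measurable_mixture π).comp (hf.prodMk hg)).mul ((measurable_mixture π).comp (hf'.prodMk hg'))

theorem IsBanditRun.measurable_centredSum {K : ℕ} {Ω : Type*} {mΩ : MeasurableSpace Ω}
    {P : Measure Ω} {ν : Fin K → Measure ℝ} {ℱ : Filtration ℕ mΩ} {I : ℕ → Ω → Fin K}
    {X : ℕ → Ω → ℝ} (h : IsBanditRun P ν ℱ I X) (m : Fin K → ℝ) (n : ℕ)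
    (i : Fin K) :
    Measurable[ℱ n] fun ω => centredSum m (fun t => I t ω) (fun t => X t ω) n i := by
  simp only [centredSum, Finset.sum_filter]
  refine h.measurable_sum n (g := fun k x => if k = i then x - m i else 0) fun k => ?_
  by_cases hk : k = i
  · simp only [hk, if_true]; fun_prop
  · simp only [hk, if_false]; fun_prop

theorem IsBanditRun.measurable_pulls {K : ℕ} {Ω : Type*} {mΩ : MeasurableSpace Ω}
    {P : Measure Ω} {ν : Fin K → Measure ℝ} {ℱ : Filtration ℕ mΩ} {I : ℕ → Ω → Fin K}
    {X : ℕ → Ω → ℝ} (h : IsBanditRun P ν ℱ I X) (n : ℕ) (i : Fin K) :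
    Measurable[ℱ n] fun ω => (pulls (fun t => I t ω) n i : ℝ) := by
  simp only [pulls, Finset.card_filter, Nat.cast_sum, Nat.cast_ite, Nat.cast_one, Nat.cast_zero]
  exact h.measurable_sum n (g := fun k _ => if k = i then (1 : ℝ) else 0)
    fun k => measurable_const

/-- Ville's inequality for the product of mixtures over the parameters of two arms. -/
theorem IsBanditRun.ville_mixture {K : ℕ} {Ω : Type*} {mΩ : MeasurableSpace Ω}
    {P : Measure Ω} [IsProbabilityMeasure P] {ν : Fin K → Measure ℝ}
    [∀ i, IsProbabilityMeasure (ν i)] {ℱ : Filtration ℕ mΩ} {I : ℕ → Ω → Fin K}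
    {X : ℕ → Ω → ℝ} (h : IsBanditRun P ν ℱ I X)
    (hν : ∀ i, IsOneSubGaussian (ν i)) (π : Measure ℝ) [SFinite π] {i j : Fin K} (hij : i ≠ j)
    (c : ℝ≥0∞) :
    c * P {ω | ∃ n, 1 ≤ n ∧ c ≤
        mixture π (centredSum (means ν) (fun t => I t ω) (fun t => X t ω) n i)
          (pulls (fun t => I t ω) n i) *
        mixture π (centredSum (means ν) (fun t => I t ω) (fun t => X t ω) n j)
          (pulls (fun t => I t ω) n j)} ≤ π Set.univ * π Set.univ := by
  set M : ℕ → Ω → ℝ≥0∞ := fun n ω =>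
    mixture π (centredSum (means ν) (fun t => I t ω) (fun t => X t ω) n i)
          (pulls (fun t => I t ω) n i) *
        mixture π (centredSum (means ν) (fun t => I t ω) (fun t => X t ω) n j)
          (pulls (fun t => I t ω) n j) with hM
  have hMeq : ∀ n ω, M n ω = ∫⁻ p : ℝ × ℝ, ENNReal.ofReal (expMart (means ν)
      (pairParam i j p.1 p.2) (fun t => I t ω) (fun t => X t ω) n) ∂(π.prod π) := by
    intro n ω
    simp only [hM, mixture]
    rw [← lintegral_prod_mul (by fun_prop) (by fun_prop)]
    refine lintegral_congr fun p => ?_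
    rw [expMart_pairParam _ _ _ _ hij, ENNReal.ofReal_mul (Real.exp_pos _).le]
  have hmeas : ∀ n, Measurable[ℱ n] (M n) := by
    intro n
    exact measurable_mixture_mul_mixture π (h.measurable_centredSum (means ν) n i)
      (h.measurable_pulls n i) (h.measurable_centredSum (means ν) n j) (h.measurable_pulls n j)
  have hjoint : ∀ n, Measurable fun q : Ω × (ℝ × ℝ) => ENNReal.ofReal (expMart (means ν)
      (pairParam i j q.2.1 q.2.2) (fun t => I t q.1) (fun t => X t q.1) n) := by
    intro n
    simp only [expMart_pairParam _ _ _ _ hij]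
    have m (k : Fin K) : Measurable fun q : Ω × (ℝ × ℝ) =>
        centredSum (means ν) (fun t => I t q.1) (fun t => X t q.1) n k :=
      ((h.measurable_centredSum (means ν) n k).mono (ℱ.le n) le_rfl).comp measurable_fst
    have m' (k : Fin K) : Measurable fun q : Ω × (ℝ × ℝ) =>
        (pulls (fun t => I t q.1) n k : ℝ) :=
      ((h.measurable_pulls n k).mono (ℱ.le n) le_rfl).comp measurable_fst
    have m'' (k : Fin K) {u : Ω × (ℝ × ℝ) → ℝ} (hu : Measurable u) :
        Measurable fun q : Ω × (ℝ × ℝ) =>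
          Real.exp (u q * centredSum (means ν) (fun t => I t q.1) (fun t => X t q.1) n k
            - u q ^ 2 / 2 * (pulls (fun t => I t q.1) n k : ℝ)) :=
      Real.measurable_exp.comp ((hu.mul (m k)).sub (((hu.pow_const 2).div_const 2).mul (m' k)))
    exact ((m'' i (measurable_fst.comp measurable_snd)).mul
      (m'' j (measurable_snd.comp measurable_snd))).ennreal_ofReal
  refine (ville P ℱ M (fun n _ => hmeas n) ?_ c).trans_eq ?_
  · intro n hn A hA
    simp only [hMeq]
    have hswap : ∀ k, ∫⁻ ω in A, ∫⁻ p : ℝ × ℝ, ENNReal.ofReal (expMart (means ν)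
        (pairParam i j p.1 p.2) (fun t => I t ω) (fun t => X t ω) k) ∂(π.prod π) ∂P
        = ∫⁻ p : ℝ × ℝ, ∫⁻ ω in A, ENNReal.ofReal (expMart (means ν)
          (pairParam i j p.1 p.2) (fun t => I t ω) (fun t => X t ω) k) ∂P ∂(π.prod π) :=
      fun k => lintegral_lintegral_swap (hjoint k).aemeasurable
    rw [hswap, hswap]
    exact lintegral_mono fun p => h.lintegral_expMart_succ_le hν _ hn hA
  · simp only [hMeq, expMart_one]
    simp [← Set.univ_prod_univ]

/-! ### The mixture of Gaussian priors -/

theorem mixture_gaussianReal {v : NNReal} (hv : v ≠ 0) (S : ℝ) {N : ℝ} (hN : 0 ≤ N) :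
    mixture (gaussianReal 0 v) S N =
      ENNReal.ofReal ((Real.sqrt (1 + v * N))⁻¹ * Real.exp (S ^ 2 / 2 * (v / (1 + v * N)))) := by
  have hv' : (0 : ℝ) < v := by positivity
  set q : ℝ := 1 + v * N with hq
  have hq0 : 0 < q := by positivity
  set v' : NNReal := v / Real.toNNReal q with hv'def
  have hqn : ((Real.toNNReal q : NNReal) : ℝ) = q := Real.coe_toNNReal _ hq0.le
  have hv'0 : v' ≠ 0 := by
    rw [hv'def]; exact div_ne_zero hv (by simpa using hq0)
  have hv'c : (v' : ℝ) = v / q := by rw [hv'def, NNReal.coe_div, hqn]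
  rw [mixture, gaussianReal_of_var_ne_zero _ hv,
    lintegral_withDensity_eq_lintegral_mul₀ (by fun_prop) (by fun_prop)]
  -- completing the square
  have key : ∀ u, (gaussianPDF 0 v * fun u => ENNReal.ofReal (Real.exp (u * S - u ^ 2 / 2 * N))) u
      = ENNReal.ofReal ((Real.sqrt q)⁻¹ * Real.exp (S ^ 2 / 2 * (v / q))) *
        gaussianPDF (S * v') v' u := by
    intro u
    rw [Pi.mul_apply, gaussianPDF, gaussianPDF, ← ENNReal.ofReal_mul (gaussianPDFReal_nonneg _ _ _),
      ← ENNReal.ofReal_mul (by positivity), gaussianPDFReal, gaussianPDFReal, hv'c]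
    congr 1
    have e1 : Real.sqrt (2 * Real.pi * v) = Real.sqrt q * Real.sqrt (2 * Real.pi * (v / q)) := by
      rw [← Real.sqrt_mul hq0.le]
      congr 1
      field_simp
    rw [e1, mul_inv, mul_assoc, ← Real.exp_add]
    rw [show (Real.sqrt q)⁻¹ * Real.exp (S ^ 2 / 2 * (v / q)) *
      ((Real.sqrt (2 * Real.pi * (v / q)))⁻¹ *
        Real.exp (-(u - S * (v / q)) ^ 2 / (2 * (v / q)))) =
      (Real.sqrt q)⁻¹ * (Real.sqrt (2 * Real.pi * (v / q)))⁻¹ *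
        (Real.exp (S ^ 2 / 2 * (v / q)) * Real.exp (-(u - S * (v / q)) ^ 2 / (2 * (v / q)))) by
      ring, ← Real.exp_add]
    congr 2
    field_simp
    rw [hq]
    ring
  simp only [key]
  rw [lintegral_const_mul _ (measurable_gaussianPDF _ _), lintegral_gaussianPDF_eq_one _ hv'0,
    mul_one]

theorem riemannZeta_re_eq_tsum {s : ℝ} (hs : 1 < s) :
    (riemannZeta (s : ℂ)).re = ∑' k : ℕ, ((k : ℝ) + 1) ^ (-s) := by
  rw [zeta_eq_tsum_one_div_nat_add_one_cpow (by simpa using hs)]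
  have : ∀ k : ℕ, 1 / ((k : ℂ) + 1) ^ (s : ℂ) = ((((k : ℝ) + 1) ^ (-s) : ℝ) : ℂ) := by
    intro k
    rw [Real.rpow_neg (by positivity), Complex.ofReal_inv, Complex.ofReal_cpow (by positivity)]
    push_cast
    rw [one_div]
  simp only [this]
  rw [← Complex.ofReal_tsum, Complex.ofReal_re]

theorem summable_nat_add_one_rpow_neg {s : ℝ} (hs : 1 < s) :
    Summable fun k : ℕ => ((k : ℝ) + 1) ^ (-s) := by
  have := (summable_nat_add_iff 1).2 (Real.summable_nat_rpow.2 (by linarith : -s < -1))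
  simpa using this

theorem tsum_ofReal_eq_zeta {s : ℝ} (hs : 1 < s) :
    ∑' k : ℕ, ENNReal.ofReal (((k : ℝ) + 1) ^ (-s)) = ENNReal.ofReal (riemannZeta (s : ℂ)).re := by
  rw [riemannZeta_re_eq_tsum hs, ENNReal.ofReal_tsum_of_nonneg (fun k => by positivity)
    (summable_nat_add_one_rpow_neg hs)]

theorem one_le_riemannZeta_re {s : ℝ} (hs : 1 < s) : 1 ≤ (riemannZeta (s : ℂ)).re := by
  rw [riemannZeta_re_eq_tsum hs]
  have := (summable_nat_add_one_rpow_neg hs).le_tsum 0 (fun k _ => by positivity)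
  simpa using this

/-- The prior on the parameter of an arm: the Gaussian of index `k` is tuned for a number of pulls
in `[exp (4 l k), exp (4 l (k + 1)))` and has the weight `(k + 1) ^ (- 2 l)`. The total mass is
`ζ (2 l)`. -/
noncomputable def slicePrior (l : ℝ) : Measure ℝ :=
  Measure.sum fun k : ℕ => ENNReal.ofReal (((k : ℝ) + 1) ^ (-(2 * l))) •
    gaussianReal 0 (Real.toNNReal (l / (Real.exp (4 * l * k) * (1 - l))))

instance (l : ℝ) : SFinite (slicePrior l) := by
  unfold slicePrior; infer_instance

theorem slicePrior_univ {l : ℝ} (hl : 1 / 2 < l) :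
    slicePrior l Set.univ = ENNReal.ofReal (riemannZeta ((2 * l : ℝ) : ℂ)).re := by
  rw [slicePrior, Measure.sum_apply _ MeasurableSet.univ, ← tsum_ofReal_eq_zeta (by linarith)]
  simp

/-- The mixture is at least the contribution of the slice which contains the number of pulls. -/
theorem le_mixture_slicePrior {l : ℝ} (hl : l ∈ Set.Ioo (1 / 2 : ℝ) 1) (S : ℝ) {N : ℝ}
    (hN : 1 ≤ N) :
    ENNReal.ofReal (Real.exp (l * (S ^ 2 / (2 * N) - 2 * Real.log (4 + Real.log N)) - gG l) *
      (riemannZeta ((2 * l : ℝ) : ℂ)).re) ≤ mixture (slicePrior l) S N := by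
  obtain ⟨h0, h1⟩ := hl
  have hl0 : 0 < l := by linarith
  have h1l : 0 < 1 - l := by linarith
  have hlogN : 0 ≤ Real.log N := Real.log_nonneg hN
  have hN0 : 0 < N := by linarith
  -- the ratio `exp (4 l)` of consecutive slices is the one which produces the term
  -- `2 l - 2 l log (4 l)` of `gG`
  set k : ℕ := ⌊Real.log N / (4 * l)⌋₊ with hk
  have hk1 : (k : ℝ) ≤ Real.log N / (4 * l) := Nat.floor_le (by positivity)
  have hk2 : Real.log N / (4 * l) < k + 1 := Nat.lt_floor_add_one _
  rw [le_div_iff₀ (by positivity)] at hk1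
  rw [div_lt_iff₀ (by positivity)] at hk2
  set N₀ : ℝ := Real.exp (4 * l * k) with hN₀
  have hN₀1 : N₀ ≤ N := by
    rw [← Real.exp_log hN0, hN₀]; exact Real.exp_le_exp.2 (by linarith)
  have hN₀2 : N ≤ N₀ * Real.exp (4 * l) := by
    rw [hN₀, ← Real.exp_add]
    conv_lhs => rw [← Real.exp_log hN0]
    exact Real.exp_le_exp.2 (by linarith)
  have hN₀0 : 0 < N₀ := Real.exp_pos _
  have hv : 0 < l / (N₀ * (1 - l)) := by positivity
  set v : NNReal := Real.toNNReal (l / (N₀ * (1 - l))) with hvdef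
  have hvc : (v : ℝ) = l / (N₀ * (1 - l)) := Real.coe_toNNReal _ hv.le
  have hv0 : v ≠ 0 := by simpa [hvdef] using hv
  have hlow : ENNReal.ofReal (((k : ℝ) + 1) ^ (-(2 * l))) * mixture (gaussianReal 0 v) S N
      ≤ mixture (slicePrior l) S N := by
    simp only [mixture, slicePrior, lintegral_sum_measure, lintegral_smul_measure, smul_eq_mul]
    exact ENNReal.le_tsum (f := fun k : ℕ => ENNReal.ofReal (((k : ℝ) + 1) ^ (-(2 * l))) *
      ∫⁻ u, ENNReal.ofReal (Real.exp (u * S - u ^ 2 / 2 * N))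
        ∂(gaussianReal 0 (Real.toNNReal (l / (Real.exp (4 * l * k) * (1 - l)))))) k
  refine le_trans ?_ hlow
  rw [mixture_gaussianReal hv0 S hN0.le, hvc, ← ENNReal.ofReal_mul (by positivity)]
  refine ENNReal.ofReal_le_ofReal ?_
  set v' : ℝ := l / (N₀ * (1 - l)) with hv'
  have hζ : 1 ≤ (riemannZeta ((2 * l : ℝ) : ℂ)).re := one_le_riemannZeta_re (by linarith)
  set ζ := (riemannZeta ((2 * l : ℝ) : ℂ)).re with hζdef
  -- the weight of the slice
  have b1 : ((4 + Real.log N) / (4 * l)) ^ (-(2 * l)) ≤ ((k : ℝ) + 1) ^ (-(2 * l)) := by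
    refine Real.rpow_le_rpow_of_nonpos (by positivity) ?_ (by linarith)
    rw [le_div_iff₀ (by positivity)]
    nlinarith
  -- the normalization of the Gaussian
  have b2 : 1 + v' * N ≤ Real.exp (4 * l) / (1 - l) := by
    have : v' * N ≤ l / (1 - l) * Real.exp (4 * l) := by
      calc v' * N ≤ v' * (N₀ * Real.exp (4 * l)) := by gcongr
        _ = _ := by rw [hv']; field_simp
    have he : 1 ≤ Real.exp (4 * l) := Real.one_le_exp (by positivity)
    calc 1 + v' * N ≤ 1 + l / (1 - l) * Real.exp (4 * l) := by linarith
      _ = ((1 - l) + l * Real.exp (4 * l)) / (1 - l) := by field_simp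
      _ ≤ _ := by
        gcongr
        nlinarith
  have b3 : Real.sqrt (1 - l) * Real.exp (-(2 * l)) ≤ (Real.sqrt (1 + v' * N))⁻¹ := by
    have : Real.sqrt (1 + v' * N) ≤ Real.exp (2 * l) / Real.sqrt (1 - l) := by
      rw [Real.sqrt_le_left (by positivity), div_pow, Real.sq_sqrt h1l.le, ← Real.exp_nat_mul]
      refine b2.trans (le_of_eq ?_)
      congr 2
      push_cast; ring
    calc Real.sqrt (1 - l) * Real.exp (-(2 * l)) = (Real.exp (2 * l) / Real.sqrt (1 - l))⁻¹ := by
          rw [inv_div, Real.exp_neg, div_eq_mul_inv]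
      _ ≤ _ := by gcongr
  have b4 : l / N ≤ v' / (1 + v' * N) := by
    have hpos : 0 < 1 + v' * N := by positivity
    rw [div_le_div_iff₀ hN0 hpos]
    have : l ≤ v' * N * (1 - l) := by
      have : v' * N * (1 - l) = l * (N / N₀) := by rw [hv']; field_simp
      rw [this]
      have : 1 ≤ N / N₀ := (one_le_div hN₀0).2 hN₀1
      nlinarith
    nlinarith
  calc Real.exp (l * (S ^ 2 / (2 * N) - 2 * Real.log (4 + Real.log N)) - gG l) * ζ
      = ((4 + Real.log N) / (4 * l)) ^ (-(2 * l)) * ((Real.sqrt (1 - l) * Real.exp (-(2 * l))) *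
        Real.exp (S ^ 2 / 2 * (l / N))) := by
        have e1 : ((4 + Real.log N) / (4 * l)) ^ (-(2 * l))
            = Real.exp (-(2 * l) * (Real.log (4 + Real.log N) - Real.log (4 * l))) := by
          rw [Real.rpow_def_of_pos (by positivity), Real.log_div (by positivity) (by positivity)]
          ring_nf
        have e2 : Real.sqrt (1 - l) = Real.exp (Real.log (1 - l) / 2) := by
          rw [← Real.log_sqrt h1l.le, Real.exp_log (by positivity)]
        have e3 : ζ = Real.exp (Real.log ζ) := (Real.exp_log (by linarith)).symm
        rw [e1, e2]
        conv_lhs => rw [e3]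
        rw [← Real.exp_add, ← Real.exp_add, ← Real.exp_add, ← Real.exp_add]
        congr 1
        rw [gG, ← hζdef]
        field_simp
        ring
    _ ≤ _ := by gcongr

/-! ### Deviation inequalities -/

theorem pulls_add_pulls_le {K : ℕ} (I : ℕ → Fin K) (n : ℕ) {i j : Fin K} (hij : i ≠ j) :
    pulls I n i + pulls I n j ≤ n - 1 := by
  have hdisj : Disjoint ((Finset.Ico 1 n).filter fun t => I t = i)
      ((Finset.Ico 1 n).filter fun t => I t = j) := by
    rw [Finset.disjoint_filter]
    rintro t _ rfl h
    exact hij h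
  rw [pulls, pulls, ← Finset.card_union_of_disjoint hdisj, ← Nat.card_Ico 1 n]
  exact Finset.card_le_card (Finset.union_subset (Finset.filter_subset _ _)
    (Finset.filter_subset _ _))

theorem FollowsEBTC.one_le_pulls {K : ℕ} {ε₀ β : ℝ} {I B C : ℕ → Fin K} {X : ℕ → ℝ}
    (h : FollowsEBTC ε₀ β I B C X) {n : ℕ} (hn : K < n) (i : Fin K) : 1 ≤ pulls I n i := by
  obtain ⟨t, ht, hti⟩ := h.init i
  rw [Finset.mem_Icc] at ht
  exact Finset.card_pos.2 ⟨t, by simp [hti]; omega⟩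

/-- The self-normalized deviation of an arm with `N` pulls and centred sum `S`, compensated by the
iterated logarithm. -/
noncomputable def deviation (S N : ℝ) : ℝ := S ^ 2 / (2 * N) - 2 * Real.log (4 + Real.log N)

/-- Concavity of `t ↦ log (4 + log t)`, through two arithmetic-geometric inequalities. -/
theorem log_four_add_log_add_le {a b t : ℝ} (ha : 1 ≤ a) (hb : 1 ≤ b) (hab : a + b ≤ t) :
    Real.log (4 + Real.log a) + Real.log (4 + Real.log b) ≤ 2 * Real.log (4 + Real.log (t / 2)) := by
  have ha0 := Real.log_nonneg ha
  have hb0 := Real.log_nonneg hb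
  have ht0 : 0 ≤ Real.log (t / 2) := Real.log_nonneg (by linarith)
  have two_mul_log : ∀ y, 2 * Real.log y = Real.log (y ^ 2) := fun y => by simp [Real.log_pow]
  have h1 : Real.log a + Real.log b ≤ 2 * Real.log (t / 2) := by
    rw [← Real.log_mul (by linarith) (by linarith), two_mul_log]
    refine Real.log_le_log (by positivity) ?_
    nlinarith [sq_nonneg (a - b)]
  rw [← Real.log_mul (by linarith) (by linarith), two_mul_log]
  refine Real.log_le_log (by positivity) ?_
  nlinarith [sq_nonneg (Real.log a - Real.log b)]

section Deviation

variable {K : ℕ} {Ω : Type*} {mΩ : MeasurableSpace Ω} {P : Measure Ω}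
    [IsProbabilityMeasure P] {ν : Fin K → Measure ℝ} [∀ i, IsProbabilityMeasure (ν i)]
    {ℱ : Filtration ℕ mΩ} {I : ℕ → Ω → Fin K} {X : ℕ → Ω → ℝ}

theorem IsBanditRun.measure_deviation_le (h : IsBanditRun P ν ℱ I X)
    (hν : ∀ i, IsOneSubGaussian (ν i)) {i j : Fin K} (hij : i ≠ j) {l : ℝ}
    (hl : l ∈ Set.Ioo (1 / 2 : ℝ) 1) (x : ℝ) :
    P {ω | ∃ n, 1 ≤ n ∧ 1 ≤ pulls (fun t => I t ω) n i ∧ 1 ≤ pulls (fun t => I t ω) n j ∧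
        2 * ((gG l + x / 2) / l) ≤
        deviation (centredSum (means ν) (fun t => I t ω) (fun t => X t ω) n i)
          (pulls (fun t => I t ω) n i) +
        deviation (centredSum (means ν) (fun t => I t ω) (fun t => X t ω) n j)
          (pulls (fun t => I t ω) n j)} ≤ ENNReal.ofReal (Real.exp (-x)) := by
  have hζ : 1 ≤ (riemannZeta ((2 * l : ℝ) : ℂ)).re := one_le_riemannZeta_re (by linarith [hl.1])
  have hville := h.ville_mixture hν (slicePrior l) hij
    (ENNReal.ofReal (Real.exp x * (riemannZeta ((2 * l : ℝ) : ℂ)).re ^ 2))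
  rw [slicePrior_univ hl.1] at hville
  set ζ := (riemannZeta ((2 * l : ℝ) : ℂ)).re with hζdef
  have hc : 0 < Real.exp x * ζ ^ 2 := by positivity
  rw [← ENNReal.ofReal_mul (by positivity)] at hville
  refine (measure_mono ?_).trans ((ENNReal.le_div_iff_mul_le (b := ENNReal.ofReal
    (Real.exp x * ζ ^ 2)) (Or.inl (by simpa using hc)) (Or.inl ENNReal.ofReal_ne_top)).2
    ((mul_comm _ _).trans_le hville) |>.trans_eq ?_)
  · rintro ω ⟨n, hn, hi, hj, hx⟩
    refine ⟨n, hn, ?_⟩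
    have bi := le_mixture_slicePrior hl
      (centredSum (means ν) (fun t => I t ω) (fun t => X t ω) n i)
      (N := pulls (fun t => I t ω) n i) (by exact_mod_cast hi)
    have bj := le_mixture_slicePrior hl
      (centredSum (means ν) (fun t => I t ω) (fun t => X t ω) n j)
      (N := pulls (fun t => I t ω) n j) (by exact_mod_cast hj)
    refine le_trans ?_ (mul_le_mul' bi bj)
    rw [← ENNReal.ofReal_mul (by positivity), ← hζdef]
    refine ENNReal.ofReal_le_ofReal ?_
    rw [← deviation, ← deviation]
    set D := deviation (centredSum (means ν) (fun t => I t ω) (fun t => X t ω) n i)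
      (pulls (fun t => I t ω) n i)
    set D' := deviation (centredSum (means ν) (fun t => I t ω) (fun t => X t ω) n j)
      (pulls (fun t => I t ω) n j)
    rw [show Real.exp (l * D - gG l) * ζ * (Real.exp (l * D' - gG l) * ζ)
      = Real.exp (l * D - gG l) * Real.exp (l * D' - gG l) * ζ ^ 2 by ring, ← Real.exp_add]
    gcongr
    have hl0 : 0 < l := by linarith [hl.1]
    have : 2 * (gG l + x / 2) ≤ (D + D') * l := by
      rw [← div_le_iff₀ hl0, mul_div_assoc]; exact hx
    linarith
  · rw [← ENNReal.ofReal_div_of_pos hc, Real.exp_neg]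
    congr 1
    have : ζ ≠ 0 := by positivity
    field_simp

/-- Optimization of the deviation inequality over the mixing parameter. -/
theorem IsBanditRun.measure_CG_lt_deviation_le (h : IsBanditRun P ν ℱ I X)
    (hν : ∀ i, IsOneSubGaussian (ν i)) {i j : Fin K} (hij : i ≠ j) (x : ℝ) :
    P {ω | ∃ n, 1 ≤ n ∧ 1 ≤ pulls (fun t => I t ω) n i ∧ 1 ≤ pulls (fun t => I t ω) n j ∧
        2 * CG (x / 2) <
        deviation (centredSum (means ν) (fun t => I t ω) (fun t => X t ω) n i)
          (pulls (fun t => I t ω) n i) +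
        deviation (centredSum (means ν) (fun t => I t ω) (fun t => X t ω) n j)
          (pulls (fun t => I t ω) n j)} ≤ ENNReal.ofReal (Real.exp (-x)) := by
  have hne : Nonempty (Set.Ioo (1 / 2 : ℝ) 1) := ⟨⟨3 / 4, by norm_num, by norm_num⟩⟩
  -- the event is an increasing union of events whose levels decrease to `2 * CG (x / 2)`
  set E : ℕ → Set Ω := fun k => {ω | ∃ n, 1 ≤ n ∧ 1 ≤ pulls (fun t => I t ω) n i ∧
    1 ≤ pulls (fun t => I t ω) n j ∧ 2 * (CG (x / 2) + 1 / ((k : ℝ) + 1)) ≤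
        deviation (centredSum (means ν) (fun t => I t ω) (fun t => X t ω) n i)
          (pulls (fun t => I t ω) n i) +
        deviation (centredSum (means ν) (fun t => I t ω) (fun t => X t ω) n j)
          (pulls (fun t => I t ω) n j)} with hE
  have hmono : Monotone E := by
    rintro k k' hk ω ⟨n, h1, h2, h3, h4⟩
    refine ⟨n, h1, h2, h3, le_trans ?_ h4⟩
    have : (k : ℝ) ≤ k' := by exact_mod_cast hk
    gcongr
  have hEle : ∀ k, P (E k) ≤ ENNReal.ofReal (Real.exp (-x)) := by
    intro k
    have hpos : (0 : ℝ) < 1 / ((k : ℝ) + 1) := by positivity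
    obtain ⟨l, hl⟩ := exists_lt_of_ciInf_lt (lt_add_of_pos_right (CG (x / 2)) hpos)
    refine (measure_mono ?_).trans (h.measure_deviation_le hν hij l.2 x)
    rintro ω ⟨n, h1, h2, h3, h4⟩
    exact ⟨n, h1, h2, h3, le_trans (by linarith) h4⟩
  refine (measure_mono (t := ⋃ k, E k) ?_).trans ?_
  · rintro ω ⟨n, h1, h2, h3, h4⟩
    obtain ⟨k, hk⟩ := exists_nat_one_div_lt (half_pos (sub_pos.2 h4))
    refine Set.mem_iUnion.2 ⟨k, n, h1, h2, h3, ?_⟩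
    linarith
  · rw [hmono.measure_iUnion]
    exact iSup_le hEle

/-- A fixed-size deviation inequality for the difference of two empirical means. -/
theorem IsBanditRun.measure_empMean_sub_le (h : IsBanditRun P ν ℱ I X)
    (hν : ∀ i, IsOneSubGaussian (ν i)) {i j : Fin K} (hij : i ≠ j) {a b : ℕ} (ha : 1 ≤ a)
    (hb : 1 ≤ b) {r : ℝ} (hr : 0 ≤ r) :
    P {ω | ∃ n, 1 ≤ n ∧ pulls (fun t => I t ω) n i = a ∧ pulls (fun t => I t ω) n j = b ∧
      r * Real.sqrt (1 / (a : ℝ) + 1 / b) <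
        empMean (fun t => I t ω) (fun t => X t ω) n i - empMean (fun t => I t ω) (fun t => X t ω) n j
          - (means ν i - means ν j)} ≤ ENNReal.ofReal (Real.exp (-(r ^ 2 / 2))) := by
  have ha0 : (0 : ℝ) < a := by positivity
  have hb0 : (0 : ℝ) < b := by positivity
  set σ : ℝ := Real.sqrt (1 / (a : ℝ) + 1 / b) with hσ
  have hσ0 : 0 < σ := by positivity
  have hσ2 : σ ^ 2 = 1 / (a : ℝ) + 1 / b := Real.sq_sqrt (by positivity)
  set u : ℝ := r / σ with hu
  set θ : Fin K → ℝ := pairParam i j (u / a) (-(u / b)) with hθ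
  have hville := ville P ℱ (fun n ω => ENNReal.ofReal
    (expMart (means ν) θ (fun t => I t ω) (fun t => X t ω) n))
    (fun n _ => (h.measurable_expMart (means ν) θ n).ennreal_ofReal)
    (fun n hn A hA => h.lintegral_expMart_succ_le hν θ hn hA)
    (ENNReal.ofReal (Real.exp (r ^ 2 / 2)))
  simp only [expMart_one, ENNReal.ofReal_one, lintegral_const, measure_univ, mul_one] at hville
  refine (measure_mono ?_).trans ((ENNReal.le_div_iff_mul_le (b := ENNReal.ofReal
    (Real.exp (r ^ 2 / 2))) (Or.inl (by simpa using Real.exp_pos _))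
    (Or.inl ENNReal.ofReal_ne_top)).2 ((mul_comm _ _).trans_le hville) |>.trans_eq ?_)
  · rintro ω ⟨n, hn, hi, hj, hx⟩
    refine ⟨n, hn, ENNReal.ofReal_le_ofReal ?_⟩
    rw [hθ, expMart_pairParam _ _ _ _ hij, centredSum_eq _ _ _ (by omega),
      centredSum_eq _ _ _ (by omega), hi, hj, ← Real.exp_add]
    refine Real.exp_le_exp.2 ?_
    set d := empMean (fun t => I t ω) (fun t => X t ω) n i
    set d' := empMean (fun t => I t ω) (fun t => X t ω) n j
    have e : u / a * (a * (d - means ν i)) - (u / a) ^ 2 / 2 * a +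
        (-(u / b) * (b * (d' - means ν j)) - (-(u / b)) ^ 2 / 2 * b)
        = u * (d - d' - (means ν i - means ν j)) - u ^ 2 * σ ^ 2 / 2 := by
      rw [hσ2]; field_simp; ring
    have e2 : u ^ 2 * σ ^ 2 = r ^ 2 := by rw [hu]; field_simp
    have e3 : u * (r * σ) = r ^ 2 := by rw [hu]; field_simp
    have hu0 : 0 ≤ u := by positivity
    rw [e, e2]
    nlinarith [mul_le_mul_of_nonneg_left hx.le hu0]
  · rw [← ENNReal.ofReal_one, ← ENNReal.ofReal_div_of_pos (Real.exp_pos _), Real.exp_neg, one_div]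

end Deviation

/-- The pairs of positive integers with sum less than `n`. -/
def countPairs (n : ℕ) : Finset (ℕ × ℕ) :=
  (Finset.range (n - 1)).biUnion fun m =>
    (Finset.HasAntidiagonal.antidiagonal m).image fun q => (q.1 + 1, q.2 + 1)

theorem two_mul_card_countPairs_le (n : ℕ) : 2 * (countPairs n).card ≤ n * n := by
  have hsum : ∀ k, 2 * ∑ m ∈ Finset.range k, (m + 1) = k * (k + 1) := by
    intro k
    induction k with
    | zero => simp
    | succ k ih => rw [Finset.sum_range_succ, mul_add, ih]; ring
  calc 2 * (countPairs n).card ≤ 2 * ∑ m ∈ Finset.range (n - 1), (m + 1) := by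
        refine Nat.mul_le_mul_left 2 (Finset.card_biUnion_le.trans (Finset.sum_le_sum fun m _ => ?_))
        exact Finset.card_image_le.trans_eq (Finset.Nat.card_antidiagonal m)
    _ = (n - 1) * (n - 1 + 1) := hsum _
    _ ≤ n * n := by
        rcases n with _ | n
        · simp
        · simp only [Nat.add_sub_cancel]; nlinarith

theorem mem_countPairs {n a b : ℕ} : (a, b) ∈ countPairs n ↔ 1 ≤ a ∧ 1 ≤ b ∧ a + b ≤ n := by
  simp only [countPairs, Finset.mem_biUnion, Finset.mem_range, Finset.mem_image,
    Finset.HasAntidiagonal.mem_antidiagonal, Prod.mk.injEq, Prod.exists]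
  constructor
  · rintro ⟨m, hm, a', b', rfl, rfl, rfl⟩; omega
  · rintro ⟨h1, h2, h3⟩
    exact ⟨a + b - 2, by omega, a - 1, b - 1, by omega, by omega, by omega⟩

/-- Up to time `n`, the differences of empirical means deviate from the differences of means by at
most `√(2 α log n) √(1 / N_i + 1 / N_j)`. -/
def Concentrated {K : ℕ} (μ : Fin K → ℝ) (α : ℝ) (I : ℕ → Fin K) (X : ℕ → ℝ) (n : ℕ) : Prop :=
  ∀ t, K < t → t ≤ n → ∀ i j, i ≠ j →
    empMean I X t i - empMean I X t j - (μ i - μ j) ≤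
      Real.sqrt (2 * α * Real.log n) *
        Real.sqrt (1 / (pulls I t i : ℝ) + 1 / (pulls I t j : ℝ))

/-- A union bound over the ordered pairs of arms and over their numbers of pulls: there are at most
`n ^ 2 / 2` possible pairs of numbers, and each of them costs `n ^ (-(2 + s))`. -/
theorem IsBanditRun.measure_not_concentrated_le {K : ℕ} {Ω : Type*} {mΩ : MeasurableSpace Ω}
    {P : Measure Ω} [IsProbabilityMeasure P] {ν : Fin K → Measure ℝ}
    [∀ i, IsProbabilityMeasure (ν i)] {ℱ : Filtration ℕ mΩ} {I B C : ℕ → Ω → Fin K}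
    {X : ℕ → Ω → ℝ} (h : IsBanditRun P ν ℱ I X) (hν : ∀ i, IsOneSubGaussian (ν i)) {ε₀ β : ℝ}
    (halg : ∀ ω, FollowsEBTC ε₀ β (fun n => I n ω) (fun n => B n ω) (fun n => C n ω)
      (fun n => X n ω)) {s : ℝ} (hs : 0 ≤ s) {n : ℕ} (hn : 1 ≤ n) :
    P {ω | ¬ Concentrated (means ν) (2 + s) (fun t => I t ω) (fun t => X t ω) n} ≤
      ENNReal.ofReal ((K : ℝ) * ((K : ℝ) - 1) / 2 * (n : ℝ) ^ (-s)) := by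
  have hn0 : (0 : ℝ) < n := by positivity
  have hlog : 0 ≤ Real.log n := Real.log_natCast_nonneg n
  set r : ℝ := Real.sqrt (2 * (2 + s) * Real.log n) with hr
  have hr2 : r ^ 2 = 2 * (2 + s) * Real.log n := Real.sq_sqrt (by positivity)
  set E : Fin K × Fin K → ℕ × ℕ → Set Ω := fun p q => {ω | ∃ t, 1 ≤ t ∧
    pulls (fun t => I t ω) t p.1 = q.1 ∧ pulls (fun t => I t ω) t p.2 = q.2 ∧
      r * Real.sqrt (1 / (q.1 : ℝ) + 1 / q.2) <
        empMean (fun t => I t ω) (fun t => X t ω) t p.1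
          - empMean (fun t => I t ω) (fun t => X t ω) t p.2 - (means ν p.1 - means ν p.2)} with hE
  have hsub : {ω | ¬ Concentrated (means ν) (2 + s) (fun t => I t ω) (fun t => X t ω) n} ⊆
      ⋃ p ∈ (Finset.univ : Finset (Fin K)).offDiag, ⋃ q ∈ countPairs n, E p q := by
    intro ω hω
    simp only [Concentrated, Set.mem_ofPred_eq, not_forall, not_le] at hω
    obtain ⟨t, htK, htn, i, j, hij, hd⟩ := hω
    have hsum := pulls_add_pulls_le (fun t => I t ω) t hij
    simp only [Set.mem_iUnion]
    exact ⟨(i, j), by simpa using hij, (_, _), mem_countPairs.2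
      ⟨(halg ω).one_le_pulls htK i, (halg ω).one_le_pulls htK j, by omega⟩,
      t, by omega, rfl, rfl, hd⟩
  have hEle : ∀ p ∈ (Finset.univ : Finset (Fin K)).offDiag, ∀ q ∈ countPairs n,
      P (E p q) ≤ ENNReal.ofReal ((n : ℝ) ^ (-(2 + s))) := by
    intro p hp q hq
    obtain ⟨h1, h2, -⟩ := mem_countPairs.1 (show (q.1, q.2) ∈ _ from hq)
    refine (h.measure_empMean_sub_le hν (by simpa using hp) h1 h2 (Real.sqrt_nonneg _)).trans_eq ?_
    rw [← hr, hr2, Real.rpow_def_of_pos hn0]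
    congr 2
    ring
  calc _ ≤ ∑ p ∈ (Finset.univ : Finset (Fin K)).offDiag, ∑ q ∈ countPairs n,
        ENNReal.ofReal ((n : ℝ) ^ (-(2 + s))) := by
        refine (measure_mono hsub).trans ((measure_biUnion_finset_le _ _).trans ?_)
        refine Finset.sum_le_sum fun p hp => (measure_biUnion_finset_le _ _).trans ?_
        exact Finset.sum_le_sum fun q hq => hEle p hp q hq
    _ = ENNReal.ofReal (((K * K - K : ℕ) : ℝ) * ((countPairs n).card * (n : ℝ) ^ (-(2 + s)))) := by
        simp only [Finset.sum_const, Finset.offDiag_card, Finset.card_univ, Fintype.card_fin,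
          nsmul_eq_mul]
        rw [ENNReal.ofReal_mul (by positivity), ENNReal.ofReal_mul (by positivity),
          ENNReal.ofReal_natCast, ENNReal.ofReal_natCast]
    _ ≤ _ := by
        refine ENNReal.ofReal_le_ofReal ?_
        have hKK : ((K * K - K : ℕ) : ℝ) = K * (K - 1) := by
          rw [Nat.cast_sub (Nat.le_mul_self K)]; push_cast; ring
        have hKK0 : (0 : ℝ) ≤ K * (K - 1) := by rw [← hKK]; positivity
        have hc : 2 * ((countPairs n).card : ℝ) ≤ n * n := by
          exact_mod_cast two_mul_card_countPairs_le n
        have hp : (n : ℝ) ^ (-s) = n * n * (n : ℝ) ^ (-(2 + s)) := by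
          rw [show -s = 2 + -(2 + s) by ring, Real.rpow_add hn0]
          congr 1
          norm_cast
          ring
        rw [hKK, hp]
        have : ((countPairs n).card : ℝ) * (n : ℝ) ^ (-(2 + s)) ≤
            n * n / 2 * (n : ℝ) ^ (-(2 + s)) := by
          gcongr; linarith
        calc _ ≤ (K : ℝ) * (K - 1) * (n * n / 2 * (n : ℝ) ^ (-(2 + s))) := by gcongr
          _ = _ := by ring

/-! ### Correctness of the stopping rule -/

theorem stoppingTime_eq_coe {K : ℕ} {ε δ : ℝ} {I B : ℕ → Fin K} {X : ℕ → ℝ} {n : ℕ}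
    (h : stoppingTime ε δ I B X = n) : K < n ∧ ∀ i, i ≠ B n →
      Real.sqrt (2 * threshold K ((n : ℝ) - 1) δ) ≤ transportCost ε I X n (B n) i := by
  set S : Set ℕ := {n : ℕ | K < n ∧ ∀ i, i ≠ B n →
    Real.sqrt (2 * threshold K ((n : ℝ) - 1) δ) ≤ transportCost ε I X n (B n) i} with hS
  have hs : stoppingTime ε δ I B X = sInf ((fun n : ℕ => (n : ℕ∞)) '' S) := by
    rw [sInf_image]; rfl
  have hne : ((fun n : ℕ => (n : ℕ∞)) '' S).Nonempty := by
    by_contra h0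
    rw [Set.not_nonempty_iff_eq_empty] at h0
    rw [hs, h0, sInf_empty] at h
    exact ENat.top_ne_natCast n h
  obtain ⟨m, hm, hmn⟩ := csInf_mem hne
  rw [← hs, h] at hmn
  have hmn' : m = n := by exact_mod_cast (show (m : ℕ∞) = n from hmn)
  rw [← hmn']
  exact hm

theorem exists_transportCost_lt {K : ℕ} {ε δ : ℝ} {I B : ℕ → Fin K} {X : ℕ → ℝ} {n : ℕ}
    (hn : K < n) (h : (n : ℕ∞) < stoppingTime ε δ I B X) : ∃ i, i ≠ B n ∧
      transportCost ε I X n (B n) i < Real.sqrt (2 * threshold K ((n : ℝ) - 1) δ) := by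
  by_contra! hc
  exact absurd (iInf₂_le (f := fun (n : ℕ) (_ : n ∈ {n : ℕ | K < n ∧ ∀ i, i ≠ B n →
    Real.sqrt (2 * threshold K ((n : ℝ) - 1) δ) ≤ transportCost ε I X n (B n) i}) => (n : ℕ∞))
    n ⟨hn, hc⟩) (not_le.2 h)

theorem stoppingTime_anti {K : ℕ} {ε ε' δ : ℝ} (hε : ε ≤ ε') (I B : ℕ → Fin K) (X : ℕ → ℝ) :
    stoppingTime ε' δ I B X ≤ stoppingTime ε δ I B X := by
  refine le_iInf₂ fun n hn => iInf₂_le n ⟨hn.1, fun i hi => (hn.2 i hi).trans ?_⟩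
  unfold transportCost
  gcongr

theorem exists_eq_maxMean {K : ℕ} (hK : 0 < K) (μ : Fin K → ℝ) : ∃ b, μ b = maxMean μ := by
  have : Nonempty (Fin K) := ⟨⟨0, hK⟩⟩
  exact exists_eq_ciSup_of_finite

theorem le_maxMean {K : ℕ} (μ : Fin K → ℝ) (i : Fin K) : μ i ≤ maxMean μ :=
  le_ciSup (Set.finite_range μ).bddAbove i

/-- If the algorithm stops and recommends an arm which is not `ε`-good, then the empirical means of
this arm and of a best arm `b` deviate jointly. -/
theorem threshold_lt_deviation {K : ℕ} {ε₀ β ε δ : ℝ} {I B C : ℕ → Fin K} {X : ℕ → ℝ}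
    (h : FollowsEBTC ε₀ β I B C X) {n : ℕ} (hn : K < n) {μ : Fin K → ℝ}
    {b : Fin K} (hb : μ b = maxMean μ) (hbB : b ≠ B n) (hbad : B n ∉ goodArms μ ε)
    (hτ : Real.sqrt (2 * threshold K ((n : ℝ) - 1) δ) ≤ transportCost ε I X n (B n) b) :
    2 * CG (Real.log (((K : ℝ) - 1) / δ) / 2) <
      deviation (centredSum μ I X n (B n)) (pulls I n (B n)) +
      deviation (centredSum μ I X n b) (pulls I n b) := by
  have hi := h.one_le_pulls hn (B n)
  have hj := h.one_le_pulls hn b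
  have hsum := pulls_add_pulls_le I n hbB.symm
  rw [centredSum_eq _ _ _ hi, centredSum_eq _ _ _ hj]
  unfold transportCost at hτ
  have hgap : μ (B n) - μ b + ε < 0 := by
    simp only [goodArms, Finset.mem_filter, Finset.mem_univ, true_and, not_le] at hbad
    linarith
  have hNi : (1 : ℝ) ≤ pulls I n (B n) := by exact_mod_cast hi
  have hNj : (1 : ℝ) ≤ pulls I n b := by exact_mod_cast hj
  have hN : (pulls I n (B n) : ℝ) + pulls I n b ≤ (n : ℝ) - 1 := by
    have : pulls I n (B n) + pulls I n b + 1 ≤ n := by omega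
    have : ((pulls I n (B n) + pulls I n b + 1 : ℕ) : ℝ) ≤ n := by exact_mod_cast this
    push_cast at this
    linarith
  set N := (pulls I n (B n) : ℝ)
  set N' := (pulls I n b : ℝ)
  set d := empMean I X n (B n) - μ (B n) with hd
  set d' := empMean I X n b - μ b with hd'
  set σ := Real.sqrt (1 / N + 1 / N') with hσ
  have hσ0 : 0 < σ := by positivity
  have hσ2 : σ ^ 2 = 1 / N + 1 / N' := Real.sq_sqrt (by positivity)
  -- the stopping condition makes the cost nonnegative, also when the threshold is negative and the
  -- square root is the junk value `0`
  have h0 : 0 ≤ (empMean I X n (B n) - empMean I X n b + ε) / σ := (Real.sqrt_nonneg _).trans hτ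
  have hnum : 0 ≤ empMean I X n (B n) - empMean I X n b + ε := by
    by_contra! hneg
    exact absurd h0 (not_le.2 (div_neg_of_neg_of_pos hneg hσ0))
  have hlt : empMean I X n (B n) - empMean I X n b + ε < d - d' := by rw [hd, hd']; linarith
  have hc : 2 * threshold K ((n : ℝ) - 1) δ < N * d ^ 2 + N' * d' ^ 2 := by
    calc 2 * threshold K ((n : ℝ) - 1) δ
        ≤ ((empMean I X n (B n) - empMean I X n b + ε) / σ) ^ 2 := Real.sqrt_le_left h0 |>.1 hτ
      _ < ((d - d') / σ) ^ 2 := by gcongr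
      _ ≤ N * d ^ 2 + N' * d' ^ 2 := by
        -- Cauchy-Schwarz
        rw [div_pow, hσ2, div_le_iff₀ (by positivity)]
        have : (N * d ^ 2 + N' * d' ^ 2) * (1 / N + 1 / N') =
          (d - d') ^ 2 + (N * d + N' * d') ^ 2 / (N * N') := by field_simp; ring
        rw [this]
        have : 0 ≤ (N * d + N' * d') ^ 2 / (N * N') := by positivity
        linarith
  have hlog := log_four_add_log_add_le hNi hNj hN
  have e1 : (N * d) ^ 2 / (2 * N) = N * d ^ 2 / 2 := by field_simp
  have e2 : (N' * d') ^ 2 / (2 * N') = N' * d' ^ 2 / 2 := by field_simp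
  rw [deviation, deviation, e1, e2]
  rw [threshold] at hc
  linarith

theorem IsBanditRun.measure_recommend_bad_le {K : ℕ} (hK : 2 ≤ K) {Ω : Type*} {mΩ : MeasurableSpace Ω}
    {P : Measure Ω} [IsProbabilityMeasure P] {ν : Fin K → Measure ℝ}
    [∀ i, IsProbabilityMeasure (ν i)] {ℱ : Filtration ℕ mΩ} {I B C : ℕ → Ω → Fin K}
    {X : ℕ → Ω → ℝ} (h : IsBanditRun P ν ℱ I X) (hν : ∀ i, IsOneSubGaussian (ν i))
    {ε₀ β δ ε : ℝ} (hδ : 0 < δ) (hε : 0 ≤ ε)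
    (halg : ∀ ω, FollowsEBTC ε₀ β (fun n => I n ω) (fun n => B n ω) (fun n => C n ω)
      (fun n => X n ω)) :
    P {ω | ∃ n : ℕ, stoppingTime ε δ (fun n => I n ω) (fun n => B n ω) (fun n => X n ω) = n ∧
          B n ω ∉ goodArms (means ν) ε} ≤ ENNReal.ofReal δ := by
  obtain ⟨b, hb⟩ := exists_eq_maxMean (by omega : 0 < K) (means ν)
  have hK1 : (0 : ℝ) < (K : ℝ) - 1 := by
    have : (2 : ℝ) ≤ K := by exact_mod_cast hK
    linarith
  set x := Real.log (((K : ℝ) - 1) / δ) with hx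
  have hexp : Real.exp (-x) = δ / ((K : ℝ) - 1) := by
    rw [hx, Real.exp_neg, Real.exp_log (by positivity), inv_div]
  calc _ ≤ P (⋃ i ∈ Finset.univ.erase b, {ω | ∃ n, 1 ≤ n ∧ 1 ≤ pulls (fun t => I t ω) n i ∧
        1 ≤ pulls (fun t => I t ω) n b ∧ 2 * CG (x / 2) <
        deviation (centredSum (means ν) (fun t => I t ω) (fun t => X t ω) n i)
          (pulls (fun t => I t ω) n i) +
        deviation (centredSum (means ν) (fun t => I t ω) (fun t => X t ω) n b)
          (pulls (fun t => I t ω) n b)}) := by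
        refine measure_mono ?_
        rintro ω ⟨n, hn, hbad⟩
        obtain ⟨hKn, hτ⟩ := stoppingTime_eq_coe hn
        have hbB : b ≠ B n ω := by
          rintro rfl
          refine hbad ?_
          simp only [goodArms, Finset.mem_filter, Finset.mem_univ, true_and, hb]
          linarith
        simp only [Set.mem_iUnion]
        exact ⟨B n ω, by simpa using hbB.symm, n, by omega, (halg ω).one_le_pulls hKn _,
          (halg ω).one_le_pulls hKn _,
          threshold_lt_deviation (halg ω) hKn hb hbB hbad (hτ b hbB)⟩
    _ ≤ ∑ i ∈ Finset.univ.erase b, ENNReal.ofReal (Real.exp (-x)) := by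
        refine (measure_biUnion_finset_le _ _).trans (Finset.sum_le_sum fun i hi => ?_)
        exact h.measure_CG_lt_deviation_le hν (Finset.ne_of_mem_erase hi) x
    _ = ENNReal.ofReal δ := by
        rw [Finset.sum_const, Finset.card_erase_of_mem (Finset.mem_univ b), Finset.card_univ,
          Fintype.card_fin, nsmul_eq_mul, ← ENNReal.ofReal_natCast,
          ← ENNReal.ofReal_mul (by positivity), hexp, Nat.cast_sub (by omega), Nat.cast_one]
        congr 1
        field_simp

/-! ### Tracking and counting -/

theorem card_filter_Ioo_succ {K n : ℕ} (hn : K < n) (p : ℕ → Prop) [DecidablePred p] :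
    ((Finset.Ioo K (n + 1)).filter p).card
      = ((Finset.Ioo K n).filter p).card + if p n then 1 else 0 := by
  have : Finset.Ioo K (n + 1) = insert n (Finset.Ioo K n) := by
    ext t; simp only [Finset.mem_Ioo, Finset.mem_insert]; omega
  rw [this, Finset.filter_insert]
  split_ifs with h
  · rw [Finset.card_insert_of_notMem (by simp)]
  · simp

/-- A finite set of times is bounded in size by `R` if each of its elements has at most `R - 1`
predecessors in the set. -/
theorem card_le_of_forall_card_filter_lt {S : Finset ℕ} {R : ℝ} (hR : 0 ≤ R)
    (h : ∀ t ∈ S, ((S.filter (· < t)).card : ℝ) + 1 ≤ R) : (S.card : ℝ) ≤ R := by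
  rcases S.eq_empty_or_nonempty with rfl | hS
  · simpa using hR
  · have hmem := S.max'_mem hS
    have : S = insert (S.max' hS) (S.filter (· < S.max' hS)) := by
      ext t
      simp only [Finset.mem_insert, Finset.mem_filter]
      constructor
      · intro ht
        rcases (S.le_max' t ht).eq_or_lt with h | h
        · exact Or.inl h
        · exact Or.inr ⟨ht, h⟩
      · rintro (rfl | h)
        · exact hmem
        · exact h.1
    calc (S.card : ℝ) = ((S.filter (· < S.max' hS)).card : ℝ) + 1 := by
          conv_lhs => rw [this]
          rw [Finset.card_insert_of_notMem (by simp)]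
          push_cast; rfl
      _ ≤ R := h _ hmem

/-- The number of rounds before `n` with leader `i`. -/
def leaderCount {K : ℕ} (B : ℕ → Fin K) (n : ℕ) (i : Fin K) : ℕ :=
  ((Finset.Ioo K n).filter fun t => B t = i).card

section Trajectory

variable {K : ℕ} {ε₀ : ℝ} {I B C : ℕ → Fin K} {X : ℕ → ℝ}

/-- For each pair, the tracking rule pulls the challenger at about half of the rounds, and at
slightly more than half of them as soon as there is one. -/
theorem FollowsEBTC.challengerPulls_bounds (h : FollowsEBTC ε₀ (1 / 2) I B C X) {i j : Fin K}
    (hij : i ≠ j) (n : ℕ) :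
    (pairCount B C n i j = 0 ∧ challengerPulls I B C n i j = 0) ∨
      (pairCount B C n i j + 1 ≤ 2 * challengerPulls I B C n i j ∧
        2 * challengerPulls I B C n i j ≤ pairCount B C n i j + 2) := by
  induction n with
  | zero => left; simp [pairCount, challengerPulls]
  | succ n ih =>
    rcases Nat.lt_or_ge K n with hn | hn
    · have e1 : pairCount B C (n + 1) i j = pairCount B C n i j +
          if B n = i ∧ C n = j then 1 else 0 := card_filter_Ioo_succ hn _
      have e2 : challengerPulls I B C (n + 1) i j = challengerPulls I B C n i j +
          if (B n = i ∧ C n = j) ∧ I n = j then 1 else 0 := card_filter_Ioo_succ hn _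
      by_cases hp : B n = i ∧ C n = j
      · have ht := h.tracking n hn
        rw [hp.1, hp.2] at ht
        simp only [hp, and_self, true_and, if_true] at e1 e2
        rw [e1] at ht
        by_cases hc : 2 * challengerPulls I B C n i j ≤ pairCount B C n i j + 1
        · have hc' : (challengerPulls I B C n i j : ℝ) ≤
              (1 - 1 / 2) * ((pairCount B C n i j + 1 : ℕ) : ℝ) := by
            have : (2 * challengerPulls I B C n i j : ℝ) ≤ pairCount B C n i j + 1 := by
              exact_mod_cast hc
            push_cast; linarith
          rw [if_pos hc'] at ht
          rw [if_pos ht] at e2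
          omega
        · have hc' : ¬ (challengerPulls I B C n i j : ℝ) ≤
              (1 - 1 / 2) * ((pairCount B C n i j + 1 : ℕ) : ℝ) := by
            intro hle
            apply hc
            have : (2 * challengerPulls I B C n i j : ℝ) ≤ pairCount B C n i j + 1 := by
              push_cast at hle; linarith
            exact_mod_cast this
          rw [if_neg hc'] at ht
          rw [if_neg (by rw [ht]; exact hij)] at e2
          omega
      · simp only [hp, false_and, if_false] at e1 e2
        omega
    · left
      have : Finset.Ioo K (n + 1) = ∅ := by
        ext t; simp only [Finset.mem_Ioo, Finset.notMem_empty, iff_false]; omega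
      simp [pairCount, challengerPulls, this]

/-- The initial pull comes on top of those pulls made after the initialization which satisfy `p`. -/
theorem FollowsEBTC.card_filter_lt_pulls {β : ℝ} (h : FollowsEBTC ε₀ β I B C X) {n : ℕ}
    (hn : K < n) (i : Fin K) (p : ℕ → Prop) [DecidablePred p] (hp : ∀ t, p t → I t = i) :
    ((Finset.Ioo K n).filter p).card + 1 ≤ pulls I n i := by
  obtain ⟨t₀, ht₀, hti⟩ := h.init i
  rw [Finset.mem_Icc] at ht₀
  have hnot : t₀ ∉ (Finset.Ioo K n).filter p := by
    simp only [Finset.mem_filter, Finset.mem_Ioo]; omega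
  rw [← Finset.card_insert_of_notMem hnot]
  refine Finset.card_le_card fun t ht => ?_
  simp only [Finset.mem_insert, Finset.mem_filter, Finset.mem_Ioo, Finset.mem_Ico] at ht ⊢
  rcases ht with rfl | ⟨⟨h1, h2⟩, h3⟩
  · exact ⟨by omega, hti⟩
  · exact ⟨by omega, hp t h3⟩

/-- The extra pull at initialization removes any rounding loss from the number of pulls of the
challenger. -/
theorem FollowsEBTC.pairCount_add_one_le (h : FollowsEBTC ε₀ (1 / 2) I B C X) {n : ℕ}
    (hn : K < n) {i j : Fin K} (hij : i ≠ j) :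
    pairCount B C n i j + 1 ≤ 2 * pulls I n j := by
  have h1 : challengerPulls I B C n i j + 1 ≤ pulls I n j :=
    h.card_filter_lt_pulls hn j _ fun t ht => ht.2
  rcases h.challengerPulls_bounds hij n with h2 | h2 <;> omega

/-- The leader is pulled at half of the rounds, up to one unit for each of the other arms. -/
theorem FollowsEBTC.leaderCount_le (h : FollowsEBTC ε₀ (1 / 2) I B C X) {n : ℕ}
    (hn : K < n) (i : Fin K) :
    leaderCount B n i + 2 ≤ 2 * pulls I n i + 2 * (K - 1) := by
  have h1 : ((Finset.Ioo K n).filter fun t => B t = i ∧ I t = i).card + 1 ≤ pulls I n i :=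
    h.card_filter_lt_pulls hn i _ fun t ht => ht.2
  have hcount : leaderCount B n i = ∑ j ∈ Finset.univ.erase i, pairCount B C n i j := by
    rw [leaderCount, Finset.card_eq_sum_card_fiberwise (f := C) (t := Finset.univ.erase i)]
    · refine Finset.sum_congr rfl fun j _ => ?_
      rw [pairCount, Finset.filter_filter]
    · intro t ht
      simp only [Finset.coe_filter, Finset.mem_Ioo, Set.mem_ofPred_eq] at ht
      have := h.challenger_ne t ht.1.1
      rw [ht.2] at this
      simpa using this
  have hother : ((Finset.Ioo K n).filter fun t => B t = i ∧ ¬ I t = i).card ≤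
      ∑ j ∈ Finset.univ.erase i, challengerPulls I B C n i j := by
    rw [Finset.card_eq_sum_card_fiberwise (f := C) (t := Finset.univ.erase i)]
    · refine Finset.sum_le_sum fun j _ => Finset.card_le_card fun t ht => ?_
      simp only [Finset.mem_filter, Finset.mem_Ioo] at ht ⊢
      refine ⟨ht.1.1, ⟨ht.1.2.1, ht.2⟩, ?_⟩
      have htr := h.tracking t ht.1.1.1
      split_ifs at htr with hc
      · rw [htr, ht.2]
      · exact absurd (htr.trans ht.1.2.1) ht.1.2.2
    · intro t ht
      simp only [Finset.coe_filter, Finset.mem_Ioo, Set.mem_ofPred_eq] at ht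
      have := h.challenger_ne t ht.1.1
      rw [ht.2.1] at this
      simpa using this
  have hsplit : leaderCount B n i =
      ((Finset.Ioo K n).filter fun t => B t = i ∧ I t = i).card +
      ((Finset.Ioo K n).filter fun t => B t = i ∧ ¬ I t = i).card := by
    rw [leaderCount, ← Finset.card_filter_add_card_filter_not (fun t => I t = i),
      Finset.filter_filter, Finset.filter_filter]
  have hsum : 2 * ∑ j ∈ Finset.univ.erase i, challengerPulls I B C n i j ≤
      leaderCount B n i + 2 * (K - 1) := by
    have hcard : (Finset.univ.erase i).card = K - 1 := by
      rw [Finset.card_erase_of_mem (Finset.mem_univ i), Finset.card_univ, Fintype.card_fin]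
    rw [hcount, Finset.mul_sum, ← hcard, mul_comm 2, ← smul_eq_mul, ← Finset.sum_const,
      ← Finset.sum_add_distrib]
    refine Finset.sum_le_sum fun j hj => ?_
    rcases h.challengerPulls_bounds (Finset.ne_of_mem_erase hj).symm n with h2 | h2 <;> omega
  omega

/-- After `h` rounds with leader `i`, one of the challengers `j` is chosen about `u j (m - h)` times
until there are `m` such rounds; consider the last time at which it is chosen. -/
theorem FollowsEBTC.exists_late_round {β : ℝ} (hE : FollowsEBTC ε₀ β I B C X) (n : ℕ) (i : Fin K)
    {u : Fin K → ℝ} (hu : ∀ j, j ≠ i → 0 < u j) (hu1 : ∑ j ∈ Finset.univ.erase i, u j ≤ 1)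
    {h : ℕ} (hm : h < leaderCount B (n + 1) i) :
    ∃ t, K < t ∧ t ≤ n ∧ B t = i ∧ h ≤ leaderCount B t i ∧
      u (C t) * ((leaderCount B (n + 1) i : ℝ) - h) ≤ pairCount B C t i (C t) + 1 := by
  set m := leaderCount B (n + 1) i with hmdef
  have hmh : (0 : ℝ) < (m : ℝ) - h := sub_pos.2 (by exact_mod_cast hm)
  set S := (Finset.Ioo K (n + 1)).filter fun t => B t = i ∧ h ≤ leaderCount B t i with hS
  set S' := (Finset.Ioo K (n + 1)).filter fun t => B t = i ∧ ¬ h ≤ leaderCount B t i with hS'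
  have hSS' : m = S.card + S'.card := by
    rw [hmdef, leaderCount, ← Finset.card_filter_add_card_filter_not
      (fun t => h ≤ leaderCount B t i), Finset.filter_filter, Finset.filter_filter]
  have hS'card : (S'.card : ℝ) ≤ h := by
    refine card_le_of_forall_card_filter_lt (by positivity) fun t ht => ?_
    rw [hS', Finset.mem_filter] at ht
    have h1 : (S'.filter (· < t)).card ≤ leaderCount B t i := by
      refine Finset.card_le_card fun s hs => ?_
      simp only [hS', Finset.mem_filter, Finset.mem_Ioo] at hs ⊢
      exact ⟨⟨hs.1.1.1, hs.2⟩, hs.1.2.1⟩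
    have h2 : (S'.filter (· < t)).card + 1 ≤ h := by omega
    exact_mod_cast h2
  have hScard : (m : ℝ) - h ≤ S.card := by
    have : (m : ℝ) = S.card + S'.card := by exact_mod_cast hSS'
    linarith
  have hfib : S.card = ∑ j ∈ Finset.univ.erase i, (S.filter fun t => C t = j).card := by
    refine Finset.card_eq_sum_card_fiberwise fun t ht => ?_
    simp only [hS, Finset.coe_filter, Finset.mem_Ioo, Set.mem_ofPred_eq] at ht
    have := hE.challenger_ne t ht.1.1
    rw [ht.2.1] at this
    simpa using this
  have hne : (Finset.univ.erase i).Nonempty := by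
    by_contra h0
    rw [Finset.not_nonempty_iff_eq_empty] at h0
    rw [h0, Finset.sum_empty] at hfib
    rw [hfib] at hScard
    simp only [Nat.cast_zero] at hScard
    linarith
  obtain ⟨j, hj, hle⟩ := Finset.exists_le_of_sum_le (s := Finset.univ.erase i)
    (f := fun j => u j * ((m : ℝ) - h)) (g := fun j => ((S.filter fun t => C t = j).card : ℝ)) hne
    (by
      rw [← Finset.sum_mul, ← Nat.cast_sum, ← hfib]
      refine le_trans ?_ hScard
      calc _ ≤ 1 * ((m : ℝ) - h) := by gcongr
        _ = _ := one_mul _)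
  by_contra! hcon
  refine absurd hle (not_le.2 ?_)
  have hpos : 0 < u j * ((m : ℝ) - h) := mul_pos (hu j (Finset.ne_of_mem_erase hj)) hmh
  rcases (S.filter fun t => C t = j).eq_empty_or_nonempty with h0 | h0
  · rw [h0]; simpa using hpos
  · -- the last time at which the challenger is `j`
    obtain ⟨t, ht, htmax⟩ := Finset.exists_max_image _ id h0
    have ht' := ht
    simp only [hS, Finset.mem_filter, Finset.mem_Ioo] at ht'
    have := hcon t ht'.1.1.1 (by omega) ht'.1.2.1 ht'.1.2.2
    rw [ht'.2] at this
    refine lt_of_le_of_lt ?_ this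
    have hsub : (S.filter fun t => C t = j) ⊆
        insert t ((Finset.Ioo K t).filter fun t => B t = i ∧ C t = j) := by
      intro s hs
      have hst := htmax s hs
      simp only [hS, Finset.mem_filter, Finset.mem_Ioo, id] at hs hst
      simp only [Finset.mem_insert, Finset.mem_filter, Finset.mem_Ioo]
      rcases hst.eq_or_lt with h1 | h1
      · exact Or.inl h1
      · exact Or.inr ⟨⟨hs.1.1.1, h1⟩, hs.1.2.1, hs.2⟩
    exact_mod_cast (Finset.card_le_card hsub).trans (Finset.card_insert_le _ _)

end Trajectory

/-! ### Rounds at which the leader is not `ε`-good -/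

/-- The contribution of the arm `k` to the complexity `H`. -/
noncomputable def armWeight {K : ℕ} (μ : Fin K → ℝ) (ε₀ ε : ℝ) (k : Fin K) : ℝ :=
  if k ∈ bestArms μ then 2 * (minBadGap μ ε)⁻¹ ^ 2
  else if k ∈ goodArms μ ε then Cconst μ ε₀ ε ^ 2
  else max (Cconst μ ε₀ ε) (Real.sqrt 2 * (gap μ k)⁻¹) ^ 2

theorem armWeight_nonneg {K : ℕ} (μ : Fin K → ℝ) (ε₀ ε : ℝ) (k : Fin K) :
    0 ≤ armWeight μ ε₀ ε k := by
  unfold armWeight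
  split_ifs <;> positivity

theorem bestArms_subset_goodArms {K : ℕ} (μ : Fin K → ℝ) {ε : ℝ} (hε : 0 ≤ ε) :
    bestArms μ ⊆ goodArms μ ε := by
  intro k hk
  simp only [bestArms, goodArms, Finset.mem_filter, Finset.mem_univ, true_and] at hk ⊢
  linarith

theorem sum_armWeight {K : ℕ} (μ : Fin K → ℝ) (ε₀ : ℝ) {ε : ℝ} (hε : 0 ≤ ε) :
    ∑ k, armWeight μ ε₀ ε k = Hconst μ ε₀ ε := by
  have hsub := bestArms_subset_goodArms μ hε
  rw [← Finset.sum_add_sum_compl (goodArms μ ε), ← Finset.sum_sdiff hsub, Hconst]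
  have e1 : ∑ k ∈ goodArms μ ε \ bestArms μ, armWeight μ ε₀ ε k =
      ((goodArms μ ε \ bestArms μ).card : ℝ) * Cconst μ ε₀ ε ^ 2 := by
    rw [← nsmul_eq_mul, ← Finset.sum_const]
    refine Finset.sum_congr rfl fun k hk => ?_
    rw [Finset.mem_sdiff] at hk
    rw [armWeight, if_neg hk.2, if_pos hk.1]
  have e2 : ∑ k ∈ bestArms μ, armWeight μ ε₀ ε k =
      2 * ((bestArms μ).card : ℝ) * (minBadGap μ ε)⁻¹ ^ 2 := by
    rw [mul_comm (2 : ℝ), mul_assoc, ← nsmul_eq_mul, ← Finset.sum_const]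
    refine Finset.sum_congr rfl fun k hk => ?_
    rw [armWeight, if_pos hk]
  have e3 : ∑ k ∈ (goodArms μ ε)ᶜ, armWeight μ ε₀ ε k =
      ∑ i ∈ (goodArms μ ε)ᶜ, max (Cconst μ ε₀ ε) (Real.sqrt 2 * (gap μ i)⁻¹) ^ 2 := by
    refine Finset.sum_congr rfl fun k hk => ?_
    rw [Finset.mem_compl] at hk
    rw [armWeight, if_neg (fun h => hk (hsub h)), if_neg hk]
  rw [e1, e2, e3]
  ring

theorem Hconst_nonneg {K : ℕ} (μ : Fin K → ℝ) (ε₀ : ℝ) {ε : ℝ} (hε : 0 ≤ ε) :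
    0 ≤ Hconst μ ε₀ ε := by
  rw [← sum_armWeight μ ε₀ hε]
  exact Finset.sum_nonneg fun k _ => armWeight_nonneg μ ε₀ ε k

theorem minBadGap_pos {K : ℕ} {μ : Fin K → ℝ} {ε : ℝ} (hε : 0 ≤ ε) {i : Fin K}
    (hi : i ∉ goodArms μ ε) : 0 < minBadGap μ ε ∧ minBadGap μ ε ≤ gap μ i := by
  have : Nonempty {k : Fin K // k ∉ goodArms μ ε} := ⟨⟨i, hi⟩⟩
  constructor
  · obtain ⟨k, hk⟩ := exists_eq_ciInf_of_finite
      (f := fun k : {k : Fin K // k ∉ goodArms μ ε} => gap μ k)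
    rw [minBadGap, ← hk]
    have := k.2
    simp only [goodArms, Finset.mem_filter, Finset.mem_univ, true_and, not_le] at this
    rw [gap]
    linarith
  · exact ciInf_le (Set.finite_range _).bddBelow (⟨i, hi⟩ : {k : Fin K // k ∉ goodArms μ ε})

/-- If the differences deviate by a large quantity `q`, one of the two arms has few pulls. -/
theorem le_or_le_of_le_mul_sqrt {q r N N' g g' : ℝ} (hq : 0 < q) (hN : 0 < N) (hN' : 0 < N')
    (h : q ≤ r * Real.sqrt (1 / N + 1 / N')) (hg : q⁻¹ ^ 2 ≤ g) (hg' : q⁻¹ ^ 2 ≤ g') :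
    N ≤ 2 * r ^ 2 * g ∨ N' ≤ 2 * r ^ 2 * g' := by
  by_contra! hcon
  obtain ⟨h1, h2⟩ := hcon
  have h1' : 2 * r ^ 2 * q⁻¹ ^ 2 < N := lt_of_le_of_lt (by gcongr) h1
  have h2' : 2 * r ^ 2 * q⁻¹ ^ 2 < N' := lt_of_le_of_lt (by gcongr) h2
  have hsq : q ^ 2 ≤ r ^ 2 * (1 / N + 1 / N') := by
    rw [← Real.sq_sqrt (by positivity : 0 ≤ 1 / N + 1 / N'), ← mul_pow]
    gcongr
  have e1 : r ^ 2 * (1 / N) < q ^ 2 / 2 := by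
    rw [mul_one_div, div_lt_iff₀ hN]
    have : r ^ 2 = q ^ 2 / 2 * (2 * r ^ 2 * q⁻¹ ^ 2) := by field_simp
    rw [this]
    gcongr
  have e2 : r ^ 2 * (1 / N') < q ^ 2 / 2 := by
    rw [mul_one_div, div_lt_iff₀ hN']
    have : r ^ 2 = q ^ 2 / 2 * (2 * r ^ 2 * q⁻¹ ^ 2) := by field_simp
    rw [this]
    gcongr
  linarith

/-- When the leader is not `ε`-good, the leader or the challenger has few pulls. -/
theorem FollowsEBTC.pulls_le_of_bad {K : ℕ} {ε₀ β : ℝ} {I B C : ℕ → Fin K} {X : ℕ → ℝ}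
    (h : FollowsEBTC ε₀ β I B C X) (hK : 0 < K) (hε₀ : 0 < ε₀) {μ : Fin K → ℝ} {ε α : ℝ}
    (hε : 0 ≤ ε) {n t : ℕ} (hc : Concentrated μ α I X n)
    (ht : K < t) (htn : t ≤ n) (hbad : B t ∉ goodArms μ ε) :
    (pulls I t (B t) : ℝ) ≤
      2 * Real.sqrt (2 * α * Real.log n) ^ 2 * armWeight μ ε₀ ε (B t) ∨
    (pulls I t (C t) : ℝ) ≤
      2 * Real.sqrt (2 * α * Real.log n) ^ 2 * armWeight μ ε₀ ε (C t) := by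
  set r := Real.sqrt (2 * α * Real.log n) with hr
  have hN : ∀ k, (0 : ℝ) < pulls I t k := fun k => by
    exact_mod_cast h.one_le_pulls ht k
  obtain ⟨hΔ, hΔi⟩ := minBadGap_pos hε hbad
  set i := B t with hi
  set j := C t with hj
  have hgi : 0 < gap μ i := hΔ.trans_le hΔi
  have hibest : i ∉ bestArms μ := fun hb => hbad (bestArms_subset_goodArms μ hε hb)
  -- the leader is empirically better than the best arms
  have key : ∀ b, b ∈ bestArms μ → b ≠ i ∧ empMean I X t i - empMean I X t b ≤
        r * Real.sqrt (1 / (pulls I t i : ℝ) + 1 / (pulls I t b : ℝ)) - gap μ i ∧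
      gap μ i ≤ r * Real.sqrt (1 / (pulls I t i : ℝ) + 1 / (pulls I t b : ℝ)) := by
    intro b hb
    have hbi : b ≠ i := fun h => hibest (h ▸ hb)
    have h1 := hc t ht htn i b hbi.symm
    have h2 := h.leader t ht b
    simp only [bestArms, Finset.mem_filter, Finset.mem_univ, true_and] at hb
    rw [gap]
    exact ⟨hbi, by linarith, by linarith⟩
  have hwi : max (Cconst μ ε₀ ε) (Real.sqrt 2 * (gap μ i)⁻¹) ^ 2 = armWeight μ ε₀ ε i := by
    rw [armWeight, if_neg hibest, if_neg hbad]
  have hC : ε₀⁻¹ ≤ Cconst μ ε₀ ε := le_max_right _ _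
  have hC0 : 0 < Cconst μ ε₀ ε := (inv_pos.2 hε₀).trans_le hC
  have hΔinv : (gap μ i)⁻¹ ≤ (minBadGap μ ε)⁻¹ := inv_anti₀ hΔ hΔi
  by_cases hjb : j ∈ bestArms μ
  · obtain ⟨-, -, h2⟩ := key j hjb
    refine le_or_le_of_le_mul_sqrt hgi (hN i) (hN j) h2 ?_ ?_
    · rw [← hwi]
      gcongr
      refine le_trans ?_ (le_max_right _ _)
      have : (1 : ℝ) ≤ Real.sqrt 2 := Real.one_le_sqrt.2 (by norm_num)
      nlinarith [inv_pos.2 hgi]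
    · rw [armWeight, if_pos hjb]
      have : (gap μ i)⁻¹ ^ 2 ≤ (minBadGap μ ε)⁻¹ ^ 2 := by gcongr
      nlinarith [sq_nonneg ((minBadGap μ ε)⁻¹)]
  · obtain ⟨b, hb⟩ := exists_eq_maxMean hK μ
    have hb' : b ∈ bestArms μ := by simpa [bestArms] using hb
    obtain ⟨hbi, h1, h2⟩ := key b hb'
    have hq0 : 0 < min ε₀ (gap μ i) := lt_min hε₀ hgi
    have hqC : (min ε₀ (gap μ i))⁻¹ ≤ Cconst μ ε₀ ε := by
      rcases min_cases ε₀ (gap μ i) with ⟨e, _⟩ | ⟨e, hlt⟩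
      · rw [e]; exact hC
      · rw [e]
        refine le_trans ?_ (le_max_left _ _)
        have : ε₀⁻¹ ≤ (gap μ i)⁻¹ := inv_anti₀ hgi hlt.le
        linarith
    have hq2 : (min ε₀ (gap μ i))⁻¹ ^ 2 ≤ Cconst μ ε₀ ε ^ 2 := by gcongr
    refine le_or_le_of_le_mul_sqrt hq0 (hN i) (hN j) ?_ ?_ ?_
    · -- the challenger has a smaller transportation cost than the best arm
      have hcost := h.challenger t ht b hbi
      have hlead := h.leader t ht j
      rw [← hi, ← hj] at hcost
      rw [← hi] at hlead
      unfold transportCost at hcost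
      set y := Real.sqrt (1 / (pulls I t i : ℝ) + 1 / (pulls I t j : ℝ)) with hy
      set z := Real.sqrt (1 / (pulls I t i : ℝ) + 1 / (pulls I t b : ℝ)) with hz
      have hy0 : 0 < y := Real.sqrt_pos.2 (by have := hN i; have := hN j; positivity)
      have hz0 : 0 < z := Real.sqrt_pos.2 (by have := hN i; have := hN b; positivity)
      have h3 : ε₀ / y ≤ (r * z - gap μ i + ε₀) / z := by
        refine le_trans ?_ (hcost.trans ?_)
        · gcongr; linarith
        · gcongr
      rw [div_le_div_iff₀ hy0 hz0] at h3
      rcases le_total ε₀ (gap μ i) with hle | hle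
      · rw [min_eq_left hle]
        by_contra! hlt
        nlinarith
      · rw [min_eq_right hle]
        -- `ε₀ z ≤ (r z - Δ + ε₀) y` and `Δ ≤ r z` give `Δ ε₀ z ≤ r ε₀ z y`
        have h4 : (ε₀ - gap μ i) * gap μ i ≤ (ε₀ - gap μ i) * (r * z) :=
          mul_le_mul_of_nonneg_left h2 (by linarith)
        have h5 : gap μ i * (ε₀ * z) ≤ r * y * (ε₀ * z) := by
          have := mul_le_mul_of_nonneg_left h3 hgi.le
          have h6 := mul_le_mul_of_nonneg_right h4 hy0.le
          nlinarith
        exact le_of_mul_le_mul_right h5 (by positivity)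
    · rw [← hwi]
      refine hq2.trans ?_
      gcongr
      exact le_max_left _ _
    · refine hq2.trans ?_
      rw [armWeight, if_neg hjb]
      split_ifs
      · exact le_rfl
      · gcongr
        exact le_max_left _ _

/-- The number of rounds at which the leader is not `ε`-good is logarithmic. -/
theorem FollowsEBTC.card_bad_le {K : ℕ} {ε₀ : ℝ} {I B C : ℕ → Fin K} {X : ℕ → ℝ}
    (h : FollowsEBTC ε₀ (1 / 2) I B C X) (hK : 2 ≤ K) (hε₀ : 0 < ε₀) {μ : Fin K → ℝ} {ε α : ℝ}
    (hε : 0 ≤ ε) {n : ℕ} (hc : Concentrated μ α I X n) :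
    (((Finset.Ioo K (n + 1)).filter fun t => B t ∉ goodArms μ ε).card : ℝ) ≤
      ((K : ℝ) - 1) * (4 * Real.sqrt (2 * α * Real.log n) ^ 2 * Hconst μ ε₀ ε + (2 * K - 3)) := by
  set r := Real.sqrt (2 * α * Real.log n) with hr
  set θ : Fin K → ℝ := fun k => 2 * r ^ 2 * armWeight μ ε₀ ε k with hθ
  have hθ0 : ∀ k, 0 ≤ θ k := fun k => mul_nonneg (by positivity) (armWeight_nonneg μ ε₀ ε k)
  have hK' : (2 : ℝ) ≤ K := by exact_mod_cast hK
  set S : Fin K → Finset ℕ := fun i => (Finset.Ioo K (n + 1)).filter fun t =>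
    B t = i ∧ (pulls I t i : ℝ) ≤ θ i with hS
  set S' : Fin K → Fin K → Finset ℕ := fun i j => (Finset.Ioo K (n + 1)).filter fun t =>
    (B t = i ∧ C t = j) ∧ (pulls I t j : ℝ) ≤ θ j with hS'
  have hScard : ∀ i, ((S i).card : ℝ) ≤ 2 * θ i + (2 * K - 3) := by
    intro i
    refine card_le_of_forall_card_filter_lt (by linarith [hθ0 i]) fun t ht => ?_
    simp only [hS, Finset.mem_filter, Finset.mem_Ioo] at ht
    have h1 : ((S i).filter (· < t)).card ≤ leaderCount B t i := by
      refine Finset.card_le_card fun s hs => ?_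
      simp only [hS, Finset.mem_filter, Finset.mem_Ioo] at hs ⊢
      exact ⟨⟨hs.1.1.1, hs.2⟩, hs.1.2.1⟩
    have h2 := h.leaderCount_le ht.1.1 i
    have h3 : ((S i).filter (· < t)).card + 4 ≤ 2 * pulls I t i + 2 * K := by omega
    have h4 : ((((S i).filter (· < t)).card + 4 : ℕ) : ℝ) ≤ ((2 * pulls I t i + 2 * K : ℕ) : ℝ) := by
      exact_mod_cast h3
    push_cast at h4
    linarith [ht.2.2]
  have hS'card : ∀ i j, i ≠ j → ((S' i j).card : ℝ) ≤ 2 * θ j := by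
    intro i j hij
    refine card_le_of_forall_card_filter_lt (by linarith [hθ0 j]) fun t ht => ?_
    simp only [hS', Finset.mem_filter, Finset.mem_Ioo] at ht
    have h1 : ((S' i j).filter (· < t)).card ≤ pairCount B C t i j := by
      refine Finset.card_le_card fun s hs => ?_
      simp only [hS', Finset.mem_filter, Finset.mem_Ioo] at hs ⊢
      exact ⟨⟨hs.1.1.1, hs.2⟩, hs.1.2.1⟩
    have h2 := h.pairCount_add_one_le ht.1.1 hij
    have h3 : ((S' i j).filter (· < t)).card + 1 ≤ 2 * pulls I t j := by omega
    have h4 : ((((S' i j).filter (· < t)).card + 1 : ℕ) : ℝ) ≤ ((2 * pulls I t j : ℕ) : ℝ) := by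
      exact_mod_cast h3
    push_cast at h4
    linarith [ht.2.2]
  have hsub : ((Finset.Ioo K (n + 1)).filter fun t => B t ∉ goodArms μ ε) ⊆
      (goodArms μ ε)ᶜ.biUnion fun i => S i ∪ (Finset.univ.erase i).biUnion (S' i) := by
    intro t ht
    simp only [Finset.mem_filter, Finset.mem_Ioo] at ht
    have hne := h.challenger_ne t ht.1.1
    rw [Finset.mem_biUnion]
    refine ⟨B t, Finset.mem_compl.2 ht.2, ?_⟩
    rw [Finset.mem_union, Finset.mem_biUnion]
    rcases h.pulls_le_of_bad (by omega) hε₀ hε hc ht.1.1 (by omega) ht.2 with h1 | h1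
    · left
      simp only [hS, Finset.mem_filter, Finset.mem_Ioo]
      exact ⟨ht.1, trivial, h1⟩
    · right
      refine ⟨C t, by simpa using hne, ?_⟩
      simp only [hS', Finset.mem_filter, Finset.mem_Ioo]
      exact ⟨ht.1, ⟨trivial, trivial⟩, h1⟩
  have hsum : ∑ k, θ k = 2 * r ^ 2 * Hconst μ ε₀ ε := by
    rw [hθ, ← Finset.mul_sum, sum_armWeight μ ε₀ hε]
  have hone : ∀ i, ((S i ∪ (Finset.univ.erase i).biUnion (S' i)).card : ℝ) ≤
      4 * r ^ 2 * Hconst μ ε₀ ε + (2 * K - 3) := by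
    intro i
    have h1 : ((S i ∪ (Finset.univ.erase i).biUnion (S' i)).card : ℝ) ≤
        (S i).card + ∑ j ∈ Finset.univ.erase i, ((S' i j).card : ℝ) := by
      exact_mod_cast (Finset.card_union_le _ _).trans
        (Nat.add_le_add_left Finset.card_biUnion_le _)
    have h2 : ∑ j ∈ Finset.univ.erase i, ((S' i j).card : ℝ) ≤
        ∑ j ∈ Finset.univ.erase i, 2 * θ j :=
      Finset.sum_le_sum fun j hj => hS'card i j (Finset.ne_of_mem_erase hj).symm
    have h3 : 2 * θ i + ∑ j ∈ Finset.univ.erase i, 2 * θ j = 2 * (2 * r ^ 2 * Hconst μ ε₀ ε) := by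
      rw [Finset.add_sum_erase _ (fun j => 2 * θ j) (Finset.mem_univ i), ← Finset.mul_sum, hsum]
    linarith [hScard i]
  have hH0 : 0 ≤ 4 * r ^ 2 * Hconst μ ε₀ ε + (2 * K - 3) := by
    have : 0 ≤ ∑ k, θ k := Finset.sum_nonneg fun k _ => hθ0 k
    rw [hsum] at this
    linarith
  have hcard : ((goodArms μ ε)ᶜ.card : ℝ) ≤ (K : ℝ) - 1 := by
    obtain ⟨b, hb⟩ := exists_eq_maxMean (by omega : 0 < K) μ
    have hb' : b ∈ goodArms μ ε := bestArms_subset_goodArms μ hε (by simpa [bestArms] using hb)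
    have h1 : (goodArms μ ε)ᶜ ⊆ Finset.univ.erase b := by
      intro k hk
      rw [Finset.mem_compl] at hk
      have : k ≠ b := fun e => hk (e ▸ hb')
      simpa using this
    have h2 := Finset.card_le_card h1
    rw [Finset.card_erase_of_mem (Finset.mem_univ b), Finset.card_univ, Fintype.card_fin] at h2
    have h3 : (goodArms μ ε)ᶜ.card + 1 ≤ K := by omega
    have h4 : (((goodArms μ ε)ᶜ.card + 1 : ℕ) : ℝ) ≤ K := by exact_mod_cast h3
    push_cast at h4
    linarith
  calc (((Finset.Ioo K (n + 1)).filter fun t => B t ∉ goodArms μ ε).card : ℝ)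
      ≤ ∑ i ∈ (goodArms μ ε)ᶜ, ((S i ∪ (Finset.univ.erase i).biUnion (S' i)).card : ℝ) := by
        exact_mod_cast (Finset.card_le_card hsub).trans Finset.card_biUnion_le
    _ ≤ ∑ i ∈ (goodArms μ ε)ᶜ, (4 * r ^ 2 * Hconst μ ε₀ ε + (2 * K - 3)) :=
        Finset.sum_le_sum fun i _ => hone i
    _ = ((goodArms μ ε)ᶜ.card : ℝ) * (4 * r ^ 2 * Hconst μ ε₀ ε + (2 * K - 3)) := by
        rw [Finset.sum_const, nsmul_eq_mul]
    _ ≤ _ := by gcongr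

/-! ### Optimal allocations -/

section Allocation

variable {K : ℕ} {ε₀ : ℝ} {μ : Fin K → ℝ} {i : Fin K}

theorem charTime_eq (hK : 2 ≤ K) (ε₀ : ℝ) (μ : Fin K → ℝ) (i : Fin K) :
    charTime ε₀ (1 / 2) μ i =
      (ENNReal.ofReal (allocationValue ε₀ (1 / 2) μ i (optAlloc ε₀ (1 / 2) μ i)))⁻¹ := by
  obtain ⟨h1, h2⟩ := optAlloc_spec hK ε₀ (β := 1 / 2) (by norm_num) (by norm_num) μ i
  have : IsGreatest (allocationValue ε₀ (1 / 2) μ i '' allocations (1 / 2) i)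
      (allocationValue ε₀ (1 / 2) μ i (optAlloc ε₀ (1 / 2) μ i)) := by
    refine ⟨⟨_, h1, rfl⟩, ?_⟩
    rintro _ ⟨w, hw, rfl⟩
    exact h2 w hw
  rw [charTime, this.csSup_eq]

theorem charTime_ne_zero (hK : 2 ≤ K) (ε₀ : ℝ) (μ : Fin K → ℝ) (i : Fin K) :
    charTime ε₀ (1 / 2) μ i ≠ 0 := by
  rw [charTime_eq hK]
  exact ENNReal.inv_ne_zero.2 ENNReal.ofReal_ne_top

theorem allocationValue_le (w : Fin K → ℝ) {j : Fin K} (hj : j ≠ i) :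
    allocationValue ε₀ (1 / 2) μ i w ≤
      1 / 2 * (μ i - μ j + ε₀) ^ 2 * (1 / 2 * w j / (1 / 2 + w j)) :=
  ciInf_le (Set.finite_range _).bddBelow (⟨j, hj⟩ : {j : Fin K // j ≠ i})

/-- When the characteristic time is finite, the optimal allocation charges every arm. -/
theorem optAlloc_pos (hK : 2 ≤ K) (hfin : charTime ε₀ (1 / 2) μ i ≠ ⊤) {j : Fin K} (hj : j ≠ i) :
    0 < optAlloc ε₀ (1 / 2) μ i j ∧ 2 * (2 + 1 / optAlloc ε₀ (1 / 2) μ i j) ≤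
      (charTime ε₀ (1 / 2) μ i).toReal * (μ i - μ j + ε₀) ^ 2 := by
  obtain ⟨⟨⟨hw0, -⟩, -⟩, -⟩ :=
    optAlloc_spec hK ε₀ (β := 1 / 2) (by norm_num) (by norm_num) μ i
  have hle := allocationValue_le (ε₀ := ε₀) (μ := μ) (optAlloc ε₀ (1 / 2) μ i) hj
  rw [charTime_eq hK] at hfin ⊢
  have hV : 0 < allocationValue ε₀ (1 / 2) μ i (optAlloc ε₀ (1 / 2) μ i) := by
    by_contra! hV
    rw [ENNReal.ofReal_of_nonpos hV] at hfin
    simp at hfin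
  set V := allocationValue ε₀ (1 / 2) μ i (optAlloc ε₀ (1 / 2) μ i)
  set w := optAlloc ε₀ (1 / 2) μ i j
  have hwj : 0 ≤ w := hw0 j
  have hw : 0 < w := by
    rcases hwj.eq_or_lt with h0 | h0
    · rw [← h0] at hle
      simp only [mul_zero, zero_div] at hle
      linarith
    · exact h0
  refine ⟨hw, ?_⟩
  rw [ENNReal.toReal_inv, ENNReal.toReal_ofReal hV.le, ← div_eq_inv_mul, le_div_iff₀ hV]
  calc 2 * (2 + 1 / w) * V ≤ 2 * (2 + 1 / w) *
        (1 / 2 * (μ i - μ j + ε₀) ^ 2 * (1 / 2 * w / (1 / 2 + w))) := by gcongr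
    _ = _ := by field_simp; ring

theorem sum_optAlloc (hK : 2 ≤ K) (ε₀ : ℝ) (μ : Fin K → ℝ) (i : Fin K) :
    ∑ j ∈ Finset.univ.erase i, optAlloc ε₀ (1 / 2) μ i j = 1 / 2 := by
  obtain ⟨⟨⟨-, h1⟩, h2⟩, -⟩ :=
    optAlloc_spec hK ε₀ (β := 1 / 2) (by norm_num) (by norm_num) μ i
  have := Finset.add_sum_erase Finset.univ (optAlloc ε₀ (1 / 2) μ i) (Finset.mem_univ i)
  linarith

theorem minAlloc_le {j : Fin K} (hj : j ≠ i) : minAlloc μ ε₀ i ≤ optAlloc ε₀ (1 / 2) μ i j :=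
  ciInf_le (Set.finite_range _).bddBelow (⟨j, hj⟩ : {j : Fin K // j ≠ i})

theorem minAlloc_pos (hK : 2 ≤ K) (hfin : charTime ε₀ (1 / 2) μ i ≠ ⊤) :
    0 < minAlloc μ ε₀ i := by
  have hnt : Nontrivial (Fin K) := Fin.nontrivial_iff_two_le.mpr hK
  obtain ⟨j₀, hj₀⟩ := exists_ne i
  have hne : Nonempty {j : Fin K // j ≠ i} := ⟨⟨j₀, hj₀⟩⟩
  obtain ⟨j, hj⟩ := exists_eq_ciInf_of_finite
    (f := fun j : {j : Fin K // j ≠ i} => optAlloc ε₀ (1 / 2) μ i j)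
  rw [minAlloc, ← hj]
  exact (optAlloc_pos hK hfin j.2).1

theorem minAlloc_mul_le (hK : 2 ≤ K) (ε₀ : ℝ) (μ : Fin K → ℝ) (i : Fin K) :
    2 * ((K : ℝ) - 1) * minAlloc μ ε₀ i ≤ 1 := by
  have h := sum_optAlloc hK ε₀ μ i
  have h2 : ∑ j ∈ Finset.univ.erase i, minAlloc μ ε₀ i ≤
      ∑ j ∈ Finset.univ.erase i, optAlloc ε₀ (1 / 2) μ i j :=
    Finset.sum_le_sum fun j hj => minAlloc_le (Finset.ne_of_mem_erase hj)
  rw [h, Finset.sum_const, Finset.card_erase_of_mem (Finset.mem_univ i), Finset.card_univ,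
    Fintype.card_fin, nsmul_eq_mul, Nat.cast_sub (by omega), Nat.cast_one] at h2
  linarith

theorem inv_natCast_sub_one_le_one (hK : 2 ≤ K) : 1 / ((K : ℝ) - 1) ≤ 1 := by
  have hK' : (2 : ℝ) ≤ K := by exact_mod_cast hK
  rw [div_le_one (by linarith)]
  linarith

/-- The factor by which clipping shrinks the allocation is positive. For `K = 2` and `x = 1`, no arm
is clipped, since the only weight is `1 / 2`. -/
theorem clip_pos (hK : 2 ≤ K) (ε₀ : ℝ) (μ : Fin K → ℝ) {x : ℝ}
    (hx : x ∈ Set.Icc (0 : ℝ) (1 / ((K : ℝ) - 1))) (i : Fin K) :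
    0 < (1 - x) ^ numClipped μ ε₀ x i := by
  have hK' : (2 : ℝ) ≤ K := by exact_mod_cast hK
  rcases (hx.2.trans (inv_natCast_sub_one_le_one hK)).eq_or_lt with h1 | h1
  · have hK2 : K = 2 := by
      have h2 := hx.2
      rw [h1, le_div_iff₀ (by linarith)] at h2
      have : (K : ℝ) ≤ 2 := by linarith
      have : K ≤ 2 := by exact_mod_cast this
      omega
    have h0 : numClipped μ ε₀ x i = 0 := by
      rw [numClipped, Finset.card_eq_zero, Finset.filter_eq_empty_iff]
      rintro j - ⟨hj, hlt⟩
      have hsum := sum_optAlloc hK ε₀ μ i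
      have he : Finset.univ.erase i = {j} := by
        symm
        refine Finset.eq_of_subset_of_card_le (by simpa using hj) ?_
        rw [Finset.card_erase_of_mem (Finset.mem_univ i), Finset.card_univ, Fintype.card_fin,
          Finset.card_singleton]
        omega
      rw [he, Finset.sum_singleton] at hsum
      rw [h1] at hlt
      linarith
    rw [h0, pow_zero]
    exact one_pos
  · exact pow_pos (by linarith) _

theorem clip_le_one (hK : 2 ≤ K) {x : ℝ} (hx : x ∈ Set.Icc (0 : ℝ) (1 / ((K : ℝ) - 1))) (d : ℕ) :
    (1 - x) ^ d ≤ 1 := by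
  have := hx.2.trans (inv_natCast_sub_one_le_one hK)
  exact pow_le_one₀ (by linarith) (by linarith [hx.1])

/-- The optimal allocation of the arm `i`, raised to `x / 2` where it is smaller and shrunk so that
its total mass does not increase. -/
noncomputable def clippedAlloc (μ : Fin K → ℝ) (ε₀ x : ℝ) (i j : Fin K) : ℝ :=
  (1 - x) ^ numClipped μ ε₀ x i * max (optAlloc ε₀ (1 / 2) μ i j) (x / 2)

theorem sum_clippedAlloc_le (hK : 2 ≤ K) (ε₀ : ℝ) (μ : Fin K → ℝ) {x : ℝ}
    (hx : x ∈ Set.Icc (0 : ℝ) (1 / ((K : ℝ) - 1))) (i : Fin K) :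
    ∑ j ∈ Finset.univ.erase i, 2 * clippedAlloc μ ε₀ x i j ≤ 1 := by
  obtain ⟨⟨⟨hw0, -⟩, -⟩, -⟩ :=
    optAlloc_spec hK ε₀ (β := 1 / 2) (by norm_num) (by norm_num) μ i
  have hx1 := hx.2.trans (inv_natCast_sub_one_le_one hK)
  have hx0 := hx.1
  have hq := clip_pos hK ε₀ μ hx i
  set d := numClipped μ ε₀ x i with hd
  have hmax : ∀ j, max (optAlloc ε₀ (1 / 2) μ i j) (x / 2) ≤ optAlloc ε₀ (1 / 2) μ i j +
      if optAlloc ε₀ (1 / 2) μ i j < x / 2 then x / 2 else 0 := by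
    intro j
    have := hw0 j
    split_ifs with h
    · exact max_le (by linarith) (by linarith)
    · exact max_le (by linarith) (by linarith)
  have hsum : ∑ j ∈ Finset.univ.erase i, max (optAlloc ε₀ (1 / 2) μ i j) (x / 2) ≤
      1 / 2 + d * (x / 2) := by
    refine (Finset.sum_le_sum fun j _ => hmax j).trans (le_of_eq ?_)
    rw [Finset.sum_add_distrib, sum_optAlloc hK, ← Finset.sum_filter, Finset.sum_const,
      nsmul_eq_mul, hd, numClipped]
    congr 4
    ext j
    simp
  have hpow : (1 - x) ^ d * (1 + d * x) ≤ 1 := by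
    calc (1 - x) ^ d * (1 + d * x) ≤ (1 - x) ^ d * (1 + x) ^ d := by
          gcongr
          exact one_add_mul_le_pow (by linarith) d
      _ = (1 - x ^ 2) ^ d := by rw [← mul_pow]; ring_nf
      _ ≤ 1 := pow_le_one₀ (by nlinarith) (by nlinarith)
  calc ∑ j ∈ Finset.univ.erase i, 2 * clippedAlloc μ ε₀ x i j
      = 2 * (1 - x) ^ d *
        ∑ j ∈ Finset.univ.erase i, max (optAlloc ε₀ (1 / 2) μ i j) (x / 2) := by
        rw [Finset.mul_sum]
        refine Finset.sum_congr rfl fun j _ => ?_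
        rw [clippedAlloc]
        ring
    _ ≤ 2 * (1 - x) ^ d * (1 / 2 + d * (x / 2)) := by gcongr
    _ = (1 - x) ^ d * (1 + d * x) := by ring
    _ ≤ 1 := hpow

theorem nonempty_goodArms (hK : 0 < K) (μ : Fin K → ℝ) {ε : ℝ} (hε : 0 ≤ ε) :
    (goodArms μ ε).Nonempty := by
  obtain ⟨b, hb⟩ := exists_eq_maxMean hK μ
  exact ⟨b, bestArms_subset_goodArms μ hε (by simpa [bestArms] using hb)⟩

theorem clip_max_pos (hK : 2 ≤ K) (ε₀ : ℝ) (μ : Fin K → ℝ) {ε x : ℝ} (hε : 0 ≤ ε)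
    (hx : x ∈ Set.Icc (0 : ℝ) (1 / ((K : ℝ) - 1))) :
    0 < (1 - x) ^ maxNumClipped μ ε₀ ε x := by
  obtain ⟨k, -, hk⟩ := Finset.exists_mem_eq_sup (goodArms μ ε)
    (nonempty_goodArms (by omega) μ hε) (numClipped μ ε₀ x)
  rw [maxNumClipped, hk]
  exact clip_pos hK ε₀ μ hx k

theorem charTime_ne_top_of_sumTime {ε : ℝ} (h : sumTime μ ε₀ ε ≠ ⊤) (hi : i ∈ goodArms μ ε) :
    charTime ε₀ (1 / 2) μ i ≠ ⊤ :=
  (ENNReal.lt_top_of_sum_ne_top h hi).ne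

theorem aconstRefined_pos (hK : 2 ≤ K) {ε x : ℝ} (hε : 0 ≤ ε)
    (hx : x ∈ Set.Icc (0 : ℝ) (1 / ((K : ℝ) - 1))) (h : sumTime μ ε₀ ε ≠ ⊤) :
    0 < aconstRefined μ ε₀ ε x := by
  have hne : Nonempty {i : Fin K // i ∈ goodArms μ ε} :=
    (nonempty_goodArms (by omega) μ hε).to_subtype
  obtain ⟨i, hi⟩ := exists_eq_ciInf_of_finite (f := fun i : {i : Fin K // i ∈ goodArms μ ε} =>
    (1 - x) ^ numClipped μ ε₀ x i * max (minAlloc μ ε₀ i) (x / 2))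
  rw [aconstRefined, ← hi]
  exact mul_pos (clip_pos hK ε₀ μ hx i)
    (lt_max_of_lt_left (minAlloc_pos hK (charTime_ne_top_of_sumTime h i.2)))

theorem aconstRefined_mul_le (hK : 2 ≤ K) {ε x : ℝ} (hε : 0 ≤ ε)
    (hx : x ∈ Set.Icc (0 : ℝ) (1 / ((K : ℝ) - 1))) :
    2 * ((K : ℝ) - 1) * aconstRefined μ ε₀ ε x ≤ 1 := by
  have hK' : (2 : ℝ) ≤ K := by exact_mod_cast hK
  have hK1 : 0 < (K : ℝ) - 1 := by linarith
  obtain ⟨i, hi⟩ := nonempty_goodArms (by omega) μ hε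
  have h1 : aconstRefined μ ε₀ ε x ≤
      (1 - x) ^ numClipped μ ε₀ x i * max (minAlloc μ ε₀ i) (x / 2) :=
    ciInf_le (Set.finite_range _).bddBelow (⟨i, hi⟩ : {i : Fin K // i ∈ goodArms μ ε})
  have h2 : max (minAlloc μ ε₀ i) (x / 2) ≤ 1 / (2 * ((K : ℝ) - 1)) := by
    refine max_le ?_ ?_
    · rw [le_div_iff₀ (by positivity)]
      linarith [minAlloc_mul_le hK ε₀ μ i]
    · rw [one_div, mul_inv, ← div_eq_inv_mul, ← one_div]
      linarith [hx.2]
  have h3 : aconstRefined μ ε₀ ε x ≤ 1 * (1 / (2 * ((K : ℝ) - 1))) :=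
    h1.trans (mul_le_mul (clip_le_one hK hx _) h2 (le_max_of_le_right (by linarith [hx.1]))
      zero_le_one)
  rw [one_mul, le_div_iff₀ (by positivity)] at h3
  linarith

theorem charTime_toReal_pos (hK : 2 ≤ K) (h : charTime ε₀ (1 / 2) μ i ≠ ⊤) :
    0 < (charTime ε₀ (1 / 2) μ i).toReal :=
  ENNReal.toReal_pos (charTime_ne_zero hK ε₀ μ i) h

theorem sumTime_toReal {ε : ℝ} (h : sumTime μ ε₀ ε ≠ ⊤) :
    (sumTime μ ε₀ ε).toReal = ∑ i ∈ goodArms μ ε, (charTime ε₀ (1 / 2) μ i).toReal :=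
  ENNReal.toReal_sum fun _ hi => charTime_ne_top_of_sumTime h hi

theorem sumTime_toReal_pos (hK : 2 ≤ K) {ε : ℝ} (hε : 0 ≤ ε) (h : sumTime μ ε₀ ε ≠ ⊤) :
    0 < (sumTime μ ε₀ ε).toReal := by
  rw [sumTime_toReal h]
  exact Finset.sum_pos (fun i hi => charTime_toReal_pos hK (charTime_ne_top_of_sumTime h hi))
    (nonempty_goodArms (by omega) μ hε)

theorem timeRatio_mul_le {ε : ℝ} (h : sumTime μ ε₀ ε ≠ ⊤) (hpos : 0 < (sumTime μ ε₀ ε).toReal)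
    (hi : i ∈ goodArms μ ε) :
    timeRatio μ ε₀ ε * (sumTime μ ε₀ ε).toReal ≤ (charTime ε₀ (1 / 2) μ i).toReal := by
  rw [timeRatio, ENNReal.toReal_div, div_mul_cancel₀ _ hpos.ne']
  exact ENNReal.toReal_mono (charTime_ne_top_of_sumTime h hi) (iInf₂_le i hi)

theorem timeRatio_pos (hK : 2 ≤ K) {ε : ℝ} (hε : 0 ≤ ε) (h : sumTime μ ε₀ ε ≠ ⊤) :
    0 < timeRatio μ ε₀ ε := by
  obtain ⟨i, hi⟩ := nonempty_goodArms (by omega : 0 < K) μ hε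
  rw [timeRatio, ENNReal.toReal_div]
  refine div_pos (ENNReal.toReal_pos ?_ ?_) (sumTime_toReal_pos hK hε h)
  · rw [← Finset.inf_eq_iInf]
    exact ((Finset.lt_inf_iff (by simp)).2
      fun j _ => pos_iff_ne_zero.2 (charTime_ne_zero hK ε₀ μ j)).ne'
  · exact ((iInf₂_le i hi).trans_lt (charTime_ne_top_of_sumTime h hi).lt_top).ne

theorem timeRatio_le_one (hK : 2 ≤ K) {ε : ℝ} (hε : 0 ≤ ε) (h : sumTime μ ε₀ ε ≠ ⊤) :
    timeRatio μ ε₀ ε ≤ 1 := by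
  obtain ⟨i, hi⟩ := nonempty_goodArms (by omega : 0 < K) μ hε
  have hpos := sumTime_toReal_pos hK hε h
  have h1 := timeRatio_mul_le h hpos hi
  have h2 : (charTime ε₀ (1 / 2) μ i).toReal ≤ (sumTime μ ε₀ ε).toReal := by
    rw [sumTime_toReal h]
    exact Finset.single_le_sum (f := fun i => (charTime ε₀ (1 / 2) μ i).toReal)
      (fun _ _ => ENNReal.toReal_nonneg) hi
  by_contra! hlt
  nlinarith

end Allocation

/-! ### Rounds before stopping -/

theorem threshold_mono {K : ℕ} (δ : ℝ) {t n : ℝ} (ht : 2 ≤ t) (htn : t ≤ n) :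
    threshold K t δ ≤ threshold K n δ := by
  have h0 : 0 ≤ Real.log (t / 2) := Real.log_nonneg (by linarith)
  unfold threshold
  gcongr

/-- If the leader `i` has been chosen `m` times without stopping, some transportation cost bounds
`m`. -/
theorem FollowsEBTC.exists_gap_sq_le {K : ℕ} {ε₀ δ : ℝ} {I B C : ℕ → Fin K} {X : ℕ → ℝ}
    (h : FollowsEBTC ε₀ (1 / 2) I B C X) (hK : 2 ≤ K) {μ : Fin K → ℝ} {α : ℝ} {n : ℕ}
    (hc : Concentrated μ α I X n) (hτ : (n : ℕ∞) < stoppingTime ε₀ δ I B X) {i : Fin K}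
    (hgap : ∀ j, 0 ≤ μ i - μ j + ε₀) {w : Fin K → ℝ} (hw : ∀ j, j ≠ i → 0 < w j)
    (hw1 : ∑ j ∈ Finset.univ.erase i, 2 * w j ≤ 1) {γ : ℝ} (hγ : 0 < γ) (hγ1 : γ ≤ 1 / 2)
    (hm : 6 * ((K : ℝ) - 2) + 2 ≤ leaderCount B (n + 1) i * γ) :
    ∃ j, j ≠ i ∧ (μ i - μ j + ε₀) ^ 2 ≤
      2 * (Real.sqrt (threshold K ((n : ℝ) - 1) δ) + Real.sqrt (α * Real.log n)) ^ 2 *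
        ((1 + γ) * (2 / leaderCount B (n + 1) i) * (2 + 1 / w j)) := by
  have hK' : (2 : ℝ) ≤ K := by exact_mod_cast hK
  set m := leaderCount B (n + 1) i with hmdef
  have hm4 : (4 : ℝ) ≤ m := by nlinarith
  have hm4' : 4 ≤ m := by exact_mod_cast hm4
  -- cutting at half of the rounds leaves `m / 2` rounds for the challengers, and about `m / 4` pulls
  -- of the leader; `hm` absorbs the rounding errors into the factor `1 + γ`
  obtain ⟨t, htK, htn, hB, hh, hu⟩ := h.exists_late_round n i (u := fun j => 2 * w j)
    (fun j hj => mul_pos two_pos (hw j hj)) hw1 (h := (m + 1) / 2) (by omega)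
  set j := C t with hj
  have hji : j ≠ i := by
    have := h.challenger_ne t htK
    rwa [hB] at this
  have hwj := hw j hji
  refine ⟨j, hji, ?_⟩
  set k := (m + 1) / 2 with hk
  have hk1 : (m : ℝ) ≤ 2 * k := by
    have : m ≤ 2 * k := by omega
    exact_mod_cast this
  have hk2 : 2 * (k : ℝ) ≤ m + 1 := by
    have : 2 * k ≤ m + 1 := by omega
    exact_mod_cast this
  -- numbers of pulls at the round `t`
  have hNj : w j * (m / (2 * (1 + γ))) ≤ pulls I t j := by
    have h1 := h.pairCount_add_one_le htK hji.symm
    have h2 : (pairCount B C t i j : ℝ) + 1 ≤ 2 * pulls I t j := by exact_mod_cast h1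
    have h3 : (m : ℝ) / (2 * (1 + γ)) ≤ m - k := by
      rw [div_le_iff₀ (by positivity)]
      nlinarith
    have h4 := mul_le_mul_of_nonneg_left h3 hwj.le
    rw [← hmdef] at hu
    linarith
  have hNi : (m : ℝ) / (4 * (1 + γ)) ≤ pulls I t i := by
    have h1 := h.leaderCount_le htK i
    have h2 : k + 4 ≤ 2 * pulls I t i + 2 * K := by omega
    have h3 : (k : ℝ) + 4 ≤ 2 * pulls I t i + 2 * K := by exact_mod_cast h2
    rw [div_le_iff₀ (by positivity)]
    nlinarith
  set N := (pulls I t i : ℝ) with hN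
  set N' := (pulls I t j : ℝ) with hN'
  have hm0 : (0 : ℝ) < m := by linarith
  have hN0 : 0 < N := lt_of_lt_of_le (by positivity) hNi
  have hN'0 : 0 < N' := lt_of_lt_of_le (by positivity) hNj
  have hvar : 1 / N + 1 / N' ≤ (1 + γ) * (2 / m) * (2 + 1 / w j) := by
    calc 1 / N + 1 / N' ≤ 1 / ((m : ℝ) / (4 * (1 + γ))) + 1 / (w j * (m / (2 * (1 + γ)))) := by
          gcongr
      _ = _ := by field_simp; ring
  set y := Real.sqrt (1 / N + 1 / N') with hy
  have hy0 : 0 < y := by positivity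
  have hy2 : y ^ 2 = 1 / N + 1 / N' := Real.sq_sqrt (by positivity)
  -- the stopping rule does not hold at the round `t`
  have hcost : transportCost ε₀ I X t i j < Real.sqrt (2 * threshold K ((n : ℝ) - 1) δ) := by
    have hts : (t : ℕ∞) < stoppingTime ε₀ δ I B X :=
      lt_of_le_of_lt (by exact_mod_cast htn) hτ
    obtain ⟨l, hl, hlt⟩ := exists_transportCost_lt htK hts
    have hmin := h.challenger t htK l hl
    rw [hB] at hmin hlt
    refine (hmin.trans_lt hlt).trans_le (Real.sqrt_le_sqrt ?_)
    have ht3 : (3 : ℝ) ≤ t := by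
      have : 3 ≤ t := by omega
      exact_mod_cast this
    have htn' : (t : ℝ) ≤ n := by exact_mod_cast htn
    linarith [threshold_mono (K := K) δ (t := (t : ℝ) - 1) (n := (n : ℝ) - 1) (by linarith)
      (by linarith)]
  have hconc := hc t htK htn j i hji
  rw [add_comm (1 / (pulls I t j : ℝ))] at hconc
  rw [← hN, ← hN', ← hy] at hconc
  rw [transportCost, ← hN, ← hN', ← hy, div_lt_iff₀ hy0] at hcost
  set c := threshold K ((n : ℝ) - 1) δ
  have e1 : Real.sqrt (2 * c) = Real.sqrt 2 * Real.sqrt c := Real.sqrt_mul (by norm_num) _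
  have e2 : Real.sqrt (2 * α * Real.log n) = Real.sqrt 2 * Real.sqrt (α * Real.log n) := by
    rw [mul_assoc]; exact Real.sqrt_mul (by norm_num) _
  rw [e1] at hcost
  rw [e2] at hconc
  set D := Real.sqrt c + Real.sqrt (α * Real.log n) with hD
  have hgapD : μ i - μ j + ε₀ ≤ Real.sqrt 2 * D * y := by rw [hD]; linarith
  calc (μ i - μ j + ε₀) ^ 2 ≤ (Real.sqrt 2 * D * y) ^ 2 := by
        have := hgap j
        gcongr
    _ = 2 * D ^ 2 * (1 / N + 1 / N') := by
        rw [mul_pow, mul_pow, Real.sq_sqrt (by norm_num), hy2]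
    _ ≤ _ := by gcongr

/-- On the concentration event, a time before stopping which is large compared with the
`δ`-independent term is bounded by the `δ`-dependent term. -/
theorem FollowsEBTC.sub_one_le {K : ℕ} {ε₀ δ : ℝ} {I B C : ℕ → Fin K} {X : ℕ → ℝ}
    (h : FollowsEBTC ε₀ (1 / 2) I B C X) (hK : 2 ≤ K) (hε₀ : 0 < ε₀) {μ : Fin K → ℝ} {s : ℝ}
    (hs : 0 ≤ s) {n : ℕ} (hn : K < n) (hc : Concentrated μ (2 + s) I X n)
    (hτ : (n : ℕ∞) < stoppingTime ε₀ δ I B X) {ε x γ : ℝ} (hε : ε ∈ Set.Icc (0 : ℝ) ε₀)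
    (hx : x ∈ Set.Icc (0 : ℝ) (1 / ((K : ℝ) - 1))) (hγ : γ ∈ Set.Ioc (0 : ℝ) (1 / 2))
    (hfin : sumTime μ ε₀ ε ≠ ⊤)
    (hlarge : (1 + γ⁻¹) * (4 * (2 + s) * Real.log n * Hconst μ ε₀ ε + (3 * (K : ℝ) ^ 2 / 4 + 1)) <
      aconstRefined μ ε₀ ε x * timeRatio μ ε₀ ε * ((n : ℝ) - 1)) :
    (n : ℝ) - 1 ≤ 2 * (1 + γ) ^ 2 / (1 - x) ^ maxNumClipped μ ε₀ ε x * (sumTime μ ε₀ ε).toReal *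
      (Real.sqrt (threshold K ((n : ℝ) - 1) δ) + Real.sqrt ((2 + s) * Real.log n)) ^ 2 := by
  obtain ⟨hγ0, hγ1⟩ := hγ
  have hK' : (2 : ℝ) ≤ K := by exact_mod_cast hK
  have hn' : (K : ℝ) + 1 ≤ n := by exact_mod_cast hn
  have ha := aconstRefined_pos hK hε.1 hx hfin
  have ha1 : 2 * ((K : ℝ) - 1) * aconstRefined μ ε₀ ε x ≤ 1 := aconstRefined_mul_le hK hε.1 hx
  have hv := timeRatio_pos hK hε.1 hfin
  have hv1 := timeRatio_le_one hK hε.1 hfin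
  have hT0 := sumTime_toReal_pos hK hε.1 hfin
  have hbad := h.card_bad_le hK hε₀ hε.1 hc
  have hlog : 0 ≤ Real.log n := Real.log_natCast_nonneg n
  rw [Real.sq_sqrt (by positivity)] at hbad
  have hH := Hconst_nonneg μ ε₀ hε.1
  set a := aconstRefined μ ε₀ ε x
  set v := timeRatio μ ε₀ ε
  set T := (sumTime μ ε₀ ε).toReal with hT
  set p := (n : ℝ) - 1 with hp
  have hp0 : 0 < p := by rw [hp]; linarith
  set z := (2 + s) * Real.log n * Hconst μ ε₀ ε with hz
  have hz0 : 0 ≤ z := by positivity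
  set c := 4 * z + (3 * (K : ℝ) ^ 2 / 4 + 1) with hcdef
  have hlarge' : (1 + γ) * c < a * v * γ * p := by
    have h1 : (1 + γ⁻¹) * c < a * v * p := by
      rw [hcdef, hz]; convert hlarge using 2; ring
    calc (1 + γ) * c = γ * ((1 + γ⁻¹) * c) := by field_simp; ring
      _ < γ * (a * v * p) := by gcongr
      _ = _ := by ring
  have hc4 : 4 ≤ c := by rw [hcdef]; nlinarith
  -- the rounds with an `ε`-good leader
  set bad := (((Finset.Ioo K (n + 1)).filter fun t => B t ∉ goodArms μ ε).card : ℝ) with hbaddef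
  set R := ∑ i ∈ goodArms μ ε, (leaderCount B (n + 1) i : ℝ) with hR
  have hRbad : R + bad = n - K := by
    have h1 : ((Finset.Ioo K (n + 1)).filter fun t => B t ∈ goodArms μ ε).card =
        ∑ i ∈ goodArms μ ε, leaderCount B (n + 1) i := by
      rw [Finset.card_eq_sum_card_fiberwise (f := B) (t := goodArms μ ε)]
      · refine Finset.sum_congr rfl fun i hi => ?_
        rw [leaderCount, Finset.filter_filter]
        congr 1
        refine Finset.filter_congr fun t _ => ?_
        constructor
        · exact fun h => h.2
        · rintro rfl; exact ⟨hi, rfl⟩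
      · intro t ht
        simp only [Finset.coe_filter, Set.mem_ofPred_eq] at ht
        exact ht.2
    have h2 := Finset.card_filter_add_card_filter_not (s := Finset.Ioo K (n + 1))
      (fun t => B t ∈ goodArms μ ε)
    rw [h1, Nat.card_Ioo] at h2
    have h3 : ((∑ i ∈ goodArms μ ε, leaderCount B (n + 1) i : ℕ) : ℝ) + bad = ((n - K : ℕ) : ℝ) := by
      rw [hbaddef, ← Nat.cast_add, h2]
      congr 1
      omega
    rw [Nat.cast_sum, Nat.cast_sub hn.le] at h3
    exact h3
  have hbad' : bad + (K - 1) ≤ 2 * ((K : ℝ) - 1) * c := by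
    have e : ((K : ℝ) - 1) * (4 * (2 * (2 + s) * Real.log n) * Hconst μ ε₀ ε + (2 * K - 3)) =
      ((K : ℝ) - 1) * (8 * z + (2 * K - 3)) := by rw [hz]; ring
    rw [e] at hbad
    have h1 : ((K : ℝ) - 1) * (8 * z + (2 * K - 2)) ≤ ((K : ℝ) - 1) * (2 * c) := by
      refine mul_le_mul_of_nonneg_left ?_ (by linarith)
      rw [hcdef]
      nlinarith
    linarith
  have hRp : p ≤ R * (1 + γ) := by
    have h1 : (bad + (K - 1)) * (1 + γ) ≤ γ * p := by
      calc (bad + (K - 1)) * (1 + γ) ≤ 2 * ((K : ℝ) - 1) * c * (1 + γ) := by gcongr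
        _ = 2 * ((K : ℝ) - 1) * ((1 + γ) * c) := by ring
        _ ≤ 2 * ((K : ℝ) - 1) * (a * v * γ * p) := by
            refine mul_le_mul_of_nonneg_left hlarge'.le (by linarith)
        _ = (2 * ((K : ℝ) - 1) * a) * (v * γ * p) := by ring
        _ ≤ 1 * (1 * γ * p) := by gcongr
        _ = γ * p := by ring
    have h2 : R = p - (bad + (K - 1)) := by rw [hp]; linarith
    rw [h2]
    linarith
  -- a good arm which is the leader at least its share of the rounds
  obtain ⟨i, hi, hmi⟩ := Finset.exists_le_of_sum_le (s := goodArms μ ε)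
    (f := fun i => (charTime ε₀ (1 / 2) μ i).toReal / T * R)
    (g := fun i => (leaderCount B (n + 1) i : ℝ)) (nonempty_goodArms (by omega) μ hε.1)
    (by
      rw [← Finset.sum_mul, ← Finset.sum_div, ← sumTime_toReal hfin, ← hT, div_self hT0.ne', one_mul])
  have hfi := charTime_ne_top_of_sumTime hfin hi
  have hTi := charTime_toReal_pos hK hfi
  have hvi := timeRatio_mul_le hfin hT0 hi
  set Ti := (charTime ε₀ (1 / 2) μ i).toReal with hTidef
  have hm1 : Ti / T * p ≤ leaderCount B (n + 1) i * (1 + γ) := by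
    calc Ti / T * p ≤ Ti / T * (R * (1 + γ)) := by gcongr
      _ = Ti / T * R * (1 + γ) := by ring
      _ ≤ _ := by gcongr
  have hm2 : v * p ≤ leaderCount B (n + 1) i * (1 + γ) := by
    refine le_trans ?_ hm1
    gcongr
    rw [le_div_iff₀ hT0]
    exact hvi
  set m := leaderCount B (n + 1) i with hmdef
  have hcm : c < a * γ * m := by
    have h1 : (1 + γ) * c < (1 + γ) * (a * γ * m) := by
      calc (1 + γ) * c < a * v * γ * p := hlarge'
        _ = a * γ * (v * p) := by ring
        _ ≤ a * γ * (m * (1 + γ)) := by gcongr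
        _ = _ := by ring
    exact lt_of_mul_lt_mul_left h1 (by positivity)
  have hmγ : 6 * ((K : ℝ) - 2) + 2 ≤ m * γ := by
    have h1 : 2 * ((K : ℝ) - 1) * c ≤ 2 * ((K : ℝ) - 1) * (a * γ * m) :=
      mul_le_mul_of_nonneg_left hcm.le (by linarith)
    have h2 : 2 * ((K : ℝ) - 1) * a * (γ * m) ≤ 1 * (γ * m) := by gcongr
    have h3 : 2 * ((K : ℝ) - 1) * 4 ≤ 2 * ((K : ℝ) - 1) * c :=
      mul_le_mul_of_nonneg_left hc4 (by linarith)
    linarith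
  have hm0 : (0 : ℝ) < m := by
    have : 0 < (m : ℝ) * γ := by linarith
    exact (pos_iff_pos_of_mul_pos this).2 hγ0
  have hgap : ∀ j, 0 ≤ μ i - μ j + ε₀ := by
    intro j
    have h1 := le_maxMean μ j
    simp only [goodArms, Finset.mem_filter, Finset.mem_univ, true_and] at hi
    linarith [hε.2]
  have hq := clip_pos hK ε₀ μ hx i
  have hq1 := clip_le_one hK hx (numClipped μ ε₀ x i)
  have hx1 : x ≤ 1 := hx.2.trans (inv_natCast_sub_one_le_one hK)
  obtain ⟨j, hj, hgj⟩ := h.exists_gap_sq_le hK hc hτ hgap (w := clippedAlloc μ ε₀ x i)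
    (fun j hj => mul_pos hq (lt_max_of_lt_left (optAlloc_pos hK hfi hj).1))
    (sum_clippedAlloc_le hK ε₀ μ hx i) hγ0 hγ1 hmγ
  obtain ⟨hwj, hTj⟩ := optAlloc_pos hK hfi hj
  rw [← hTidef] at hTj
  rw [← hmdef] at hgj
  set D := Real.sqrt (threshold K p δ) + Real.sqrt ((2 + s) * Real.log n)
  set q := (1 - x) ^ numClipped μ ε₀ x i with hqdef
  set wj := optAlloc ε₀ (1 / 2) μ i j
  have hclip : 2 + 1 / clippedAlloc μ ε₀ x i j ≤ (2 + 1 / wj) / q := by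
    have h1 : q * wj ≤ clippedAlloc μ ε₀ x i j := by
      rw [clippedAlloc, ← hqdef]
      gcongr
      exact le_max_left _ _
    calc 2 + 1 / clippedAlloc μ ε₀ x i j ≤ 2 / q + 1 / (q * wj) := by
          refine add_le_add ?_ ?_
          · rw [le_div_iff₀ hq]; linarith
          · gcongr
      _ = _ := by field_simp
  have hfinal : q * m ≤ 2 * Ti * D ^ 2 * (1 + γ) := by
    have h1 : 2 * (2 + 1 / wj) ≤
        Ti * (2 * D ^ 2 * ((1 + γ) * (2 / m) * ((2 + 1 / wj) / q))) := by
      refine hTj.trans ?_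
      gcongr
      refine hgj.trans ?_
      gcongr
    have h2 : Ti * (2 * D ^ 2 * ((1 + γ) * (2 / m) * ((2 + 1 / wj) / q))) =
      (2 * (2 + 1 / wj)) * (2 * Ti * D ^ 2 * (1 + γ) / (q * m)) := by field_simp
    rw [h2] at h1
    have h3 : 1 ≤ 2 * Ti * D ^ 2 * (1 + γ) / (q * m) :=
      le_of_mul_le_mul_left (by rw [mul_one]; exact h1) (by positivity : 0 < 2 * (2 + 1 / wj))
    rwa [le_div_iff₀ (by positivity), one_mul] at h3
  have hqmax : (1 - x) ^ maxNumClipped μ ε₀ ε x ≤ q :=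
    pow_le_pow_of_le_one (by linarith) (by linarith [hx.1]) (Finset.le_sup hi)
  have hqmax0 := clip_max_pos hK ε₀ μ hε.1 hx
  have hpq : q * p ≤ 2 * (1 + γ) ^ 2 * T * D ^ 2 := by
    have h1 : Ti * (q * p) ≤ Ti * (2 * (1 + γ) ^ 2 * T * D ^ 2) := by
      calc Ti * (q * p) = q * T * (Ti / T * p) := by field_simp
        _ ≤ q * T * (m * (1 + γ)) := by gcongr
        _ = T * (1 + γ) * (q * m) := by ring
        _ ≤ T * (1 + γ) * (2 * Ti * D ^ 2 * (1 + γ)) := by gcongr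
        _ = _ := by ring
    exact le_of_mul_le_mul_left h1 hTi
  calc p ≤ 2 * (1 + γ) ^ 2 * T * D ^ 2 / q := by rw [le_div_iff₀ hq]; linarith
    _ ≤ 2 * (1 + γ) ^ 2 * T * D ^ 2 / (1 - x) ^ maxNumClipped μ ε₀ ε x := by gcongr
    _ = _ := by ring

/-! ### The Lambert function -/

theorem Wbar_spec {x : ℝ} (hx : 1 ≤ x) : 1 ≤ Wbar x ∧ Wbar x - Real.log (Wbar x) = x := by
  set S := {w : ℝ | w ≤ -1 ∧ w * Real.exp w = -Real.exp (-x)} with hS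
  have hne : S.Nonempty := by
    have hcont : ContinuousOn (fun u : ℝ => u - Real.log u) (Set.Icc 1 ((x + 2) ^ 2)) := by
      refine continuousOn_id.sub (Real.continuousOn_log.mono ?_)
      intro u hu
      have : u ≠ 0 := by linarith [hu.1]
      simpa using this
    have hmem : x ∈ Set.Icc ((fun u : ℝ => u - Real.log u) 1)
        ((fun u : ℝ => u - Real.log u) ((x + 2) ^ 2)) := by
      constructor
      · simpa using hx
      · have h1 := Real.log_le_sub_one_of_pos (by linarith : 0 < x + 2)
        simp only [Real.log_pow, Nat.cast_ofNat]
        nlinarith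
    obtain ⟨u, hu, hux⟩ := intermediate_value_Icc (by nlinarith) hcont hmem
    have hu0 : 0 < u := by linarith [hu.1]
    refine ⟨-u, by linarith [hu.1], ?_⟩
    rw [← hux]
    simp only [neg_sub, neg_mul, neg_inj]
    rw [Real.exp_sub, Real.exp_log hu0, Real.exp_neg, div_eq_mul_inv]
  have hclosed : IsClosed S :=
    isClosed_Iic.inter (isClosed_eq (by fun_prop) continuous_const)
  have hmem : lambertWNeg (-Real.exp (-x)) ∈ S :=
    hclosed.csSup_mem hne ⟨-1, fun w hw => hw.1⟩
  obtain ⟨h1, h2⟩ := hmem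
  have hW : lambertWNeg (-Real.exp (-x)) = -Wbar x := by rw [Wbar, neg_neg]
  rw [hW] at h1 h2
  have h3 : 1 ≤ Wbar x := by linarith
  refine ⟨h3, ?_⟩
  have h4 : Wbar x * Real.exp (-Wbar x) = Real.exp (-x) := by linarith
  have h5 := congrArg Real.log h4
  rw [Real.log_mul (by linarith) (Real.exp_pos _).ne', Real.log_exp, Real.log_exp] at h5
  linarith

/-- Beyond `h₁(z,y)`, the linear function dominates `y + z log`. -/
theorem add_mul_log_lt_of_h1_lt {z y t : ℝ} (hz : 0 ≤ z) (hy : 1 ≤ y) (h : h1 z y < t) :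
    y + z * Real.log t < t := by
  unfold h1 at h
  split_ifs at h with h0
  · simpa [h0] using h
  · have hz0 : 0 < z := lt_of_le_of_ne hz (Ne.symm h0)
    have hx : 1 ≤ y / z + Real.log z := by
      have h1 := Real.one_sub_inv_le_log_of_pos (by positivity : 0 < z / y)
      rw [Real.log_div hz0.ne' (by linarith), inv_div] at h1
      linarith [Real.log_nonneg hy]
    obtain ⟨hW1, hW2⟩ := Wbar_spec hx
    set W := Wbar (y / z + Real.log z)
    have hS0 : 0 < z * W := by positivity
    have ht0 : 0 < t := hS0.trans h
    have hS : z * W - z * Real.log (z * W) = y := by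
      rw [Real.log_mul hz0.ne' (by linarith)]
      have : z * (W - Real.log W) = y + z * Real.log z := by rw [hW2]; field_simp
      linarith
    have hlog := Real.log_lt_sub_one_of_pos (div_pos ht0 hS0) (by
      rw [Ne, div_eq_one_iff_eq hS0.ne']; exact h.ne')
    rw [Real.log_div ht0.ne' hS0.ne'] at hlog
    have h1 : z * (Real.log t - Real.log (z * W)) < z * (t / (z * W) - 1) := by gcongr
    have h2 : z * (t / (z * W) - 1) = (t - z * W) / W := by field_simp
    have h3 : (t - z * W) / W ≤ t - z * W := div_le_self (by linarith) hW1
    linarith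

/-! ### Expected sample complexity -/

/-- Bound on the mean of an integer-valued variable `τ` whose tail events `n < τ` are, for
`n > M`, contained in events of summable probabilities. -/
theorem lintegral_toENNReal_le {Ω : Type*} {mΩ : MeasurableSpace Ω} (P : Measure Ω)
    [IsProbabilityMeasure P] (τ : Ω → ℕ∞) (E : ℕ → Set Ω) (M : ℝ≥0∞) {c s : ℝ} (hc : 0 ≤ c)
    (hs : 1 < s) (hE : ∀ n : ℕ, 1 ≤ n → P (E n) ≤ ENNReal.ofReal (c * (n : ℝ) ^ (-s)))
    (h : ∀ ω, ∀ n : ℕ, (n : ℕ∞) < τ ω → M < n → ω ∈ E n) :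
    ∫⁻ ω, (τ ω : ℝ≥0∞) ∂P ≤ M + 1 + ENNReal.ofReal (c * (riemannZeta (s : ℂ)).re) := by
  rcases eq_or_ne M ⊤ with rfl | hM
  · simp
  set N : ℕ := ⌊M.toReal⌋₊ + 1 with hN
  have hN1 : (N : ℝ≥0∞) ≤ M + 1 := by
    rw [hN, Nat.cast_add, Nat.cast_one]
    gcongr
    rw [← ENNReal.ofReal_natCast]
    exact ENNReal.ofReal_le_of_le_toReal (Nat.floor_le ENNReal.toReal_nonneg)
  have hNM : ∀ n, N ≤ n → M < n := by
    intro n hn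
    rw [← ENNReal.ofReal_toReal hM, ← ENNReal.ofReal_natCast]
    have h1 : M.toReal < N := by rw [hN]; push_cast; exact Nat.lt_floor_add_one _
    have h2 : (N : ℝ) ≤ n := by exact_mod_cast hn
    exact (ENNReal.ofReal_lt_ofReal_iff (lt_of_le_of_lt ENNReal.toReal_nonneg (h1.trans_le h2))).2
      (h1.trans_le h2)
  -- measurable hulls, since the events are not assumed to be measurable
  set F : ℕ → Set Ω := fun n => toMeasurable P (E n) with hF
  have hpt : ∀ ω, (τ ω : ℝ≥0∞) ≤ N + ∑' k : ℕ, (F (N + k)).indicator 1 ω := by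
    intro ω
    have hone : ∀ k : ℕ, ((N + k : ℕ) : ℕ∞) < τ ω → (F (N + k)).indicator (1 : Ω → ℝ≥0∞) ω = 1 := by
      intro k hk
      have : ω ∈ F (N + k) :=
        subset_toMeasurable P _ (h ω (N + k) hk (hNM _ (Nat.le_add_right N k)))
      simp [this]
    rcases hτ : τ ω with _ | m
    · have : ∀ k : ℕ, (F (N + k)).indicator (1 : Ω → ℝ≥0∞) ω = 1 := by
        intro k
        refine hone k ?_
        rw [hτ]
        exact ENat.natCast_lt_top _
      simp only [this]
      rw [ENNReal.tsum_const_eq_top_of_ne_zero one_ne_zero]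
      simp
    · calc (((m : ℕ) : ℕ∞) : ℝ≥0∞) = (m : ℝ≥0∞) := by simp
        _ ≤ ((N + (m - N) : ℕ) : ℝ≥0∞) := by
          exact_mod_cast (by omega : m ≤ N + (m - N))
        _ = N + ∑ k ∈ Finset.range (m - N), (F (N + k)).indicator (1 : Ω → ℝ≥0∞) ω := by
          rw [Finset.sum_congr rfl fun k hk => hone k ?_]
          · simp
          · rw [hτ]
            rw [Finset.mem_range] at hk
            exact Nat.cast_lt.2 (by omega)
        _ ≤ _ := by gcongr; exact ENNReal.sum_le_tsum _
  calc ∫⁻ ω, (τ ω : ℝ≥0∞) ∂P ≤ ∫⁻ ω, (N + ∑' k : ℕ, (F (N + k)).indicator 1 ω) ∂P :=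
        lintegral_mono hpt
    _ = N + ∑' k : ℕ, P (E (N + k)) := by
        rw [lintegral_add_left measurable_const, lintegral_const, measure_univ, mul_one,
          lintegral_tsum fun k => (measurable_one.indicator (measurableSet_toMeasurable P _)).aemeasurable]
        congr 2
        ext k
        rw [lintegral_indicator_one (measurableSet_toMeasurable P _), measure_toMeasurable]
    _ ≤ (M + 1) + ∑' k : ℕ, ENNReal.ofReal c * ENNReal.ofReal (((k : ℝ) + 1) ^ (-s)) := by
        gcongr with k
        refine (hE (N + k) (by omega)).trans ?_
        rw [← ENNReal.ofReal_mul hc]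
        refine ENNReal.ofReal_le_ofReal (mul_le_mul_of_nonneg_left ?_ hc)
        refine Real.rpow_le_rpow_of_nonpos (by positivity) ?_ (by linarith)
        have : k + 1 ≤ N + k := by omega
        exact_mod_cast this
    _ = _ := by rw [ENNReal.tsum_mul_left, tsum_ofReal_eq_zeta hs, ← ENNReal.ofReal_mul hc]

theorem largestTime_top {K : ℕ} (hK : 2 ≤ K) (δ : ℝ) {b : ℝ} (hb : 0 < b) :
    largestTime K δ ⊤ b = ⊤ := by
  by_contra hne
  obtain ⟨m, hm⟩ := ENNReal.exists_nat_gt hne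
  refine absurd hm (not_lt.2 ?_)
  have hlog : 0 < Real.log ((K + 1 + m : ℕ) : ℝ) := by
    refine Real.log_pos ?_
    have : 1 < K + 1 + m := by omega
    exact_mod_cast this
  have hD : 0 < (Real.sqrt (threshold K (((K + 1 + m : ℕ) : ℝ) - 1) δ) +
      Real.sqrt (b * Real.log ((K + 1 + m : ℕ) : ℝ))) ^ 2 := by positivity
  calc (m : ℝ≥0∞) ≤ ((K + 1 + m : ℕ) : ℝ≥0∞) := by
        exact_mod_cast (by omega : m ≤ K + 1 + m)
    _ ≤ _ := by
        refine le_iSup₂_of_le (f := fun (n : ℕ) (_ : n ∈ {n : ℕ | K < n ∧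
          ENNReal.ofReal ((n : ℝ) - 1) ≤ ⊤ * ENNReal.ofReal
            ((Real.sqrt (threshold K ((n : ℝ) - 1) δ) + Real.sqrt (b * Real.log n)) ^ 2)}) =>
          (n : ℝ≥0∞)) (K + 1 + m) ⟨by omega, ?_⟩ le_rfl
        rw [ENNReal.top_mul (ENNReal.ofReal_pos.2 hD).ne']
        exact le_top

/-- The bound on the expected sample complexity at given `ε` and `x`, with any `y` which is at least
the second argument of `h₁` in the definition of `StermRefined`. -/
theorem IsBanditRun.lintegral_stoppingTime_le {K : ℕ} (hK : 2 ≤ K) {Ω : Type*}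
    {mΩ : MeasurableSpace Ω} {P : Measure Ω} [IsProbabilityMeasure P] {ν : Fin K → Measure ℝ}
    [∀ i, IsProbabilityMeasure (ν i)] {ℱ : Filtration ℕ mΩ} {I B C : ℕ → Ω → Fin K}
    {X : ℕ → Ω → ℝ} (h : IsBanditRun P ν ℱ I X) (hν : ∀ i, IsOneSubGaussian (ν i))
    {ε₀ : ℝ} (hε₀ : 0 < ε₀) (δ : ℝ)
    (halg : ∀ ω, FollowsEBTC ε₀ (1 / 2) (fun n => I n ω) (fun n => B n ω) (fun n => C n ω)
      (fun n => X n ω)) {ε x γ s y : ℝ} (hε : ε ∈ Set.Icc (0 : ℝ) ε₀)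
    (hx : x ∈ Set.Icc (0 : ℝ) (1 / ((K : ℝ) - 1))) (hγ : γ ∈ Set.Ioc (0 : ℝ) (1 / 2)) (hs : 1 < s)
    (hy : (1 + γ⁻¹) * (3 * (K : ℝ) ^ 2 / 4 + 1) /
      (aconstRefined (means ν) ε₀ ε x * timeRatio (means ν) ε₀ ε) + 1 ≤ y) :
    ∫⁻ ω, (stoppingTime ε₀ δ (fun n => I n ω) (fun n => B n ω) (fun n => X n ω) : ℝ≥0∞) ∂P ≤
      max (TtermRefined (means ν) ε₀ γ s δ ε x + 1) (ENNReal.ofReal (h1 (4 * (2 + s) * (1 + γ⁻¹) /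
        (aconstRefined (means ν) ε₀ ε x * timeRatio (means ν) ε₀ ε) * Hconst (means ν) ε₀ ε) y)) +
      ENNReal.ofReal ((riemannZeta (s : ℂ)).re * ((K : ℝ) * ((K : ℝ) + 1) / 2)) := by
  have hK' : (2 : ℝ) ≤ K := by exact_mod_cast hK
  have hγ0 := hγ.1
  have hclip := clip_max_pos hK ε₀ (means ν) hε.1 hx
  by_cases hfin : sumTime (means ν) ε₀ ε = ⊤
  · have : TtermRefined (means ν) ε₀ γ s δ ε x = ⊤ := by
      have hpos : 0 < 2 * (1 + γ) ^ 2 / (1 - x) ^ maxNumClipped (means ν) ε₀ ε x := by positivity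
      rw [TtermRefined, hfin, ENNReal.mul_top (by simpa using hpos)]
      exact largestTime_top hK δ (by linarith)
    simp [this]
  have ha := aconstRefined_pos hK hε.1 hx hfin
  have ha1 : 2 * ((K : ℝ) - 1) * aconstRefined (means ν) ε₀ ε x ≤ 1 :=
    aconstRefined_mul_le hK hε.1 hx
  have hv := timeRatio_pos hK hε.1 hfin
  have hv1 := timeRatio_le_one hK hε.1 hfin
  have hH := Hconst_nonneg (means ν) ε₀ hε.1
  set a := aconstRefined (means ν) ε₀ ε x
  set v := timeRatio (means ν) ε₀ ε
  set H := Hconst (means ν) ε₀ ε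
  set z := 4 * (2 + s) * (1 + γ⁻¹) / (a * v) * H with hz
  have hz0 : 0 ≤ z := by positivity
  have hav : a * v ≤ 1 := by nlinarith
  have hyK : (K : ℝ) ≤ y := by
    have h1 : (3 * (K : ℝ) ^ 2 / 4 + 1) ≤ (1 + γ⁻¹) * (3 * (K : ℝ) ^ 2 / 4 + 1) / (a * v) := by
      rw [le_div_iff₀ (by positivity)]
      have : 0 < γ⁻¹ := inv_pos.2 hγ0
      have h2 : (3 * (K : ℝ) ^ 2 / 4 + 1) * (a * v) ≤ (3 * (K : ℝ) ^ 2 / 4 + 1) * 1 := by gcongr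
      nlinarith [mul_pos this (by positivity : 0 < 3 * (K : ℝ) ^ 2 / 4 + 1)]
    nlinarith
  have hmean := lintegral_toENNReal_le P
    (fun ω => stoppingTime ε₀ δ (fun n => I n ω) (fun n => B n ω) (fun n => X n ω))
    (fun n => {ω | ¬ Concentrated (means ν) (2 + s) (fun t => I t ω) (fun t => X t ω) n})
    (max (TtermRefined (means ν) ε₀ γ s δ ε x + 1) (ENNReal.ofReal (h1 z y)))
    (c := (K : ℝ) * ((K : ℝ) - 1) / 2) (by
      have : 0 ≤ (K : ℝ) - 1 := by linarith
      positivity) hs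
    (fun n hn => h.measure_not_concentrated_le hν halg (by linarith) hn) ?_
  · refine hmean.trans ?_
    rw [add_assoc]
    gcongr
    -- the unit lost in rounding up is absorbed by the difference between `K (K - 1)` and `K (K + 1)`
    have hζ := one_le_riemannZeta_re hs
    have hKK : 0 ≤ (K : ℝ) * ((K : ℝ) - 1) / 2 := by
      have : 0 ≤ (K : ℝ) - 1 := by linarith
      positivity
    rw [← ENNReal.ofReal_one, ← ENNReal.ofReal_add zero_le_one (mul_nonneg hKK (by linarith))]
    refine ENNReal.ofReal_le_ofReal ?_
    nlinarith
  · intro ω n hn hMn hconc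
    rw [max_lt_iff] at hMn
    obtain ⟨hTn, hSn⟩ := hMn
    have hSn' : h1 z y < n := by
      by_contra! hle
      refine absurd hSn (not_lt.2 ?_)
      rw [← ENNReal.ofReal_natCast]
      exact ENNReal.ofReal_le_ofReal hle
    have hlt := add_mul_log_lt_of_h1_lt hz0 (by linarith) hSn'
    have hlog : 0 ≤ Real.log n := Real.log_natCast_nonneg n
    have hKn : K < n := by
      have : (K : ℝ) < n := by nlinarith [mul_nonneg hz0 hlog]
      exact_mod_cast this
    -- `n` is beyond `h₁`, so the `δ`-independent constraint holds, and `n` is in the set whose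
    -- supremum is the `δ`-dependent term
    have hbound := (halg ω).sub_one_le hK hε₀ (by linarith : (0 : ℝ) ≤ s) hKn hconc hn hε hx hγ hfin
      (by
        have h1 : (1 + γ⁻¹) * (3 * (K : ℝ) ^ 2 / 4 + 1) / (a * v) + z * Real.log n < (n : ℝ) - 1 := by
          linarith
        have h2 : (1 + γ⁻¹) * (3 * (K : ℝ) ^ 2 / 4 + 1) / (a * v) + z * Real.log n =
          (1 + γ⁻¹) * (4 * (2 + s) * Real.log n * H + (3 * (K : ℝ) ^ 2 / 4 + 1)) / (a * v) := by
          rw [hz]; field_simp; ring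
        rw [h2, div_lt_iff₀ (by positivity)] at h1
        linarith)
    have hle : (n : ℝ≥0∞) ≤ TtermRefined (means ν) ε₀ γ s δ ε x := by
      refine le_iSup₂_of_le (f := fun (n : ℕ) (_ : n ∈ {n : ℕ | K < n ∧
          ENNReal.ofReal ((n : ℝ) - 1) ≤ _ * ENNReal.ofReal
            ((Real.sqrt (threshold K ((n : ℝ) - 1) δ) + Real.sqrt ((2 + s) * Real.log n)) ^ 2)}) =>
          (n : ℝ≥0∞)) n ⟨hKn, ?_⟩ le_rfl
      have hpos : 0 ≤ 2 * (1 + γ) ^ 2 / (1 - x) ^ maxNumClipped (means ν) ε₀ ε x := by positivity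
      rw [← ENNReal.ofReal_toReal hfin, ← ENNReal.ofReal_mul hpos,
        ← ENNReal.ofReal_mul (mul_nonneg hpos ENNReal.toReal_nonneg)]
      exact ENNReal.ofReal_le_ofReal hbound
    exact absurd (hle.trans le_self_add) (not_le.2 hTn)

theorem minAlloc_nonneg {K : ℕ} (hK : 2 ≤ K) (μ : Fin K → ℝ) (ε₀ : ℝ) (i : Fin K) :
    0 ≤ minAlloc μ ε₀ i :=
  Real.iInf_nonneg fun j =>
    (optAlloc_spec hK ε₀ (β := 1 / 2) (by norm_num) (by norm_num) μ i).1.1.1 j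

theorem aconst_eq {K : ℕ} (hK : 2 ≤ K) (μ : Fin K → ℝ) (ε₀ ε : ℝ) :
    aconst μ ε₀ ε = aconstRefined μ ε₀ ε 0 * timeRatio μ ε₀ ε := by
  rw [aconst, aconstRefined, mul_comm]
  congr 2
  ext i
  rw [sub_zero, one_pow, one_mul, zero_div, max_eq_left (minAlloc_nonneg hK μ ε₀ i)]

theorem Tterm_eq {K : ℕ} (μ : Fin K → ℝ) (ε₀ γ δ ε : ℝ) :
    Tterm μ ε₀ γ δ ε = TtermRefined μ ε₀ γ 2 δ ε 0 := by
  rw [Tterm, TtermRefined, sub_zero, one_pow, div_one]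
  norm_num

theorem riemannZeta_two_re_le : (riemannZeta ((2 : ℝ) : ℂ)).re ≤ 2 := by
  have h : riemannZeta ((2 : ℝ) : ℂ) = ((Real.pi ^ 2 / 6 : ℝ) : ℂ) := by
    push_cast
    exact riemannZeta_two
  rw [h, Complex.ofReal_re]
  have := Real.pi_lt_d2
  nlinarith [Real.pi_pos]

end EBTC

open EBTC in
theorem theorem2 {K : ℕ} (hK : 2 ≤ K)
    {Ω : Type*} {mΩ : MeasurableSpace Ω} (P : Measure Ω) [IsProbabilityMeasure P]
    (ν : Fin K → Measure ℝ) [∀ i, IsProbabilityMeasure (ν i)] (hν : ∀ i, IsOneSubGaussian (ν i))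
    (ε₀ : ℝ) (hε₀ : 0 < ε₀) (δ : ℝ) (hδ₀ : 0 < δ) (hδ₁ : δ < 1)
    (ℱ : Filtration ℕ mΩ) (I B C : ℕ → Ω → Fin K) (X : ℕ → Ω → ℝ)
    (hrun : IsBanditRun P ν ℱ I X)
    (hB : ∀ n, K < n → Measurable[ℱ n] (B n)) (hC : ∀ n, K < n → Measurable[ℱ n] (C n))
    (halg : ∀ ω, FollowsEBTC ε₀ (1 / 2) (fun n => I n ω) (fun n => B n ω) (fun n => C n ω)
      (fun n => X n ω)) :
    -- `(ε₁, δ)`-PAC for all `ε₁ ≥ ε₀`, in particular `(ε₀, δ)`-PAC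
    (∀ ε₁, ε₀ ≤ ε₁ →
      P {ω | ∃ n : ℕ, stoppingTime ε₁ δ (fun n => I n ω) (fun n => B n ω) (fun n => X n ω) = n ∧
          B n ω ∉ goodArms (means ν) ε₁} ≤ ENNReal.ofReal δ) ∧
    -- bound on the expected sample complexity
    (∀ γ ∈ Set.Ioc (0 : ℝ) (1 / 2),
      ∫⁻ ω, (stoppingTime ε₀ δ (fun n => I n ω) (fun n => B n ω) (fun n => X n ω) : ℝ≥0∞) ∂P
        ≤ (⨅ ε ∈ Set.Icc (0 : ℝ) ε₀,
            max (Tterm (means ν) ε₀ γ δ ε + 1) (ENNReal.ofReal (Sterm (means ν) ε₀ γ ε)))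
          + 2 * (K : ℝ≥0∞) ^ 2) ∧
    -- monotonicity in the error of the stopping rule
    (∀ ε₁, ε₀ ≤ ε₁ →
      ∫⁻ ω, (stoppingTime ε₁ δ (fun n => I n ω) (fun n => B n ω) (fun n => X n ω) : ℝ≥0∞) ∂P
        ≤ ∫⁻ ω, (stoppingTime ε₀ δ (fun n => I n ω) (fun n => B n ω) (fun n => X n ω) : ℝ≥0∞) ∂P) ∧
    -- refined bound on the expected sample complexity
    (∀ γ ∈ Set.Ioc (0 : ℝ) (1 / 2), ∀ s : ℝ, 1 < s →
      ∫⁻ ω, (stoppingTime ε₀ δ (fun n => I n ω) (fun n => B n ω) (fun n => X n ω) : ℝ≥0∞) ∂P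
        ≤ (⨅ ε ∈ Set.Icc (0 : ℝ) ε₀, ⨅ x ∈ Set.Icc (0 : ℝ) (1 / ((K : ℝ) - 1)),
            max (TtermRefined (means ν) ε₀ γ s δ ε x + 1)
              (ENNReal.ofReal (StermRefined (means ν) ε₀ γ s ε x)))
          + ENNReal.ofReal ((riemannZeta (s : ℂ)).re * ((K : ℝ) * ((K : ℝ) + 1) / 2))) := by
  have hK' : (2 : ℝ) ≤ K := by exact_mod_cast hK
  refine ⟨fun ε₁ hε₁ => hrun.measure_recommend_bad_le hK hν hδ₀ (hε₀.le.trans hε₁) halg, fun γ hγ => ?_,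
    fun ε₁ hε₁ => lintegral_mono fun ω => ENat.toENNReal_le.2 (stoppingTime_anti hε₁ _ _ _),
    fun γ hγ s hs => ?_⟩
  · rw [← tsub_le_iff_right]
    refine le_iInf₂ fun ε hε => ?_
    rw [tsub_le_iff_right]
    have hx : (0 : ℝ) ∈ Set.Icc (0 : ℝ) (1 / ((K : ℝ) - 1)) :=
      ⟨le_rfl, by have : 0 < (K : ℝ) - 1 := by linarith
                  positivity⟩
    have hav : 0 ≤ aconst (means ν) ε₀ ε := mul_nonneg ENNReal.toReal_nonneg
      (Real.iInf_nonneg fun i => minAlloc_nonneg hK _ _ _)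
    have hγ0 := hγ.1
    refine (hrun.lintegral_stoppingTime_le hK hν hε₀ δ halg hε hx hγ one_lt_two
      (y := (1 + γ⁻¹) * (K : ℝ) ^ 2 / aconst (means ν) ε₀ ε + 1) ?_).trans ?_
    · rw [← aconst_eq hK]
      have : 3 * (K : ℝ) ^ 2 / 4 + 1 ≤ (K : ℝ) ^ 2 := by nlinarith
      gcongr
    · rw [← aconst_eq hK, ← Tterm_eq, Sterm]
      refine add_le_add (le_of_eq ?_) ?_
      · norm_num
      · rw [show (2 : ℝ≥0∞) * (K : ℝ≥0∞) ^ 2 = ENNReal.ofReal (2 * (K : ℝ) ^ 2) by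
          rw [ENNReal.ofReal_mul (by norm_num), ENNReal.ofReal_pow (by positivity),
            ENNReal.ofReal_natCast, ENNReal.ofReal_ofNat]]
        refine ENNReal.ofReal_le_ofReal ?_
        calc _ ≤ 2 * ((K : ℝ) * ((K : ℝ) + 1) / 2) := by
              gcongr
              exact riemannZeta_two_re_le
          _ ≤ _ := by nlinarith
  · rw [← tsub_le_iff_right]
    refine le_iInf₂ fun ε hε => le_iInf₂ fun x hx => ?_
    rw [tsub_le_iff_right]
    exact hrun.lintegral_stoppingTime_le hK hν hε₀ δ halg hε hx hγ hs le_rfl
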